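/- Let $X\sim\mathcal N(0,I_d)$ and let $p=(p_1,\dots,p_r):\mathbb R^d\to\mathbb R^r$ be a function whose components $p_i$ are twice weakly differentiable (that is, $p_i$ and its weak gradient $\nabla p_i$ and weak Hessian $\nabla^2 p_i$ are locally integrable functions; for instance, $p\in C^2$), with $\mathbb E\|p(X)\|_2^2<\infty$, $\mathbb E[p(X)]=0$ and $\mathrm{Cov}(p(X),p(X))=I_r$. Then $$W_1\bigl(\mathrm{Law}(p(X)),\mathcal N(0,I_r)\bigr)\le\frac{4}{\sqrt\pi}\Bigl(\sum_{i=1}^r\mathbb E\bigl[\|\nabla p_i(X)\|_2^4\bigr]^{1/4}\Bigr)\Bigl(\sum_{j=1}^r\mathbb E\bigl[\|\nabla^2p_j(X)\|_{\mathrm{op}}^4\bigr]^{1/4}\Bigr).$$ Here $W_1(\mu,\nu)=\inf_\pi\int\|y-z\|_2\,d\pi(y,z)$ is the Wasserstein-1 distance, the infimum being over all couplings $\pi$ of $\mu$ and $\nu$; both sides are read in $[0,\infty]$ (the bound is trivial if its right-hand side is infinite), and $\|\cdot\|_{\mathrm{op}}$ is the operator norm for the Euclidean norm. -/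

import Mathlib

open MeasureTheory ProbabilityTheory
open scoped ENNReal

/-- A measure `π` on `E × E` is a coupling of `μ` and `ν` if its marginals are `μ` and `ν`. -/
def IsCoupling {E : Type*} [MeasurableSpace E] (π : Measure (E × E)) (μ ν : Measure E) : Prop :=
  π.map Prod.fst = μ ∧ π.map Prod.snd = ν

/-- The Wasserstein-1 distance: the infimum of the transport cost `∫ dist(y, z) dπ(y, z)` over all
couplings `π` of `μ` and `ν`, as an extended nonnegative real. -/
noncomputable def wassersteinOne {E : Type*} [PseudoEMetricSpace E] [MeasurableSpace E]
    (μ ν : Measure E) : ℝ≥0∞ :=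
  ⨅ (π : Measure (E × E)) (_ : IsCoupling π μ ν), ∫⁻ z, edist z.1 z.2 ∂π

/-- `f'` is a weak derivative of `f : ℝ^d → F`: both are locally integrable for the Lebesgue
measure, and `∫ (∂_v φ) f = - ∫ φ (f' v)` for all test functions `φ ∈ C_c^∞(ℝ^d)` and all
directions `v`. -/
structure HasWeakFDeriv {d : ℕ} {F : Type*} [NormedAddCommGroup F] [NormedSpace ℝ F]
    (f : EuclideanSpace ℝ (Fin d) → F)
    (f' : EuclideanSpace ℝ (Fin d) → EuclideanSpace ℝ (Fin d) →L[ℝ] F) : Prop where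
  locallyIntegrable : LocallyIntegrable f volume
  locallyIntegrable_deriv : LocallyIntegrable f' volume
  integral_eq : ∀ φ : EuclideanSpace ℝ (Fin d) → ℝ, ContDiff ℝ (⊤ : ℕ∞) φ → HasCompactSupport φ →
    ∀ v : EuclideanSpace ℝ (Fin d),
      ∫ x, (fderiv ℝ φ x v) • f x = - ∫ x, φ x • f' x v

/-- The vector field `G` is a weak gradient of `u : ℝ^d → ℝ`. -/
def HasWeakGradient {d : ℕ} (u : EuclideanSpace ℝ (Fin d) → ℝ)
    (G : EuclideanSpace ℝ (Fin d) → EuclideanSpace ℝ (Fin d)) : Prop :=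
  HasWeakFDeriv u (fun x => innerSL ℝ (G x))

/-- `G` and `H` are the weak gradient `∇u` and the weak Hessian `∇²u` of `u : ℝ^d → ℝ`; the Hessian
at a point is a linear map `ℝ^d → ℝ^d`, the derivative of the gradient. -/
def HasWeakGradientHessian {d : ℕ} (u : EuclideanSpace ℝ (Fin d) → ℝ)
    (G : EuclideanSpace ℝ (Fin d) → EuclideanSpace ℝ (Fin d))
    (H : EuclideanSpace ℝ (Fin d) → EuclideanSpace ℝ (Fin d) →L[ℝ] EuclideanSpace ℝ (Fin d)) :
    Prop :=
  HasWeakGradient u G ∧ HasWeakFDeriv G H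

/-! By Kantorovich-Rubinstein duality it suffices to compare E h(p(X)) with E h(N), N standard
Gaussian, for smooth 1-Lipschitz h. The comparison interpolates between N and p(X) and is controlled
by a Stein kernel of p(X).

Let X' be an independent copy of X and X_t = cos t X + sin t X'. Rotations preserve the law of (X,
X'), so differentiating E[f(X) g(X_t)] in t and integrating by parts gives Cov(f(X), g(X)) = E
∫_0^{π/2} sin t ⟨∇f(X), ∇g(X_t)⟩ dt (`integral_mul_sub_stdGaussian`). Conditionally on X, the
right-hand side for p_i, p_j is a random variable T_ij (`steinKernel`) with mean Cov(p_i, p_j) =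
δ_ij, and E[k_j(p) p_j] = Σ_i E[∂_i k_j(p) T_ij] for every smooth k with the relevant bounds.

Take k = ∇h and W_θ = cos θ N + sin θ p(X), with N independent of X. The derivative of E h(W_θ) in θ
is sin θ Σ_ij E[M_ij (T_ij - δ_ij)], where M_ij = cos θ E[∂_i k_j(W_θ) | X]. Integration by parts in
N turns M_ij into E[k_j(W_θ) N_i | X], hence |M_ij| ≤ E|N_i| = √(2/π), however large the Hessian of
h is. Therefore |E h(p(X)) - E h(N)| ≤ √(2/π) Σ_ij E|T_ij - δ_ij|
(`abs_integral_comp_sub_integral_stdGaussian_le`).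

The deviation of T_ij from its mean is bounded by the L¹ Poincaré inequality E|Q(X) - Q(X')| ≤ (π/2)
E‖∇Q(X)‖ (`integral_abs_sub_le_stdGaussian`), applied to x ↦ ⟨∇p_i(x), ∇p_j(cos t x + sin t y)⟩ with
t and y frozen. Cauchy-Schwarz leaves products of L² norms of gradients and Hessians, weighted by ∫
sin = 1 and ∫ sin cos = 1/2; summing over i, j gives the constant 3π/4. Finally √(2/π) · 3π/4 <
4/√π, and L² norms are at most L⁴ norms.

This is carried out for bounded functions with bounded continuous derivatives. Weakly differentiable
p are reached by mollification and cutoff, which raise the L² norms of the derivatives by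
arbitrarily little (`HasWeakGradientHessian.exists_smooth_approx`). The duality rests on Hahn-Banach
separation for finite probability vectors (`exists_transportPlan_of_forall_lipschitz`). -/

/-! ### Gaussian density, integration by parts, rotation invariance and absolute first moments. -/

section GaussianDensity

open scoped RealInnerProductSpace

variable {E : Type*} [NormedAddCommGroup E] [InnerProductSpace ℝ E]

/-- The density of the standard Gaussian measure with respect to the Lebesgue measure. -/
noncomputable def gaussianDensity (x : E) : ℝ :=
  ((2 * Real.pi) ^ ((Module.finrank ℝ E : ℝ) / 2))⁻¹ * Real.exp (-(1 / 2) * ‖x‖ ^ 2)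

lemma gaussianDensity_pos (x : E) : 0 < gaussianDensity x := by
  unfold gaussianDensity; positivity

lemma continuous_gaussianDensity : Continuous (gaussianDensity (E := E)) := by
  unfold gaussianDensity; fun_prop

lemma gaussianDensity_le (x : E) :
    gaussianDensity x ≤ ((2 * Real.pi) ^ ((Module.finrank ℝ E : ℝ) / 2))⁻¹ := by
  unfold gaussianDensity
  apply mul_le_of_le_one_right (by positivity)
  rw [Real.exp_le_one_iff]; nlinarith [sq_nonneg ‖x‖]

lemma hasFDerivAt_gaussianDensity (x : E) :
    HasFDerivAt gaussianDensity (-(gaussianDensity x) • innerSL ℝ x) x := by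
  have h := (((hasStrictFDerivAt_norm_sq x).hasFDerivAt.const_mul (-(1 / 2 : ℝ))).exp).const_mul
    ((2 * Real.pi) ^ ((Module.finrank ℝ E : ℝ) / 2))⁻¹
  refine h.congr_fderiv ?_
  ext v
  simp [gaussianDensity]
  ring

variable [FiniteDimensional ℝ E] [MeasurableSpace E] [BorelSpace E]

lemma integral_gaussianDensity : ∫ x : E, gaussianDensity x = 1 := by
  unfold gaussianDensity
  rw [integral_const_mul, GaussianFourier.integral_rexp_neg_mul_sq_norm (by norm_num)]
  rw [show Real.pi / (1 / 2) = 2 * Real.pi by ring]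
  exact inv_mul_cancel₀ (by positivity)

lemma integrable_gaussianDensity : Integrable (gaussianDensity (E := E)) := by
  by_contra h
  have := integral_gaussianDensity (E := E)
  rw [integral_undef h] at this
  exact zero_ne_one this

/-- Both sides are finite measures with characteristic function exp(-‖t‖²/2). -/
lemma stdGaussian_eq_withDensity :
    stdGaussian E = volume.withDensity (fun x => ENNReal.ofReal (gaussianDensity x)) := by
  have hp : IsProbabilityMeasure
      ((volume : Measure E).withDensity (fun x => ENNReal.ofReal (gaussianDensity x))) := by
    constructor
    rw [withDensity_apply _ MeasurableSet.univ, Measure.restrict_univ,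
      ← ofReal_integral_eq_lintegral_ofReal integrable_gaussianDensity
        (ae_of_all _ fun x => (gaussianDensity_pos x).le), integral_gaussianDensity]
    simp
  apply Measure.ext_of_charFun
  ext t
  rw [charFun_stdGaussian, charFun_apply]
  have h1 : ∀ x : E, ENNReal.ofReal (gaussianDensity x) = ((gaussianDensity x).toNNReal : ℝ≥0∞) :=
    fun x => rfl
  simp_rw [h1]
  rw [integral_withDensity_eq_integral_smul
    (continuous_gaussianDensity.measurable.real_toNNReal)]
  have h2 : ∀ x : E, (gaussianDensity x).toNNReal • Complex.exp (⟪x, t⟫ * Complex.I) =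
      (((2 * Real.pi) ^ ((Module.finrank ℝ E : ℝ) / 2))⁻¹ : ℝ) *
        Complex.exp (-(1 / 2 : ℂ) * ‖x‖ ^ 2 + Complex.I * ⟪t, x⟫) := by
    intro x
    rw [NNReal.smul_def, Real.coe_toNNReal _ (gaussianDensity_pos x).le, Complex.real_smul,
      gaussianDensity, Complex.ofReal_mul, mul_assoc, Complex.exp_add, Complex.ofReal_exp,
      real_inner_comm t x, mul_comm Complex.I]
    push_cast
    rfl
  simp_rw [h2]
  rw [integral_const_mul, GaussianFourier.integral_cexp_neg_mul_sq_norm_add (by norm_num)]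
  rw [show (Real.pi : ℂ) / (1 / 2) = ((2 * Real.pi : ℝ) : ℂ) by push_cast; ring, ← mul_assoc]
  rw [show ((Module.finrank ℝ E : ℂ) / 2) = (((Module.finrank ℝ E : ℝ) / 2 : ℝ) : ℂ) by push_cast; rfl,
    ← Complex.ofReal_cpow (by positivity), ← Complex.ofReal_mul, inv_mul_cancel₀ (by positivity)]
  simp only [Complex.I_sq, Complex.ofReal_one, one_mul]
  congr 1; ring

lemma integral_stdGaussian {F : Type*} [NormedAddCommGroup F] [NormedSpace ℝ F] (f : E → F) :
    ∫ x, f x ∂(stdGaussian E) = ∫ x, gaussianDensity x • f x := by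
  rw [stdGaussian_eq_withDensity]
  have h1 : ∀ x : E, ENNReal.ofReal (gaussianDensity x) = ((gaussianDensity x).toNNReal : ℝ≥0∞) :=
    fun x => rfl
  simp_rw [h1]
  rw [integral_withDensity_eq_integral_smul
    (continuous_gaussianDensity.measurable.real_toNNReal)]
  simp_rw [NNReal.smul_def, Real.coe_toNNReal _ (gaussianDensity_pos _).le]

lemma integrable_stdGaussian_iff {F : Type*} [NormedAddCommGroup F] [NormedSpace ℝ F] {f : E → F} :
    Integrable f (stdGaussian E) ↔ Integrable (fun x => gaussianDensity x • f x) := by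
  rw [stdGaussian_eq_withDensity]
  have h1 : ∀ x : E, ENNReal.ofReal (gaussianDensity x) = ((gaussianDensity x).toNNReal : ℝ≥0∞) :=
    fun x => rfl
  simp_rw [h1]
  rw [integrable_withDensity_iff_integrable_smul
    (continuous_gaussianDensity.measurable.real_toNNReal)]
  simp_rw [NNReal.smul_def, Real.coe_toNNReal _ (gaussianDensity_pos _).le]

lemma integrable_norm_stdGaussian : Integrable (fun x : E => ‖x‖) (stdGaussian E) :=
  (IsGaussian.integrable_id (μ := stdGaussian E)).norm

/-- Gaussian integration by parts. -/
lemma integral_inner_mul_stdGaussian {u : E → ℝ} {u' : E → E →L[ℝ] ℝ}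
    (hu : ∀ x, HasFDerivAt u (u' x) x) (hu'c : Continuous u') {C C' : ℝ}
    (hC : ∀ x, |u x| ≤ C) (hC' : ∀ x, ‖u' x‖ ≤ C') (v : E) :
    ∫ x, u x * ⟪v, x⟫ ∂(stdGaussian E) = ∫ x, u' x v ∂(stdGaussian E) := by
  have hc : Continuous u := continuous_iff_continuousAt.2 fun x => (hu x).continuousAt
  have hi1 : Integrable (fun x => u' x v) (stdGaussian E) :=
    .of_bound (by fun_prop) (C' * ‖v‖) (ae_of_all _ fun x =>
      ((u' x).le_opNorm v).trans (by gcongr; exact hC' x))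
  have hi2 : Integrable (fun x => u x * ⟪v, x⟫) (stdGaussian E) := by
    refine (integrable_norm_stdGaussian.const_mul (C * ‖v‖)).mono' (by fun_prop)
      (ae_of_all _ fun x => ?_)
    rw [norm_mul, mul_assoc]
    have := abs_real_inner_le_norm v x
    have h0 : 0 ≤ C := (abs_nonneg _).trans (hC x)
    simp only [Real.norm_eq_abs]
    gcongr
    exact hC x
  have hi3 : Integrable u (stdGaussian E) := .of_bound (by fun_prop) C (ae_of_all _ hC)
  rw [integrable_stdGaussian_iff] at hi1 hi2 hi3
  -- The density g satisfies ∂_v g = -⟨v, x⟩ g, so the claim is Lebesgue integration by parts of u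
  -- against g.
  have hgd : ∀ x : E, (fderiv ℝ gaussianDensity x) v = -(gaussianDensity x * ⟪v, x⟫) := by
    intro x
    rw [(hasFDerivAt_gaussianDensity x).fderiv]
    simp [real_inner_comm]
  have hud : ∀ x, fderiv ℝ u x = u' x := fun x => (hu x).fderiv
  have key := integral_mul_fderiv_eq_neg_fderiv_mul_of_integrable (μ := (volume : Measure E))
    (f := u) (g := gaussianDensity) (v := v) ?_ ?_ ?_
    (fun x _ => (hu x).differentiableAt)
    (fun x _ => (hasFDerivAt_gaussianDensity x).differentiableAt)
  · rw [integral_stdGaussian, integral_stdGaussian]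
    simp_rw [hgd, hud] at key
    simp only [smul_eq_mul]
    have e1 : ∀ x : E, u x * -(gaussianDensity x * ⟪v, x⟫) = -(gaussianDensity x * (u x * ⟪v, x⟫)) := by
      intro x; ring
    simp_rw [e1] at key
    rw [integral_neg, neg_inj] at key
    rw [key]
    simp_rw [mul_comm]
  · simp_rw [hud, mul_comm]; exact hi1
  · simp_rw [hgd]
    refine hi2.neg.congr (ae_of_all _ fun x => ?_)
    simp only [Pi.neg_apply, smul_eq_mul]; ring
  · exact hi3.congr (ae_of_all _ fun x => mul_comm _ _)

/-- The rotation by the angle `θ` preserves the product of two standard Gaussian measures. -/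
lemma measurePreserving_rotation_stdGaussian (θ : ℝ) :
    MeasurePreserving
      (fun z : E × E => (Real.cos θ • z.1 + Real.sin θ • z.2, -Real.sin θ • z.1 + Real.cos θ • z.2))
      ((stdGaussian E).prod (stdGaussian E)) ((stdGaussian E).prod (stdGaussian E)) := by
  refine ⟨by fun_prop, ?_⟩
  have := IsGaussian.map_rotation_eq_self (μ := stdGaussian E) (by simp) θ
  have e : (fun z : E × E => (Real.cos θ • z.1 + Real.sin θ • z.2,
      -Real.sin θ • z.1 + Real.cos θ • z.2)) = ContinuousLinearMap.rotation θ := by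
    ext1 z; rw [ContinuousLinearMap.rotation_apply]
  rw [e, this]

lemma integrable_inner_stdGaussian (v : E) : Integrable (fun x => ⟪v, x⟫) (stdGaussian E) :=
  (IsGaussian.integrable_id (μ := stdGaussian E)).const_inner v

/-- Nonnegativity of the variance of |L| gives (E|L|)² ≤ E L² = ‖L‖². -/
lemma integral_abs_clm_le_stdGaussian (L : E →L[ℝ] ℝ) :
    ∫ x, |L x| ∂(stdGaussian E) ≤ ‖L‖ := by
  have h := variance_dual_stdGaussian L
  rw [variance_of_integral_eq_zero (by fun_prop) (integral_strongDual_stdGaussian _)] at h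
  have hm : MemLp (fun x => L x) 2 (stdGaussian E) :=
    L.comp_memLp' (IsGaussian.memLp_two_id (μ := stdGaussian E))
  have h2 := variance_nonneg (fun x => |L x|) (stdGaussian E)
  rw [variance_eq_sub (show MemLp (fun x => |L x|) 2 (stdGaussian E) from hm.abs)] at h2
  simp only [Pi.pow_apply, sq_abs] at h2
  rw [h] at h2
  exact (abs_le_of_sq_le_sq' (by linarith) (norm_nonneg _)).2

lemma map_inner_stdGaussian {v : E} (hv : ‖v‖ = 1) :
    (stdGaussian E).map (fun x => ⟪v, x⟫) = gaussianReal 0 1 := by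
  have h := IsGaussian.map_eq_gaussianReal (μ := stdGaussian E) (innerSL ℝ v)
  rw [integral_strongDual_stdGaussian, variance_dual_stdGaussian] at h
  simpa [hv] using h

lemma integral_abs_gaussianReal : ∫ x, |x| ∂(gaussianReal 0 1) = Real.sqrt (2 / Real.pi) := by
  rw [integral_gaussianReal_eq_integral_smul (by norm_num)]
  have h := integral_comp_abs (f := fun x => gaussianPDFReal 0 1 x * x)
  have h1 : ∀ x : ℝ, gaussianPDFReal 0 1 x • |x| = gaussianPDFReal 0 1 |x| * |x| := by
    intro x; simp [gaussianPDFReal]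
  simp_rw [h1, h]
  have h2 := integral_rpow_mul_exp_neg_mul_rpow (p := 2) (q := 1) (b := 1 / 2)
    (by norm_num) (by norm_num) (by norm_num)
  norm_num at h2
  have h3 : ∀ x : ℝ, gaussianPDFReal 0 1 x * x =
      (Real.sqrt (2 * Real.pi))⁻¹ * (x * Real.exp (-(1 / 2 * x ^ 2))) := by
    intro x; simp [gaussianPDFReal]; ring_nf
  simp_rw [h3]
  rw [integral_const_mul, h2]
  rw [Real.sqrt_mul (by norm_num), Real.sqrt_div (by norm_num)]
  have := Real.sq_sqrt (show (0 : ℝ) ≤ 2 by norm_num)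
  have h4 : 0 < Real.sqrt 2 := by positivity
  have h5 : 0 < Real.sqrt Real.pi := by positivity
  field_simp
  nlinarith

/-- Source of the factor √(2/π) in the Gaussian approximation bound. -/
lemma integral_abs_inner_stdGaussian {v : E} (hv : ‖v‖ = 1) :
    ∫ x, |⟪v, x⟫| ∂(stdGaussian E) = Real.sqrt (2 / Real.pi) := by
  rw [← integral_abs_gaussianReal, ← map_inner_stdGaussian hv, integral_map (by fun_prop)
    (by fun_prop)]

end GaussianDensity

/-! ### Rotation interpolation: covariance formula and L¹ Poincaré inequality. -/

section GaussianInterpolation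

open scoped RealInnerProductSpace

/-- The probability measure `sin t dt` on `(0, π/2]`. -/
noncomputable def sinMeasure : Measure ℝ :=
  (volume.restrict (Set.Ioc 0 (Real.pi / 2))).withDensity (fun t => ENNReal.ofReal (Real.sin t))

lemma integral_sinMeasure {F : Type*} [NormedAddCommGroup F] [NormedSpace ℝ F] (f : ℝ → F) :
    ∫ t, f t ∂sinMeasure = ∫ t in (0 : ℝ)..(Real.pi / 2), Real.sin t • f t := by
  unfold sinMeasure
  have h1 : ∀ t, ENNReal.ofReal (Real.sin t) = ((Real.sin t).toNNReal : ℝ≥0∞) := fun t => rfl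
  simp_rw [h1]
  rw [integral_withDensity_eq_integral_smul (Real.continuous_sin.measurable.real_toNNReal),
    intervalIntegral.integral_of_le (by positivity)]
  refine setIntegral_congr_fun measurableSet_Ioc fun t ht => ?_
  simp only [NNReal.smul_def]
  rw [Real.coe_toNNReal _ (Real.sin_nonneg_of_nonneg_of_le_pi ht.1.le
    (by linarith [ht.2, Real.pi_pos]))]

instance : IsProbabilityMeasure sinMeasure := by
  constructor
  unfold sinMeasure
  rw [withDensity_apply _ MeasurableSet.univ, Measure.restrict_univ,
    ← ofReal_integral_eq_lintegral_ofReal, ← intervalIntegral.integral_of_le (by positivity)]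
  · simp
  · exact (intervalIntegrable_iff_integrableOn_Ioc_of_le (by positivity)).1
      (Real.continuous_sin.intervalIntegrable _ _)
  · refine (ae_restrict_iff' measurableSet_Ioc).2 (ae_of_all _ fun t ht => ?_)
    exact Real.sin_nonneg_of_nonneg_of_le_pi ht.1.le (by linarith [ht.2, Real.pi_pos])

lemma integral_cos_sinMeasure : ∫ t, Real.cos t ∂sinMeasure = 1 / 2 := by
  rw [integral_sinMeasure]
  simp [integral_sin_mul_cos₁]

lemma ae_sinMeasure_cos_nonneg : ∀ᵐ t ∂sinMeasure, 0 ≤ Real.cos t := by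
  refine (withDensity_absolutelyContinuous _ _).ae_le ?_
  refine (ae_restrict_iff' measurableSet_Ioc).2 (ae_of_all _ fun t ht => ?_)
  exact Real.cos_nonneg_of_neg_pi_div_two_le_of_le (by linarith [ht.1, Real.pi_pos]) ht.2

/-- Disposes of most integrability conditions of the smooth case, where the functions concerned are
bounded and continuous. -/
lemma Continuous.integrable_of_forall_norm_le {α F : Type*} [TopologicalSpace α]
    [MeasurableSpace α] [OpensMeasurableSpace α] [NormedAddCommGroup F]
    [SecondCountableTopologyEither α F] {μ : Measure α} [IsFiniteMeasure μ]
    {f : α → F} (hf : Continuous f) {C : ℝ} (hC : ∀ x, ‖f x‖ ≤ C) : Integrable f μ :=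
  .of_bound hf.aestronglyMeasurable C (ae_of_all _ hC)

variable {E : Type*} [NormedAddCommGroup E] [InnerProductSpace ℝ E]

lemma norm_rotation_deriv_le (t : ℝ) (x y : E) :
    ‖-Real.sin t • x + Real.cos t • y‖ ≤ ‖x‖ + ‖y‖ := by
  refine (norm_add_le _ _).trans ?_
  rw [norm_smul, norm_smul, norm_neg]
  have h1 := Real.abs_sin_le_one t
  have h2 := Real.abs_cos_le_one t
  simp only [Real.norm_eq_abs]
  exact add_le_add (mul_le_of_le_one_left (norm_nonneg _) h1)
    (mul_le_of_le_one_left (norm_nonneg _) h2)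

lemma hasDerivAt_rotation (x y : E) (t : ℝ) :
    HasDerivAt (fun t => Real.cos t • x + Real.sin t • y) (-Real.sin t • x + Real.cos t • y) t :=
  ((Real.hasDerivAt_cos t).smul_const x).add ((Real.hasDerivAt_sin t).smul_const y)

variable [FiniteDimensional ℝ E] [MeasurableSpace E] [BorelSpace E]

lemma integrable_norm_add_norm_stdGaussian_prod :
    Integrable (fun z : E × E => ‖z.1‖ + ‖z.2‖) ((stdGaussian E).prod (stdGaussian E)) :=
  (integrable_norm_stdGaussian.comp_fst _).add (integrable_norm_stdGaussian.comp_snd _)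

lemma integral_comp_rotation_stdGaussian {F : Type*} [NormedAddCommGroup F] [NormedSpace ℝ F]
    (θ : ℝ) {f : E × E → F} (hf : Continuous f) :
    ∫ z, f (Real.cos θ • z.1 + Real.sin θ • z.2, -Real.sin θ • z.1 + Real.cos θ • z.2)
      ∂((stdGaussian E).prod (stdGaussian E)) =
    ∫ z, f z ∂((stdGaussian E).prod (stdGaussian E)) := by
  have h := measurePreserving_rotation_stdGaussian (E := E) θ
  conv_rhs => rw [← h.map_eq]
  rw [integral_map h.measurable.aemeasurable hf.aestronglyMeasurable]

/-- The derivative in `θ` of the correlation of `f (X)` and `g (cos θ X + sin θ X')`. -/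
lemma hasDerivAt_integral_mul_comp_rotation {f g : E → ℝ} {F G : E → E}
    (hf : ∀ x, HasFDerivAt f (innerSL ℝ (F x)) x) (hg : ∀ x, HasFDerivAt g (innerSL ℝ (G x)) x)
    (hFc : Continuous F) (hGc : Continuous G) {C : ℝ} (hfC : ∀ x, |f x| ≤ C)
    (hgC : ∀ x, |g x| ≤ C) (hFC : ∀ x, ‖F x‖ ≤ C) (hGC : ∀ x, ‖G x‖ ≤ C) (θ : ℝ) :
    HasDerivAt (fun t => ∫ z : E × E, f z.1 * g (Real.cos t • z.1 + Real.sin t • z.2)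
        ∂((stdGaussian E).prod (stdGaussian E)))
      (-Real.sin θ * ∫ z : E × E, ⟪F z.1, G (Real.cos θ • z.1 + Real.sin θ • z.2)⟫
        ∂((stdGaussian E).prod (stdGaussian E))) θ := by
  have hC0 : 0 ≤ C := (abs_nonneg _).trans (hfC 0)
  have hfc : Continuous f := continuous_iff_continuousAt.2 fun x => (hf x).continuousAt
  have hgc : Continuous g := continuous_iff_continuousAt.2 fun x => (hg x).continuousAt
  have h1 := hasDerivAt_integral_of_dominated_loc_of_deriv_le
    (μ := (stdGaussian E).prod (stdGaussian E)) (x₀ := θ) (s := Set.univ)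
    (F := fun t (z : E × E) => f z.1 * g (Real.cos t • z.1 + Real.sin t • z.2))
    (F' := fun t (z : E × E) => f z.1 * ⟪G (Real.cos t • z.1 + Real.sin t • z.2),
      -Real.sin t • z.1 + Real.cos t • z.2⟫)
    (bound := fun z => C * (C * (‖z.1‖ + ‖z.2‖))) Filter.univ_mem
    (Filter.Eventually.of_forall fun t => by fun_prop)
    (Continuous.integrable_of_forall_norm_le (C := C * C) (by fun_prop) fun z => by
      rw [norm_mul]; exact mul_le_mul (hfC _) (hgC _) (norm_nonneg _) hC0)
    (by fun_prop)
    (ae_of_all _ fun z t _ => by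
      rw [norm_mul]
      refine mul_le_mul (hfC _) ?_ (norm_nonneg _) hC0
      refine (norm_inner_le_norm _ _).trans ?_
      exact mul_le_mul (hGC _) (norm_rotation_deriv_le _ _ _) (norm_nonneg _) hC0)
    ((integrable_norm_add_norm_stdGaussian_prod.const_mul C).const_mul C)
    (ae_of_all _ fun z t _ => by
      have := ((hg _).comp_hasDerivAt t (hasDerivAt_rotation z.1 z.2 t)).const_mul (f z.1)
      simpa using this)
  refine h1.2.congr_deriv ?_
  -- The inverse rotation recovers X from X_θ and its velocity. After the change of variables these
  -- two become a fresh independent pair, in which X reads cos θ z.1 - sin θ z.2.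
  have e1 : ∀ z : E × E, z.1 = Real.cos θ • (Real.cos θ • z.1 + Real.sin θ • z.2) -
      Real.sin θ • (-Real.sin θ • z.1 + Real.cos θ • z.2) := by
    intro z
    have := Real.sin_sq_add_cos_sq θ
    have e : Real.cos θ • (Real.cos θ • z.1 + Real.sin θ • z.2) -
      Real.sin θ • (-Real.sin θ • z.1 + Real.cos θ • z.2) =
      (Real.sin θ ^ 2 + Real.cos θ ^ 2) • z.1 := by module
    rw [e, this, one_smul]
  have e2 := integral_comp_rotation_stdGaussian (E := E) θ
    (f := fun z => f (Real.cos θ • z.1 - Real.sin θ • z.2) * ⟪G z.1, z.2⟫) (by fun_prop)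
  have e3 := integral_comp_rotation_stdGaussian (E := E) θ
    (f := fun z => ⟪F (Real.cos θ • z.1 - Real.sin θ • z.2), G z.1⟫) (by fun_prop)
  simp only [← e1] at e2 e3
  rw [e2, e3, ← integral_const_mul, integral_prod, integral_prod]
  · congr 1
    ext x
    -- With the first variable fixed, integration by parts in the second removes the linear factor;
    -- the chain rule produces -sin θ.
    have := integral_inner_mul_stdGaussian (u := fun y => f (Real.cos θ • x - Real.sin θ • y))
      (u' := fun y => -Real.sin θ • innerSL ℝ (F (Real.cos θ • x - Real.sin θ • y)))
      (fun y => ?_) (by fun_prop) (fun y => hfC _) (C' := |Real.sin θ| * C) (fun y => ?_) (G x)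
    · rw [this]
      simp
    · have hd : HasFDerivAt (fun y : E => Real.cos θ • x - Real.sin θ • y)
          (-(Real.sin θ • ContinuousLinearMap.id ℝ E)) y :=
        ((hasFDerivAt_id y).const_smul (Real.sin θ)).const_sub _
      refine ((hf _).comp y hd).congr_fderiv ?_
      ext v; simp
    · rw [norm_smul, norm_neg, innerSL_apply_norm]
      exact mul_le_mul_of_nonneg_left (hFC _) (abs_nonneg _)
  · refine (Continuous.integrable_of_forall_norm_le (C := C * C) (by fun_prop) fun z => ?_).const_mul _
    exact (norm_inner_le_norm _ _).trans (mul_le_mul (hFC _) (hGC _) (norm_nonneg _) hC0)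
  · refine ((integrable_norm_add_norm_stdGaussian_prod.const_mul C).const_mul C).mono'
      (by fun_prop) (ae_of_all _ fun z => ?_)
    rw [norm_mul]
    refine mul_le_mul (hfC _) ?_ (norm_nonneg _) hC0
    refine (norm_inner_le_norm _ _).trans ?_
    exact mul_le_mul (hGC _) (by simp) (norm_nonneg _) hC0

/-- The covariance of two functions of a Gaussian vector in terms of their gradients. -/
lemma integral_mul_sub_stdGaussian {f g : E → ℝ} {F G : E → E}
    (hf : ∀ x, HasFDerivAt f (innerSL ℝ (F x)) x) (hg : ∀ x, HasFDerivAt g (innerSL ℝ (G x)) x)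
    (hFc : Continuous F) (hGc : Continuous G) {C : ℝ} (hfC : ∀ x, |f x| ≤ C)
    (hgC : ∀ x, |g x| ≤ C) (hFC : ∀ x, ‖F x‖ ≤ C) (hGC : ∀ x, ‖G x‖ ≤ C) :
    ∫ x, f x * g x ∂(stdGaussian E) - (∫ x, f x ∂(stdGaussian E)) * ∫ x, g x ∂(stdGaussian E) =
      ∫ x, ∫ q : ℝ × E, ⟪F x, G (Real.cos q.1 • x + Real.sin q.1 • q.2)⟫
        ∂(sinMeasure.prod (stdGaussian E)) ∂(stdGaussian E) := by
  have hC0 : 0 ≤ C := (abs_nonneg _).trans (hfC 0)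
  have hfc : Continuous f := continuous_iff_continuousAt.2 fun x => (hf x).continuousAt
  have hgc : Continuous g := continuous_iff_continuousAt.2 fun x => (hg x).continuousAt
  have hb : ∀ x y : E, ‖⟪F x, G y⟫‖ ≤ C * C := fun x y =>
    (norm_inner_le_norm _ _).trans (mul_le_mul (hFC _) (hGC _) (norm_nonneg _) hC0)
  have hJ : Continuous fun t : ℝ => ∫ z : E × E,
      ⟪F z.1, G (Real.cos t • z.1 + Real.sin t • z.2)⟫ ∂((stdGaussian E).prod (stdGaussian E)) :=
    continuous_of_dominated (bound := fun _ => C * C) (fun t => by fun_prop)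
      (fun t => ae_of_all _ fun z => hb _ _) (integrable_const _)
      (ae_of_all _ fun z => by fun_prop)
  -- The correlation equals E[fg] at t = 0 and E[f] E[g] at t = π/2.
  have h1 := intervalIntegral.integral_eq_sub_of_hasDerivAt (a := 0) (b := Real.pi / 2)
    (fun t _ => hasDerivAt_integral_mul_comp_rotation hf hg hFc hGc hfC hgC hFC hGC t)
    (Continuous.intervalIntegrable (by fun_prop) _ _)
  simp only [Real.cos_pi_div_two, Real.sin_pi_div_two, Real.cos_zero, Real.sin_zero, one_smul,
    zero_smul, zero_add, add_zero] at h1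
  rw [integral_prod_mul, integral_fun_fst (f := fun x : E => f x * g x)] at h1
  simp only [probReal_univ, one_smul, neg_mul, intervalIntegral.integral_neg] at h1
  have h2 := integral_sinMeasure (fun t : ℝ => ∫ z : E × E,
      ⟪F z.1, G (Real.cos t • z.1 + Real.sin t • z.2)⟫ ∂((stdGaussian E).prod (stdGaussian E)))
  simp only [smul_eq_mul] at h2
  rw [← h2] at h1
  have h3 : ∀ t : ℝ, ∫ z : E × E,
      ⟪F z.1, G (Real.cos t • z.1 + Real.sin t • z.2)⟫ ∂((stdGaussian E).prod (stdGaussian E)) =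
      ∫ x, ∫ y, ⟪F x, G (Real.cos t • x + Real.sin t • y)⟫ ∂(stdGaussian E) ∂(stdGaussian E) :=
    fun t => integral_prod _ (Continuous.integrable_of_forall_norm_le (by fun_prop) fun z => hb _ _)
  simp_rw [h3] at h1
  rw [integral_integral_swap] at h1
  · have h4 : ∀ x, ∫ q : ℝ × E, ⟪F x, G (Real.cos q.1 • x + Real.sin q.1 • q.2)⟫
        ∂(sinMeasure.prod (stdGaussian E)) = ∫ t, ∫ y, ⟪F x, G (Real.cos t • x + Real.sin t • y)⟫
        ∂(stdGaussian E) ∂sinMeasure := fun x =>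
      integral_prod _ (Continuous.integrable_of_forall_norm_le (by fun_prop) fun z => hb _ _)
    simp_rw [h4]
    linarith
  · refine Continuous.integrable_of_forall_norm_le (C := C * C) ?_ fun z => ?_
    · exact continuous_of_dominated (bound := fun _ => C * C) (fun t => by fun_prop)
        (fun t => ae_of_all _ fun z => hb _ _) (integrable_const _)
        (ae_of_all _ fun z => by fun_prop)
    · refine (norm_integral_le_of_norm_le_const (ae_of_all _ fun y => hb _ _)).trans ?_
      simp

/-- An `L¹` Poincaré inequality for the standard Gaussian measure. -/
lemma integral_abs_sub_le_stdGaussian {Q : E → ℝ} {Q' : E → E →L[ℝ] ℝ}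
    (hQ : ∀ x, HasFDerivAt Q (Q' x) x) (hQc : Continuous Q') {C : ℝ} (hQC : ∀ x, ‖Q' x‖ ≤ C) :
    ∫ z : E × E, |Q z.1 - Q z.2| ∂((stdGaussian E).prod (stdGaussian E)) ≤
      Real.pi / 2 * ∫ x, ‖Q' x‖ ∂(stdGaussian E) := by
  have hC0 : 0 ≤ C := (norm_nonneg _).trans (hQC 0)
  have hc : Continuous Q := continuous_iff_continuousAt.2 fun x => (hQ x).continuousAt
  have hb : ∀ (t : ℝ) (z : E × E), |Q' (Real.cos t • z.1 + Real.sin t • z.2)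
      (-Real.sin t • z.1 + Real.cos t • z.2)| ≤ C * (‖z.1‖ + ‖z.2‖) := fun t z =>
    ((Q' _).le_opNorm _).trans
      (mul_le_mul (hQC _) (norm_rotation_deriv_le _ _ _) (norm_nonneg _) hC0)
  -- The quarter circle t ↦ cos t z.1 + sin t z.2 joins z.1 to z.2; the difference is the integral
  -- of the derivative along it.
  have hpt : ∀ z : E × E, |Q z.1 - Q z.2| ≤ ∫ t in Set.Ioc 0 (Real.pi / 2),
      |Q' (Real.cos t • z.1 + Real.sin t • z.2) (-Real.sin t • z.1 + Real.cos t • z.2)| := by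
    intro z
    have h1 := intervalIntegral.integral_eq_sub_of_hasDerivAt (a := 0) (b := Real.pi / 2)
      (fun t _ => (hQ _).comp_hasDerivAt t (hasDerivAt_rotation z.1 z.2 t))
      (Continuous.intervalIntegrable (by fun_prop) _ _)
    simp only [Function.comp, Real.cos_pi_div_two, Real.sin_pi_div_two, Real.cos_zero,
      Real.sin_zero, one_smul, zero_smul, zero_add, add_zero] at h1
    rw [abs_sub_comm, ← h1, intervalIntegral.integral_of_le (by positivity)]
    exact abs_integral_le_integral_abs
  have hint : Integrable (fun p : (E × E) × ℝ =>
      |Q' (Real.cos p.2 • p.1.1 + Real.sin p.2 • p.1.2)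
        (-Real.sin p.2 • p.1.1 + Real.cos p.2 • p.1.2)|)
      (((stdGaussian E).prod (stdGaussian E)).prod
        (volume.restrict (Set.Ioc 0 (Real.pi / 2)))) := by
    refine ((integrable_norm_add_norm_stdGaussian_prod.const_mul C).comp_fst _).mono'
      (Continuous.aestronglyMeasurable (by fun_prop)) (ae_of_all _ fun p => ?_)
    simpa using hb p.2 p.1
  have hmono : ∫ z : E × E, |Q z.1 - Q z.2| ∂((stdGaussian E).prod (stdGaussian E)) ≤
      ∫ z : E × E, (∫ t in Set.Ioc 0 (Real.pi / 2),
      |Q' (Real.cos t • z.1 + Real.sin t • z.2) (-Real.sin t • z.1 + Real.cos t • z.2)|)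
      ∂((stdGaussian E).prod (stdGaussian E)) :=
    integral_mono_of_nonneg (ae_of_all _ fun z => abs_nonneg _) hint.integral_prod_left
      (ae_of_all _ hpt)
  refine hmono.trans ?_
  rw [integral_integral_swap hint]
  -- Position and velocity on the quarter circle are again independent standard Gaussians, so every
  -- t contributes the same amount and the length π/2 factors out. Conditionally on the position,
  -- `integral_abs_clm_le_stdGaussian` bounds the velocity average.
  have e : ∀ t : ℝ, ∫ z : E × E, |Q' (Real.cos t • z.1 + Real.sin t • z.2)
      (-Real.sin t • z.1 + Real.cos t • z.2)| ∂((stdGaussian E).prod (stdGaussian E)) =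
      ∫ z : E × E, |Q' z.1 z.2| ∂((stdGaussian E).prod (stdGaussian E)) := fun t =>
    integral_comp_rotation_stdGaussian t (f := fun z => |Q' z.1 z.2|) (by fun_prop)
  simp_rw [e]
  rw [integral_const, smul_eq_mul]
  have hv : (volume.restrict (Set.Ioc 0 (Real.pi / 2))).real Set.univ = Real.pi / 2 := by
    simp only [measureReal_def, Measure.restrict_apply_univ, Real.volume_Ioc, sub_zero]
    exact ENNReal.toReal_ofReal (by positivity)
  rw [hv]
  refine mul_le_mul_of_nonneg_left ?_ (by positivity)
  rw [integral_prod]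
  · refine integral_mono_of_nonneg (ae_of_all _ fun x => integral_nonneg fun y => abs_nonneg _)
      (Continuous.integrable_of_forall_norm_le (C := C) (by fun_prop) fun x => by simpa using hQC x)
      (ae_of_all _ fun x => integral_abs_clm_le_stdGaussian (Q' x))
  · refine (integrable_norm_add_norm_stdGaussian_prod.const_mul C).mono'
      (Continuous.aestronglyMeasurable (by fun_prop)) (ae_of_all _ fun z => ?_)
    simp only [Real.norm_eq_abs, abs_abs]
    refine ((Q' _).le_opNorm _).trans (mul_le_mul (hQC _) (by simp) (norm_nonneg _) hC0)

end GaussianInterpolation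

/-! ### The Stein kernel and its mean deviation. -/

section SteinKernel

open scoped RealInnerProductSpace

variable {E : Type*} [NormedAddCommGroup E] [InnerProductSpace ℝ E]

lemma norm_inner_le_of_bound {G₁ G₂ : E → E} {C : ℝ} (h₁ : ∀ x, ‖G₁ x‖ ≤ C)
    (h₂ : ∀ x, ‖G₂ x‖ ≤ C) (x y : E) : ‖⟪G₁ x, G₂ y⟫‖ ≤ C * C :=
  (norm_inner_le_norm _ _).trans
    (mul_le_mul (h₁ _) (h₂ _) (norm_nonneg _) ((norm_nonneg _).trans (h₁ 0)))

variable [FiniteDimensional ℝ E] [MeasurableSpace E] [BorelSpace E]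

/-- The Stein kernel built from the gradients `G₁`, `G₂` of two functions of a Gaussian vector. -/
noncomputable def steinKernel (G₁ G₂ : E → E) (x : E) : ℝ :=
  ∫ q : ℝ × E, ⟪G₁ x, G₂ (Real.cos q.1 • x + Real.sin q.1 • q.2)⟫
    ∂(sinMeasure.prod (stdGaussian E))

lemma continuous_steinKernel {G₁ G₂ : E → E} (hc₁ : Continuous G₁) (hc₂ : Continuous G₂) {C : ℝ}
    (h₁ : ∀ x, ‖G₁ x‖ ≤ C) (h₂ : ∀ x, ‖G₂ x‖ ≤ C) : Continuous (steinKernel G₁ G₂) :=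
  continuous_of_dominated (bound := fun _ => C * C) (fun t => by fun_prop)
    (fun t => ae_of_all _ fun z => norm_inner_le_of_bound h₁ h₂ _ _) (integrable_const _)
    (ae_of_all _ fun z => by fun_prop)

lemma abs_steinKernel_le {G₁ G₂ : E → E} {C : ℝ}
    (h₁ : ∀ x, ‖G₁ x‖ ≤ C) (h₂ : ∀ x, ‖G₂ x‖ ≤ C) (x : E) : |steinKernel G₁ G₂ x| ≤ C * C := by
  refine (norm_integral_le_of_norm_le_const
    (ae_of_all _ fun y => norm_inner_le_of_bound h₁ h₂ _ _)).trans ?_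
  simp

lemma integrable_steinKernel {G₁ G₂ : E → E} (hc₁ : Continuous G₁) (hc₂ : Continuous G₂) {C : ℝ}
    (h₁ : ∀ x, ‖G₁ x‖ ≤ C) (h₂ : ∀ x, ‖G₂ x‖ ≤ C) :
    Integrable (steinKernel G₁ G₂) (stdGaussian E) :=
  (continuous_steinKernel hc₁ hc₂ h₁ h₂).integrable_of_forall_norm_le (abs_steinKernel_le h₁ h₂)

/-- Cauchy-Schwarz for bounded continuous functions of two correlated Gaussian vectors. -/
lemma integral_mul_comp_rotation_le {A B : E → ℝ} (hA : Continuous A) (hB : Continuous B)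
    (hA0 : ∀ x, 0 ≤ A x) (hB0 : ∀ x, 0 ≤ B x) {C : ℝ} (hAC : ∀ x, A x ≤ C) (hBC : ∀ x, B x ≤ C)
    (t : ℝ) :
    ∫ z : E × E, A z.1 * B (Real.cos t • z.1 + Real.sin t • z.2)
      ∂((stdGaussian E).prod (stdGaussian E)) ≤
    Real.sqrt (∫ x, A x ^ 2 ∂(stdGaussian E)) * Real.sqrt (∫ x, B x ^ 2 ∂(stdGaussian E)) := by
  have hAm : MemLp (fun z : E × E => A z.1) (ENNReal.ofReal 2)
      ((stdGaussian E).prod (stdGaussian E)) :=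
    .of_bound (Continuous.aestronglyMeasurable (by fun_prop)) C
      (ae_of_all _ fun z => by rw [Real.norm_of_nonneg (hA0 _)]; exact hAC _)
  have hBm : MemLp (fun z : E × E => B (Real.cos t • z.1 + Real.sin t • z.2)) (ENNReal.ofReal 2)
      ((stdGaussian E).prod (stdGaussian E)) :=
    .of_bound (Continuous.aestronglyMeasurable (by fun_prop)) C
      (ae_of_all _ fun z => by rw [Real.norm_of_nonneg (hB0 _)]; exact hBC _)
  have h := integral_mul_le_Lp_mul_Lq_of_nonneg Real.HolderConjugate.two_two
    (ae_of_all _ fun z => hA0 _) (ae_of_all _ fun z => hB0 _) hAm hBm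
  refine h.trans_eq ?_
  -- The rotated point is itself standard Gaussian, so its second moment under B does not depend on
  -- t.
  have e := integral_comp_rotation_stdGaussian t (f := fun z : E × E => B z.1 ^ 2) (by fun_prop)
  simp only [Real.rpow_two]
  rw [← Real.sqrt_eq_rpow, ← Real.sqrt_eq_rpow]
  simp only at e
  rw [e, integral_fun_fst (f := fun x : E => A x ^ 2), integral_fun_fst (f := fun x : E => B x ^ 2)]
  simp

/-- For fixed t, Cauchy-Schwarz bounds the average over both Gaussian vectors by a quantity free of
t; only the weight c remains to be integrated. -/
lemma integral_sinMeasure_mul_comp_rotation_le {A B : E → ℝ} (hA : Continuous A)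
    (hB : Continuous B) (hA0 : ∀ x, 0 ≤ A x) (hB0 : ∀ x, 0 ≤ B x) {C : ℝ} (hAC : ∀ x, A x ≤ C)
    (hBC : ∀ x, B x ≤ C) {c : ℝ → ℝ} (hc : Continuous c) (hc0 : ∀ᵐ t ∂sinMeasure, 0 ≤ c t)
    (hc1 : ∀ t, |c t| ≤ 1) :
    ∫ q : ℝ × E, ∫ x, c q.1 * (A x * B (Real.cos q.1 • x + Real.sin q.1 • q.2)) ∂(stdGaussian E)
      ∂(sinMeasure.prod (stdGaussian E)) ≤
    (∫ t, c t ∂sinMeasure) *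
      (Real.sqrt (∫ x, A x ^ 2 ∂(stdGaussian E)) * Real.sqrt (∫ x, B x ^ 2 ∂(stdGaussian E))) := by
  have hC0 : 0 ≤ C := (hA0 0).trans (hAC 0)
  have hb : ∀ (t : ℝ) (x y : E), ‖A x * B (Real.cos t • x + Real.sin t • y)‖ ≤ C * C :=
    fun t x y => by
      rw [Real.norm_of_nonneg (mul_nonneg (hA0 _) (hB0 _))]
      exact mul_le_mul (hAC _) (hBC _) (hB0 _) hC0
  have hb' : ∀ (t : ℝ) (x y : E), ‖c t * (A x * B (Real.cos t • x + Real.sin t • y))‖ ≤ C * C :=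
    fun t x y => by
      rw [norm_mul]
      refine (mul_le_mul (hc1 t) (hb _ _ _) (norm_nonneg _) zero_le_one).trans (by rw [one_mul])
  rw [integral_prod]
  · rw [← integral_mul_const]
    refine integral_mono_ae ?_ ?_ ?_
    · refine Continuous.integrable_of_forall_norm_le (C := C * C) ?_ fun t => ?_
      · refine continuous_of_dominated (bound := fun _ => C * C)
          (fun t => Continuous.aestronglyMeasurable ?_)
          (fun t => ae_of_all _ fun z => ?_) (integrable_const _)
          (ae_of_all _ fun z => ?_)
        · exact continuous_of_dominated (bound := fun _ => C * C) (fun t => by fun_prop)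
            (fun t => ae_of_all _ fun z => hb' _ _ _) (integrable_const _)
            (ae_of_all _ fun z => by fun_prop)
        · exact (norm_integral_le_of_norm_le_const (ae_of_all _ fun y => hb' _ _ _)).trans (by simp)
        · exact continuous_of_dominated (bound := fun _ => C * C) (fun t => by fun_prop)
            (fun t => ae_of_all _ fun z => hb' _ _ _) (integrable_const _)
            (ae_of_all _ fun z => by fun_prop)
      · refine (norm_integral_le_of_norm_le_const (C := C * C) (ae_of_all _ fun y => ?_)).trans
          (by simp)
        exact (norm_integral_le_of_norm_le_const (ae_of_all _ fun z => hb' _ _ _)).trans (by simp)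
    · exact (Continuous.integrable_of_forall_norm_le hc hc1).mul_const _
    · filter_upwards [hc0] with t ht
      simp_rw [integral_const_mul]
      refine mul_le_mul_of_nonneg_left ?_ ht
      rw [integral_integral_swap (Continuous.integrable_of_forall_norm_le (C := C * C)
        (by fun_prop) fun z => hb _ _ _)]
      refine le_trans (le_of_eq ?_) (integral_mul_comp_rotation_le hA hB hA0 hB0 hAC hBC t)
      rw [integral_prod]
      exact Continuous.integrable_of_forall_norm_le (C := C * C) (by fun_prop) fun z => hb _ _ _
  · refine Continuous.integrable_of_forall_norm_le (C := C * C) ?_ fun q => ?_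
    · exact continuous_of_dominated (bound := fun _ => C * C) (fun t => by fun_prop)
        (fun t => ae_of_all _ fun z => hb' _ _ _) (integrable_const _)
        (ae_of_all _ fun z => by fun_prop)
    · exact (norm_integral_le_of_norm_le_const (ae_of_all _ fun y => hb' _ _ _)).trans (by simp)

/-- The mean deviation of the Stein kernel in terms of the first two derivatives. -/
lemma integral_abs_steinKernel_sub_le {G₁ G₂ : E → E} {H₁ H₂ : E → E →L[ℝ] E}
    (hG₁ : ∀ x, HasFDerivAt G₁ (H₁ x) x) (hG₂ : ∀ x, HasFDerivAt G₂ (H₂ x) x)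
    (hc₁ : Continuous H₁) (hc₂ : Continuous H₂) {C : ℝ} (hGC₁ : ∀ x, ‖G₁ x‖ ≤ C)
    (hGC₂ : ∀ x, ‖G₂ x‖ ≤ C) (hHC₁ : ∀ x, ‖H₁ x‖ ≤ C) (hHC₂ : ∀ x, ‖H₂ x‖ ≤ C) :
    ∫ x, |steinKernel G₁ G₂ x - ∫ y, steinKernel G₁ G₂ y ∂(stdGaussian E)| ∂(stdGaussian E) ≤
      Real.pi / 2 * (Real.sqrt (∫ x, ‖H₁ x‖ ^ 2 ∂(stdGaussian E)) *
          Real.sqrt (∫ x, ‖G₂ x‖ ^ 2 ∂(stdGaussian E)) +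
        1 / 2 * (Real.sqrt (∫ x, ‖G₁ x‖ ^ 2 ∂(stdGaussian E)) *
          Real.sqrt (∫ x, ‖H₂ x‖ ^ 2 ∂(stdGaussian E)))) := by
  have hC0 : 0 ≤ C := (norm_nonneg _).trans (hGC₁ 0)
  have hg₁ : Continuous G₁ := continuous_iff_continuousAt.2 fun x => (hG₁ x).continuousAt
  have hg₂ : Continuous G₂ := continuous_iff_continuousAt.2 fun x => (hG₂ x).continuousAt
  -- The kernel is the average of Q q over q = (t, y). Poincaré is applied to each Q q with q
  -- frozen, so the kernel itself need not be differentiated.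
  set Q : ℝ × E → E → ℝ := fun q x => ⟪G₁ x, G₂ (Real.cos q.1 • x + Real.sin q.1 • q.2)⟫ with hQdef
  have hQb : ∀ q x, ‖Q q x‖ ≤ C * C := fun q x => norm_inner_le_of_bound hGC₁ hGC₂ _ _
  have hQc : Continuous (fun p : (ℝ × E) × E => Q p.1 p.2) := by simp only [hQdef]; fun_prop
  have hTi := integrable_steinKernel hg₁ hg₂ hGC₁ hGC₂
  have hTc := continuous_steinKernel hg₁ hg₂ hGC₁ hGC₂
  have hTb := abs_steinKernel_le hGC₁ hGC₂
  have hdb : ∀ q x y, ‖|Q q x - Q q y|‖ ≤ C * C + C * C := fun q x y => by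
    rw [Real.norm_eq_abs, abs_abs]
    exact (norm_sub_le _ _).trans (add_le_add (hQb _ _) (hQb _ _))
  have hQi : ∀ x, Integrable (fun q => Q q x) (sinMeasure.prod (stdGaussian E)) := fun x =>
    Continuous.integrable_of_forall_norm_le (C := C * C) (by fun_prop) fun q => hQb q x
  have step1 : ∀ x, |steinKernel G₁ G₂ x - ∫ y, steinKernel G₁ G₂ y ∂(stdGaussian E)| ≤
      ∫ y, ∫ q, |Q q x - Q q y| ∂(sinMeasure.prod (stdGaussian E)) ∂(stdGaussian E) := by
    intro x
    -- The mean is replaced by an independent copy, producing the two-point differences that the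
    -- Poincaré inequality controls.
    have e : steinKernel G₁ G₂ x - ∫ y, steinKernel G₁ G₂ y ∂(stdGaussian E) =
        ∫ y, (steinKernel G₁ G₂ x - steinKernel G₁ G₂ y) ∂(stdGaussian E) := by
      rw [integral_sub (integrable_const _) hTi]; simp
    rw [e]
    refine abs_integral_le_integral_abs.trans (integral_mono_of_nonneg
      (ae_of_all _ fun y => abs_nonneg _) ?_ (ae_of_all _ fun y => ?_))
    · refine Continuous.integrable_of_forall_norm_le (C := C * C + C * C) ?_ fun y => ?_
      · exact continuous_of_dominated (bound := fun _ => C * C + C * C) (fun t => by fun_prop)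
          (fun t => ae_of_all _ fun z => hdb _ _ _) (integrable_const _)
          (ae_of_all _ fun z => by fun_prop)
      · exact (norm_integral_le_of_norm_le_const (ae_of_all _ fun y => hdb _ _ _)).trans (by simp)
    · have e2 : steinKernel G₁ G₂ x - steinKernel G₁ G₂ y =
          ∫ q, (Q q x - Q q y) ∂(sinMeasure.prod (stdGaussian E)) := by
        rw [integral_sub (hQi x) (hQi y)]; rfl
      simp only [e2]
      exact abs_integral_le_integral_abs
  have hswapc : Continuous fun z : E × E =>
      ∫ q, |Q q z.1 - Q q z.2| ∂(sinMeasure.prod (stdGaussian E)) :=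
    continuous_of_dominated (bound := fun _ => C * C + C * C) (fun t => by fun_prop)
      (fun t => ae_of_all _ fun z => hdb _ _ _) (integrable_const _)
      (ae_of_all _ fun z => by fun_prop)
  have hswapb : ∀ z : E × E, ‖∫ q, |Q q z.1 - Q q z.2| ∂(sinMeasure.prod (stdGaussian E))‖ ≤
      C * C + C * C := fun z =>
    (norm_integral_le_of_norm_le_const (ae_of_all _ fun y => hdb _ _ _)).trans (by simp)
  have hswapi := Continuous.integrable_of_forall_norm_le
    (μ := (stdGaussian E).prod (stdGaussian E)) hswapc hswapb
  have step2 : ∫ x, |steinKernel G₁ G₂ x - ∫ y, steinKernel G₁ G₂ y ∂(stdGaussian E)|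
      ∂(stdGaussian E) ≤ ∫ q, ∫ z : E × E, |Q q z.1 - Q q z.2|
        ∂((stdGaussian E).prod (stdGaussian E)) ∂(sinMeasure.prod (stdGaussian E)) := by
    rw [← integral_integral_swap, integral_prod _ hswapi]
    · exact integral_mono_of_nonneg (ae_of_all _ fun y => abs_nonneg _)
        hswapi.integral_prod_left (ae_of_all _ step1)
    · exact Continuous.integrable_of_forall_norm_le (C := C * C + C * C) (by fun_prop)
        fun p => hdb _ _ _
  -- The two terms of the product rule for the gradient of Q q. The inert factor 1 gives A₁ the same
  -- shape c(t) · A · B as A₂; the cosine in A₂ is the chain rule factor of the rotated argument.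
  set A₁ : ℝ × E → E → ℝ := fun q x =>
    1 * (‖H₁ x‖ * ‖G₂ (Real.cos q.1 • x + Real.sin q.1 • q.2)‖)
  set A₂ : ℝ × E → E → ℝ := fun q x =>
    |Real.cos q.1| * (‖G₁ x‖ * ‖H₂ (Real.cos q.1 • x + Real.sin q.1 • q.2)‖)
  have hA₁c : Continuous (fun p : (ℝ × E) × E => A₁ p.1 p.2) := by simp only [A₁]; fun_prop
  have hA₂c : Continuous (fun p : (ℝ × E) × E => A₂ p.1 p.2) := by simp only [A₂]; fun_prop
  have hA₁b : ∀ q x, ‖A₁ q x‖ ≤ C * C := fun q x => by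
    simp only [A₁, one_mul, norm_mul, norm_norm]
    exact mul_le_mul (hHC₁ _) (hGC₂ _) (norm_nonneg _) hC0
  have hA₂b : ∀ q x, ‖A₂ q x‖ ≤ C * C := fun q x => by
    simp only [A₂, norm_mul, norm_norm]
    refine (mul_le_of_le_one_left (by positivity) ?_).trans
      (mul_le_mul (hGC₁ _) (hHC₂ _) (norm_nonneg _) hC0)
    simpa using Real.abs_cos_le_one q.1
  have hA₁i : ∀ q, Integrable (A₁ q) (stdGaussian E) := fun q =>
    Continuous.integrable_of_forall_norm_le (by fun_prop) (hA₁b q)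
  have hA₂i : ∀ q, Integrable (A₂ q) (stdGaussian E) := fun q =>
    Continuous.integrable_of_forall_norm_le (by fun_prop) (hA₂b q)
  have hI : ∀ {A : ℝ × E → E → ℝ}, Continuous (fun p : (ℝ × E) × E => A p.1 p.2) →
      (∀ q x, ‖A q x‖ ≤ C * C) → Integrable (fun q => ∫ x, A q x ∂(stdGaussian E))
        (sinMeasure.prod (stdGaussian E)) := by
    intro A hA hAb
    refine Continuous.integrable_of_forall_norm_le (C := C * C) ?_ fun q => ?_
    · exact continuous_of_dominated (bound := fun _ => C * C) (fun t => by fun_prop)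
        (fun t => ae_of_all _ fun z => hAb _ _) (integrable_const _)
        (ae_of_all _ fun z => by fun_prop)
    · exact (norm_integral_le_of_norm_le_const (ae_of_all _ fun y => hAb _ _)).trans (by simp)
  have step3 : ∀ q, ∫ z : E × E, |Q q z.1 - Q q z.2| ∂((stdGaussian E).prod (stdGaussian E)) ≤
      Real.pi / 2 * (∫ x, A₁ q x ∂(stdGaussian E) + ∫ x, A₂ q x ∂(stdGaussian E)) := by
    intro q
    set R : E → E := fun x => Real.cos q.1 • x + Real.sin q.1 • q.2
    have hR : ∀ x, HasFDerivAt R (Real.cos q.1 • ContinuousLinearMap.id ℝ E) x := fun x =>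
      ((hasFDerivAt_id x).const_smul (Real.cos q.1)).add_const _
    have hd : ∀ x, HasFDerivAt (Q q) ((fderivInnerCLM ℝ (G₁ x, G₂ (R x))).comp
        ((H₁ x).prod ((H₂ (R x)).comp (Real.cos q.1 • ContinuousLinearMap.id ℝ E)))) x := fun x =>
      (hG₁ x).inner ℝ ((hG₂ (R x)).comp x (hR x))
    have hdb : ∀ x, ‖(fderivInnerCLM ℝ (G₁ x, G₂ (R x))).comp
        ((H₁ x).prod ((H₂ (R x)).comp (Real.cos q.1 • ContinuousLinearMap.id ℝ E)))‖ ≤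
        A₁ q x + A₂ q x := by
      intro x
      refine ContinuousLinearMap.opNorm_le_bound _ (by positivity) fun v => ?_
      simp only [ContinuousLinearMap.comp_apply, ContinuousLinearMap.prod_apply,
        fderivInnerCLM_apply, smul_apply, ContinuousLinearMap.id_apply,
        map_smul, A₁, A₂]
      refine (norm_add_le _ _).trans ?_
      rw [inner_smul_right, norm_mul]
      have h1 : ‖⟪G₁ x, H₂ (R x) v⟫‖ ≤ ‖G₁ x‖ * (‖H₂ (R x)‖ * ‖v‖) :=
        (norm_inner_le_norm _ _).trans (by gcongr; exact (H₂ (R x)).le_opNorm v)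
      have h2 : ‖⟪H₁ x v, G₂ (R x)⟫‖ ≤ ‖H₁ x‖ * ‖v‖ * ‖G₂ (R x)‖ :=
        (norm_inner_le_norm _ _).trans (by gcongr; exact (H₁ x).le_opNorm v)
      have h3 := mul_le_mul_of_nonneg_left h1 (norm_nonneg (Real.cos q.1))
      simp only [Real.norm_eq_abs] at h2 h3 ⊢
      calc _ ≤ |Real.cos q.1| * (‖G₁ x‖ * (‖H₂ (R x)‖ * ‖v‖)) + ‖H₁ x‖ * ‖v‖ * ‖G₂ (R x)‖ :=
            add_le_add h3 h2
        _ = _ := by simp only [R]; ring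
    have hRc : Continuous R := by fun_prop
    have hFI : Continuous fun x => fderivInnerCLM ℝ (G₁ x, G₂ (R x)) :=
      (isBoundedBilinearMap_inner (𝕜 := ℝ) (E := E)).isBoundedLinearMap_deriv.continuous.comp
        (by fun_prop : Continuous fun x => (G₁ x, G₂ (R x)))
    have hP : Continuous fun x => (H₁ x).prod
        ((H₂ (R x)).comp (Real.cos q.1 • ContinuousLinearMap.id ℝ E)) :=
      (ContinuousLinearMap.prodₗᵢ ℝ).continuous.comp
        (by fun_prop : Continuous fun x =>
          (H₁ x, (H₂ (R x)).comp (Real.cos q.1 • ContinuousLinearMap.id ℝ E)))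
    have h := integral_abs_sub_le_stdGaussian hd (hFI.clm_comp hP) (C := C * C + C * C) fun x => (hdb x).trans
      (add_le_add ((le_abs_self _).trans (hA₁b q x)) ((le_abs_self _).trans (hA₂b q x)))
    refine h.trans (mul_le_mul_of_nonneg_left ?_ (by positivity))
    rw [← integral_add (hA₁i q) (hA₂i q)]
    exact integral_mono_of_nonneg (ae_of_all _ fun x => norm_nonneg _) ((hA₁i q).add (hA₂i q))
      (ae_of_all _ hdb)
  refine step2.trans ((integral_mono_of_nonneg
    (ae_of_all _ fun q => integral_nonneg fun z => abs_nonneg _)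
    (((hI hA₁c hA₁b).add (hI hA₂c hA₂b)).const_mul _) (ae_of_all _ step3)).trans ?_)
  rw [integral_const_mul]
  refine mul_le_mul_of_nonneg_left ?_ (by positivity)
  simp only [Pi.add_apply]
  rw [integral_add (hI hA₁c hA₁b) (hI hA₂c hA₂b)]
  have b1 := integral_sinMeasure_mul_comp_rotation_le (A := fun x => ‖H₁ x‖) (B := fun x => ‖G₂ x‖)
    (by fun_prop) (by fun_prop) (fun _ => norm_nonneg _) (fun _ => norm_nonneg _) hHC₁ hGC₂
    (c := fun _ => 1) continuous_const (ae_of_all _ fun _ => zero_le_one) (by simp)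
  have b2 := integral_sinMeasure_mul_comp_rotation_le (A := fun x => ‖G₁ x‖) (B := fun x => ‖H₂ x‖)
    (by fun_prop) (by fun_prop) (fun _ => norm_nonneg _) (fun _ => norm_nonneg _) hGC₁ hHC₂
    (c := fun t => |Real.cos t|) (by fun_prop) (ae_of_all _ fun _ => abs_nonneg _)
    (by simpa using Real.abs_cos_le_one)
  -- On (0, π/2] the cosine is nonnegative; this weight 1/2 is why the second term counts half.
  have e1 : ∫ t, |Real.cos t| ∂sinMeasure = 1 / 2 := by
    rw [← integral_cos_sinMeasure]
    exact integral_congr_ae (ae_sinMeasure_cos_nonneg.mono fun t ht => abs_of_nonneg ht)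
  rw [e1] at b2
  simp only [integral_const, probReal_univ, smul_eq_mul, mul_one, one_mul] at b1
  refine add_le_add ?_ b2
  simpa [A₁] using b1

end SteinKernel

/-! ### Interpolation between a standard Gaussian vector and F(X), for smooth bounded F. -/

section SmartPath

open scoped RealInnerProductSpace

variable {E : Type*} [NormedAddCommGroup E] [InnerProductSpace ℝ E] {r : ℕ}

/-- A function on a Euclidean space whose coordinates have gradients `G i` is differentiable. -/
lemma hasFDerivAt_of_coord {F : E → EuclideanSpace ℝ (Fin r)} {G : Fin r → E → E} {x : E}
    (hF : ∀ i, HasFDerivAt (fun x => F x i) (innerSL ℝ (G i x)) x) :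
    HasFDerivAt F (∑ i, (innerSL ℝ (G i x)).smulRight (EuclideanSpace.single i (1 : ℝ))) x := by
  rw [← hasFDerivWithinAt_univ, hasFDerivWithinAt_euclidean]
  intro i
  rw [hasFDerivWithinAt_univ]
  refine (hF i).congr_fderiv ?_
  ext v
  simp [ContinuousLinearMap.comp_apply]

variable [FiniteDimensional ℝ E] [MeasurableSpace E] [BorelSpace E]

/-- Gaussian integration by parts trades the derivative of k for a factor n_i. As |k_j| ≤ 1, the
averaged Hessian is then bounded by E|n_i|, independently of the bound on K. -/
lemma abs_integral_cos_mul_deriv_le {k : EuclideanSpace ℝ (Fin r) → EuclideanSpace ℝ (Fin r)}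
    {K : EuclideanSpace ℝ (Fin r) → EuclideanSpace ℝ (Fin r) →L[ℝ] EuclideanSpace ℝ (Fin r)}
    (hk : ∀ w, HasFDerivAt k (K w) w) (hKc : Continuous K) (hk1 : ∀ w, ‖k w‖ ≤ 1) {C : ℝ}
    (hKC : ∀ w, ‖K w‖ ≤ C) (θ : ℝ) (y : EuclideanSpace ℝ (Fin r)) (i j : Fin r) :
    (∫ n, k (Real.cos θ • n + y) j * n i ∂(stdGaussian (EuclideanSpace ℝ (Fin r))) =
      Real.cos θ * ∫ n, K (Real.cos θ • n + y) (EuclideanSpace.single i (1 : ℝ)) j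
        ∂(stdGaussian (EuclideanSpace ℝ (Fin r)))) ∧
    |Real.cos θ * ∫ n, K (Real.cos θ • n + y) (EuclideanSpace.single i (1 : ℝ)) j
        ∂(stdGaussian (EuclideanSpace ℝ (Fin r)))| ≤ Real.sqrt (2 / Real.pi) := by
  have hkb : ∀ w j, |k w j| ≤ 1 := fun w j => (PiLp.norm_apply_le (k w) j).trans (hk1 w)
  have hd : ∀ n : EuclideanSpace ℝ (Fin r), HasFDerivAt (fun n => k (Real.cos θ • n + y) j)
      (Real.cos θ • (EuclideanSpace.proj j : EuclideanSpace ℝ (Fin r) →L[ℝ] ℝ).comp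
        (K (Real.cos θ • n + y))) n := by
    intro n
    have hR : HasFDerivAt (fun n : EuclideanSpace ℝ (Fin r) => Real.cos θ • n + y)
        (Real.cos θ • ContinuousLinearMap.id ℝ _) n :=
      ((hasFDerivAt_id n).const_smul (Real.cos θ)).add_const _
    refine (((EuclideanSpace.proj j : EuclideanSpace ℝ (Fin r) →L[ℝ] ℝ).hasFDerivAt).comp n
      ((hk _).comp n hR)).congr_fderiv ?_
    ext v; simp
  have h1 := integral_inner_mul_stdGaussian hd (by fun_prop) (C := 1) (C' := C)
    (fun n => hkb _ _) (fun n => by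
      rw [norm_smul]
      refine (mul_le_of_le_one_left (norm_nonneg _) (Real.abs_cos_le_one θ)).trans ?_
      refine ContinuousLinearMap.opNorm_le_bound _ ((norm_nonneg _).trans (hKC 0)) fun v => ?_
      refine (PiLp.norm_apply_le _ j).trans ((ContinuousLinearMap.le_opNorm _ _).trans ?_)
      gcongr; exact hKC _) (EuclideanSpace.single i (1 : ℝ))
  simp only [EuclideanSpace.inner_single_left, map_one, one_mul, smul_apply,
    ContinuousLinearMap.comp_apply, PiLp.proj_apply, smul_eq_mul] at h1
  rw [integral_const_mul] at h1
  refine ⟨h1, ?_⟩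
  rw [← h1, ← integral_abs_inner_stdGaussian (v := EuclideanSpace.single i (1 : ℝ)) (by simp)]
  refine abs_integral_le_integral_abs.trans (integral_mono_of_nonneg
    (ae_of_all _ fun n => abs_nonneg _) (integrable_inner_stdGaussian _).abs
    (ae_of_all _ fun n => ?_))
  simp only [EuclideanSpace.inner_single_left, map_one, one_mul, abs_mul]
  exact mul_le_of_le_one_left (abs_nonneg _) (hkb _ _)

/-- This is `integral_mul_sub_stdGaussian` for x ↦ k_j(n + sF(x)) and F_j: the chain rule writes the
gradient of the former as s Σ_i ∂_i k_j · G_i, and the product of means vanishes because F_j is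
centred. -/
lemma integral_comp_mul_coord {F : E → EuclideanSpace ℝ (Fin r)} {G : Fin r → E → E}
    (hF : ∀ i x, HasFDerivAt (fun x => F x i) (innerSL ℝ (G i x)) x)
    (hGc : ∀ i, Continuous (G i)) {C : ℝ} (hFC : ∀ x, ‖F x‖ ≤ C) (hGC : ∀ i x, ‖G i x‖ ≤ C)
    (hmean : ∀ i, ∫ x, F x i ∂(stdGaussian E) = 0)
    {k : EuclideanSpace ℝ (Fin r) → EuclideanSpace ℝ (Fin r)}
    {K : EuclideanSpace ℝ (Fin r) → EuclideanSpace ℝ (Fin r) →L[ℝ] EuclideanSpace ℝ (Fin r)}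
    (hk : ∀ w, HasFDerivAt k (K w) w) (hKc : Continuous K) (hk1 : ∀ w, ‖k w‖ ≤ 1) {C' : ℝ}
    (hKC : ∀ w, ‖K w‖ ≤ C') (s : ℝ) (n : EuclideanSpace ℝ (Fin r)) (j : Fin r) :
    ∫ x, k (n + s • F x) j * F x j ∂(stdGaussian E) =
      s * ∑ i, ∫ x, K (n + s • F x) (EuclideanSpace.single i (1 : ℝ)) j *
        steinKernel (G i) (G j) x ∂(stdGaussian E) := by
  have hkb : ∀ w j, |k w j| ≤ 1 := fun w j => (PiLp.norm_apply_le (k w) j).trans (hk1 w)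
  have hKb : ∀ w i j, |K w (EuclideanSpace.single i (1 : ℝ)) j| ≤ C' := fun w i j =>
    (PiLp.norm_apply_le _ j).trans (((K w).le_opNorm _).trans (by simpa using hKC w))
  have hFd : ∀ x, HasFDerivAt F
      (∑ i, (innerSL ℝ (G i x)).smulRight (EuclideanSpace.single i (1 : ℝ))) x :=
    fun x => hasFDerivAt_of_coord fun i => hF i x
  have hFc : Continuous F := continuous_iff_continuousAt.2 fun x => (hFd x).continuousAt
  have hd : ∀ x, HasFDerivAt (fun x => k (n + s • F x) j)
      (innerSL ℝ (∑ i, (s * K (n + s • F x) (EuclideanSpace.single i (1 : ℝ)) j) • G i x)) x := by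
    intro x
    have hR : HasFDerivAt (fun x => n + s • F x) (s • ∑ i, (innerSL ℝ (G i x)).smulRight
        (EuclideanSpace.single i (1 : ℝ))) x := ((hFd x).const_smul s).const_add _
    refine (((EuclideanSpace.proj j : EuclideanSpace ℝ (Fin r) →L[ℝ] ℝ).hasFDerivAt).comp x
      ((hk _).comp x hR)).congr_fderiv ?_
    ext v
    simp [ContinuousLinearMap.comp_apply, map_sum, Finset.mul_sum]
    exact Finset.sum_congr rfl fun i _ => by ring
  set D := ∑ i : Fin r, (|s| * C' * C)
  have hgb : ∀ x, ‖∑ i, (s * K (n + s • F x) (EuclideanSpace.single i (1 : ℝ)) j) • G i x‖ ≤ D := by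
    intro x
    refine (norm_sum_le _ _).trans (Finset.sum_le_sum fun i _ => ?_)
    rw [norm_smul, norm_mul]
    refine mul_le_mul (mul_le_mul_of_nonneg_left (hKb _ _ _) (norm_nonneg _)) (hGC i x)
      (norm_nonneg _) (mul_nonneg (abs_nonneg _) ((norm_nonneg _).trans (hKC 0)))
  have h1 := integral_mul_sub_stdGaussian hd (hF j) (by fun_prop) (hGc j)
    (C := max (max 1 C) D) (fun x => (hkb _ _).trans (by simp))
    (fun x => (PiLp.norm_apply_le _ j).trans ((hFC x).trans (by simp)))
    (fun x => (hgb x).trans (by simp)) (fun x => (hGC j x).trans (by simp))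
  rw [hmean j, mul_zero, sub_zero] at h1
  rw [h1, Finset.mul_sum]
  have h2 : ∀ x, ∫ q : ℝ × E, ⟪∑ i, (s * K (n + s • F x) (EuclideanSpace.single i (1 : ℝ)) j) • G i x,
      G j (Real.cos q.1 • x + Real.sin q.1 • q.2)⟫ ∂(sinMeasure.prod (stdGaussian E)) =
      ∑ i, s * (K (n + s • F x) (EuclideanSpace.single i (1 : ℝ)) j *
        steinKernel (G i) (G j) x) := by
    intro x
    simp only [sum_inner, inner_smul_left, steinKernel]
    rw [integral_finsetSum]
    · refine Finset.sum_congr rfl fun i _ => ?_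
      rw [integral_const_mul]
      simp; ring
    · intro i _
      refine (Continuous.integrable_of_forall_norm_le (C := C * C) (by fun_prop) fun q => ?_).const_mul _
      exact norm_inner_le_of_bound (hGC i) (hGC j) _ _
  simp_rw [h2]
  rw [integral_finsetSum]
  · exact Finset.sum_congr rfl fun i _ => integral_const_mul _ _
  · intro i _
    have := continuous_steinKernel (hGc i) (hGc j) (hGC i) (hGC j)
    refine (Continuous.integrable_of_forall_norm_le (C := C' * (C * C)) (by fun_prop)
      fun x => ?_).const_mul _
    rw [norm_mul]
    exact mul_le_mul (hKb _ _ _) (abs_steinKernel_le (hGC i) (hGC j) x) (norm_nonneg _)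
      ((norm_nonneg _).trans (hKC 0))

/-- Gaussian approximation of a smooth bounded function of a Gaussian vector, in terms of its Stein
kernels. -/
lemma abs_integral_comp_sub_integral_stdGaussian_le {F : E → EuclideanSpace ℝ (Fin r)}
    {G : Fin r → E → E}
    (hF : ∀ i x, HasFDerivAt (fun x => F x i) (innerSL ℝ (G i x)) x)
    (hGc : ∀ i, Continuous (G i)) {C : ℝ} (hFC : ∀ x, ‖F x‖ ≤ C) (hGC : ∀ i x, ‖G i x‖ ≤ C)
    (hmean : ∀ i, ∫ x, F x i ∂(stdGaussian E) = 0)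
    {h : EuclideanSpace ℝ (Fin r) → ℝ}
    {k : EuclideanSpace ℝ (Fin r) → EuclideanSpace ℝ (Fin r)}
    {K : EuclideanSpace ℝ (Fin r) → EuclideanSpace ℝ (Fin r) →L[ℝ] EuclideanSpace ℝ (Fin r)}
    (hh : ∀ w, HasFDerivAt h (innerSL ℝ (k w)) w)
    (hk : ∀ w, HasFDerivAt k (K w) w) (hKc : Continuous K) (hk1 : ∀ w, ‖k w‖ ≤ 1) {C' : ℝ}
    (hKC : ∀ w, ‖K w‖ ≤ C') :
    |∫ x, h (F x) ∂(stdGaussian E) - ∫ n, h n ∂(stdGaussian (EuclideanSpace ℝ (Fin r)))| ≤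
      Real.sqrt (2 / Real.pi) * ∑ i, ∑ j,
        ∫ x, |steinKernel (G i) (G j) x - if i = j then 1 else 0| ∂(stdGaussian E) := by
  set Γ := stdGaussian (EuclideanSpace ℝ (Fin r)) with hΓ
  set γ := stdGaussian E with hγ
  set S := ∑ i, ∑ j, ∫ x, |steinKernel (G i) (G j) x - if i = j then 1 else 0| ∂γ with hS
  have hkb : ∀ w j, |k w j| ≤ 1 := fun w j => (PiLp.norm_apply_le (k w) j).trans (hk1 w)
  have hKb : ∀ w i j, |K w (EuclideanSpace.single i (1 : ℝ)) j| ≤ C' := fun w i j =>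
    (PiLp.norm_apply_le _ j).trans (((K w).le_opNorm _).trans (by simpa using hKC w))
  have hFc : Continuous F := continuous_iff_continuousAt.2 fun x =>
    (hasFDerivAt_of_coord fun i => hF i x).continuousAt
  have hhc : Continuous h := continuous_iff_continuousAt.2 fun x => (hh x).continuousAt
  have hkc : Continuous k := continuous_iff_continuousAt.2 fun x => (hk x).continuousAt
  have hTc : ∀ i j, Continuous (steinKernel (G i) (G j)) := fun i j =>
    continuous_steinKernel (hGc i) (hGc j) (hGC i) (hGC j)
  have hTb : ∀ i j x, |steinKernel (G i) (G j) x| ≤ C * C := fun i j =>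
    abs_steinKernel_le (hGC i) (hGC j)
  have hC0 : 0 ≤ C := (norm_nonneg _).trans (hFC 0)
  have hC'0 : 0 ≤ C' := (norm_nonneg _).trans (hKC 0)
  have hlip : ∀ w, |h w| ≤ |h 0| + ‖w‖ := by
    intro w
    have h1 := Convex.norm_image_sub_le_of_norm_hasFDerivWithin_le (s := Set.univ) (C := 1)
      (fun x _ => (hh x).hasFDerivWithinAt) (fun x _ => by rw [innerSL_apply_norm]; exact hk1 x)
      convex_univ (Set.mem_univ (0 : EuclideanSpace ℝ (Fin r))) (Set.mem_univ w)
    rw [sub_zero, one_mul, Real.norm_eq_abs] at h1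
    have h2 := abs_sub_abs_le_abs_sub (h w) (h 0)
    linarith
  have hn : Integrable (fun z : EuclideanSpace ℝ (Fin r) × E => ‖z.1‖) (Γ.prod γ) :=
    integrable_norm_stdGaussian.comp_fst _
  have hW : ∀ (θ : ℝ) (z : EuclideanSpace ℝ (Fin r) × E),
      ‖Real.cos θ • z.1 + Real.sin θ • F z.2‖ ≤ ‖z.1‖ + C := by
    intro θ z
    refine (norm_add_le _ _).trans ?_
    rw [norm_smul, norm_smul]
    exact add_le_add (mul_le_of_le_one_left (norm_nonneg _) (Real.abs_cos_le_one θ))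
      ((mul_le_of_le_one_left (norm_nonneg _) (Real.abs_sin_le_one θ)).trans (hFC _))
  have hderiv : ∀ θ : ℝ, HasDerivAt
      (fun θ : ℝ => ∫ z : EuclideanSpace ℝ (Fin r) × E,
        h (Real.cos θ • z.1 + Real.sin θ • F z.2) ∂(Γ.prod γ))
      (∫ z : EuclideanSpace ℝ (Fin r) × E, ⟪k (Real.cos θ • z.1 + Real.sin θ • F z.2),
        -Real.sin θ • z.1 + Real.cos θ • F z.2⟫ ∂(Γ.prod γ)) θ := by
    intro θ
    refine (hasDerivAt_integral_of_dominated_loc_of_deriv_le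
      (μ := Γ.prod γ) (x₀ := θ) (s := Set.univ)
      (F := fun θ (z : EuclideanSpace ℝ (Fin r) × E) => h (Real.cos θ • z.1 + Real.sin θ • F z.2))
      (F' := fun θ (z : EuclideanSpace ℝ (Fin r) × E) =>
        ⟪k (Real.cos θ • z.1 + Real.sin θ • F z.2), -Real.sin θ • z.1 + Real.cos θ • F z.2⟫)
      (bound := fun z => ‖z.1‖ + C) Filter.univ_mem
      (Filter.Eventually.of_forall fun t => Continuous.aestronglyMeasurable (by fun_prop))
      ?_ (Continuous.aestronglyMeasurable (by fun_prop)) ?_ (hn.add (integrable_const _)) ?_).2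
    · refine ((integrable_const |h 0|).add (hn.add (integrable_const C))).mono'
        (Continuous.aestronglyMeasurable (by fun_prop)) (ae_of_all _ fun z => ?_)
      exact (hlip _).trans (by simpa using hW θ z)
    · refine ae_of_all _ fun z t _ => (norm_inner_le_norm _ _).trans ?_
      refine (mul_le_of_le_one_left (norm_nonneg _) (hk1 _)).trans ?_
      exact (norm_rotation_deriv_le t z.1 (F z.2)).trans (by simpa using hFC z.2)
    · refine ae_of_all _ fun z t _ => ?_
      exact (hh _).comp_hasDerivAt t (hasDerivAt_rotation z.1 (F z.2) t)
  -- The Hessian of h on the path, averaged over the Gaussian endpoint with x fixed. Keeping cos θ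
  -- inside makes the bound by √(2/π) uniform in θ.
  set M : ℝ → Fin r → Fin r → E → ℝ := fun θ i j x => Real.cos θ *
    ∫ n, K (Real.cos θ • n + Real.sin θ • F x) (EuclideanSpace.single i (1 : ℝ)) j ∂Γ with hM
  have hMc : ∀ θ i j, Continuous (M θ i j) := by
    intro θ i j
    refine continuous_const.mul (continuous_of_dominated (bound := fun _ => C')
      (fun x => Continuous.aestronglyMeasurable (by fun_prop))
      (fun x => ae_of_all _ fun n => hKb _ _ _) (integrable_const _)
      (ae_of_all _ fun n => by fun_prop))
  have hMb : ∀ θ i j x, |M θ i j x| ≤ Real.sqrt (2 / Real.pi) := fun θ i j x =>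
    (abs_integral_cos_mul_deriv_le hk hKc hk1 hKC θ (Real.sin θ • F x) i j).2
  have hMi : ∀ θ i j, Integrable (M θ i j) γ := fun θ i j =>
    (hMc θ i j).integrable_of_forall_norm_le (hMb θ i j)
  have hTMb : ∀ θ i j x, ‖steinKernel (G i) (G j) x * M θ i j x‖ ≤
      C * C * Real.sqrt (2 / Real.pi) := fun θ i j x => by
    rw [norm_mul]
    exact mul_le_mul (hTb i j x) (hMb θ i j x) (norm_nonneg _) (mul_nonneg hC0 hC0)
  have hTMi : ∀ θ i j, Integrable (fun x => steinKernel (G i) (G j) x * M θ i j x) γ :=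
    fun θ i j => Continuous.integrable_of_forall_norm_le
      ((hTc i j).mul (hMc θ i j)) (hTMb θ i j)
  -- The Gaussian half -sin θ E[k_j n_j] gives -sin θ E[M_jj] by integration by parts in n; the
  -- other half cos θ E[k_j F_j] gives sin θ Σ_i E[T_ij M_ij] by the kernel identity. Their sum
  -- exhibits T - δ.
  have hval : ∀ θ : ℝ, ∫ z : EuclideanSpace ℝ (Fin r) × E,
      ⟪k (Real.cos θ • z.1 + Real.sin θ • F z.2),
        -Real.sin θ • z.1 + Real.cos θ • F z.2⟫ ∂(Γ.prod γ) =
      Real.sin θ * ∑ i, ∑ j, ∫ x, M θ i j x *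
        (steinKernel (G i) (G j) x - if i = j then 1 else 0) ∂γ := by
    intro θ
    have hi1 : ∀ j, Integrable (fun z : EuclideanSpace ℝ (Fin r) × E =>
        k (Real.cos θ • z.1 + Real.sin θ • F z.2) j * z.1 j) (Γ.prod γ) := fun j => by
      refine hn.mono' (Continuous.aestronglyMeasurable (by fun_prop)) (ae_of_all _ fun z => ?_)
      rw [norm_mul]
      exact (mul_le_of_le_one_left (norm_nonneg _) (hkb _ _)).trans (PiLp.norm_apply_le _ _)
    have hi2 : ∀ j, Integrable (fun z : EuclideanSpace ℝ (Fin r) × E =>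
        k (Real.cos θ • z.1 + Real.sin θ • F z.2) j * F z.2 j) (Γ.prod γ) := fun j => by
      refine Continuous.integrable_of_forall_norm_le (C := C) (by fun_prop) fun z => ?_
      rw [norm_mul]
      exact (mul_le_of_le_one_left (norm_nonneg _) (hkb _ _)).trans
        ((PiLp.norm_apply_le _ _).trans (hFC _))
    have e1 : ∀ j, ∫ z : EuclideanSpace ℝ (Fin r) × E,
        k (Real.cos θ • z.1 + Real.sin θ • F z.2) j * z.1 j ∂(Γ.prod γ) = ∫ x, M θ j j x ∂γ := by
      intro j
      rw [integral_prod_symm _ (hi1 j)]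
      refine integral_congr_ae (ae_of_all _ fun x => ?_)
      exact (abs_integral_cos_mul_deriv_le hk hKc hk1 hKC θ (Real.sin θ • F x) j j).1
    have e2 : ∀ j, Real.cos θ * ∫ z : EuclideanSpace ℝ (Fin r) × E,
        k (Real.cos θ • z.1 + Real.sin θ • F z.2) j * F z.2 j ∂(Γ.prod γ) =
        Real.sin θ * ∑ i, ∫ x, steinKernel (G i) (G j) x * M θ i j x ∂γ := by
      intro j
      have hb : ∀ i n x, ‖K (Real.cos θ • n + Real.sin θ • F x) (EuclideanSpace.single i (1 : ℝ)) j *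
          steinKernel (G i) (G j) x‖ ≤ C' * (C * C) := fun i n x => by
        rw [norm_mul]
        exact mul_le_mul (hKb _ _ _) (hTb _ _ _) (norm_nonneg _) hC'0
      rw [integral_prod _ (hi2 j)]
      have hcoord : ∀ n, ∫ x, k (Real.cos θ • n + Real.sin θ • F x) j * F x j ∂γ =
          Real.sin θ * ∑ i, ∫ x, K (Real.cos θ • n + Real.sin θ • F x)
            (EuclideanSpace.single i (1 : ℝ)) j * steinKernel (G i) (G j) x ∂γ := fun n =>
        integral_comp_mul_coord hF hGc hFC hGC hmean hk hKc hk1 hKC (Real.sin θ) (Real.cos θ • n) j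
      simp_rw [hcoord]
      rw [integral_const_mul, integral_finsetSum]
      · rw [mul_left_comm, Finset.mul_sum]
        congr 1
        refine Finset.sum_congr rfl fun i _ => ?_
        rw [integral_integral_swap]
        · rw [← integral_const_mul]
          refine integral_congr_ae (ae_of_all _ fun x => ?_)
          simp only [hM]
          rw [integral_mul_const]
          ring
        · have := hTc i j
          exact Continuous.integrable_of_forall_norm_le (by fun_prop) fun p => hb i p.1 p.2
      · intro i _
        have := hTc i j
        refine Continuous.integrable_of_forall_norm_le (C := C' * (C * C)) ?_ fun n => ?_
        · exact continuous_of_dominated (bound := fun _ => C' * (C * C))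
            (fun x => Continuous.aestronglyMeasurable (by fun_prop))
            (fun n => ae_of_all _ fun x => hb i n x) (integrable_const _)
            (ae_of_all _ fun n => by fun_prop)
        · exact (norm_integral_le_of_norm_le_const (ae_of_all _ fun x => hb i n x)).trans (by simp)
    have e3 : ∀ z : EuclideanSpace ℝ (Fin r) × E, ⟪k (Real.cos θ • z.1 + Real.sin θ • F z.2),
        -Real.sin θ • z.1 + Real.cos θ • F z.2⟫ =
        ∑ j, (-Real.sin θ * (k (Real.cos θ • z.1 + Real.sin θ • F z.2) j * z.1 j) +
          Real.cos θ * (k (Real.cos θ • z.1 + Real.sin θ • F z.2) j * F z.2 j)) := by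
      intro z
      rw [PiLp.inner_apply]
      refine Finset.sum_congr rfl fun j _ => ?_
      simp; ring
    have hi3 : ∀ j, Integrable (fun z : EuclideanSpace ℝ (Fin r) × E =>
        -Real.sin θ * (k (Real.cos θ • z.1 + Real.sin θ • F z.2) j * z.1 j) +
          Real.cos θ * (k (Real.cos θ • z.1 + Real.sin θ • F z.2) j * F z.2 j)) (Γ.prod γ) :=
      fun j => ((hi1 j).const_mul _).add ((hi2 j).const_mul _)
    simp_rw [e3]
    rw [integral_finsetSum _ fun j _ => hi3 j,
      Finset.sum_comm, Finset.mul_sum]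
    refine Finset.sum_congr rfl fun j _ => ?_
    rw [integral_add ((hi1 j).const_mul _) ((hi2 j).const_mul _), integral_const_mul,
      integral_const_mul, e1, e2]
    have e4 : ∀ i, ∫ x, M θ i j x * (steinKernel (G i) (G j) x - if i = j then 1 else 0) ∂γ =
        ∫ x, steinKernel (G i) (G j) x * M θ i j x ∂γ - if i = j then ∫ x, M θ j j x ∂γ else 0 := by
      intro i
      have e5 : ∀ x, M θ i j x * (steinKernel (G i) (G j) x - if i = j then 1 else 0) =
          steinKernel (G i) (G j) x * M θ i j x - (if i = j then 1 else 0) * M θ i j x :=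
        fun x => by ring
      simp_rw [e5]
      rw [integral_sub (hTMi θ i j) ((hMi θ i j).const_mul _), integral_const_mul]
      split_ifs with hij
      · subst hij; simp
      · simp
    simp_rw [e4]
    rw [Finset.sum_sub_distrib]
    simp
    ring
  have hbound : ∀ θ ∈ Set.Ico (0 : ℝ) (Real.pi / 2), ‖∫ z : EuclideanSpace ℝ (Fin r) × E,
      ⟪k (Real.cos θ • z.1 + Real.sin θ • F z.2),
        -Real.sin θ • z.1 + Real.cos θ • F z.2⟫ ∂(Γ.prod γ)‖ ≤
      Real.sin θ * (Real.sqrt (2 / Real.pi) * S) := by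
    intro θ hθ
    have hs : 0 ≤ Real.sin θ :=
      Real.sin_nonneg_of_nonneg_of_le_pi hθ.1 (by linarith [hθ.2, Real.pi_pos])
    rw [hval, norm_mul, Real.norm_of_nonneg hs]
    refine mul_le_mul_of_nonneg_left ?_ hs
    rw [hS, Finset.mul_sum]
    refine (norm_sum_le _ _).trans (Finset.sum_le_sum fun i _ => ?_)
    rw [Finset.mul_sum]
    refine (norm_sum_le _ _).trans (Finset.sum_le_sum fun j _ => ?_)
    rw [← integral_const_mul]
    refine (norm_integral_le_integral_norm _).trans (integral_mono_of_nonneg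
      (ae_of_all _ fun x => norm_nonneg _) ?_ (ae_of_all _ fun x => ?_))
    · exact ((integrable_steinKernel (hGc i) (hGc j) (hGC i) (hGC j)).sub
        (integrable_const _)).abs.const_mul _
    · simp only [norm_mul, Real.norm_eq_abs]
      exact mul_le_mul_of_nonneg_right (hMb θ i j x) (abs_nonneg _)
  -- The comparison function 1 - cos θ is the primitive of sin θ and equals 1 at π/2, so the path
  -- costs no further constant.
  have hfin := image_norm_le_of_norm_deriv_right_le_deriv_boundary
    (a := 0) (b := Real.pi / 2)
    (f := fun θ : ℝ => ∫ z : EuclideanSpace ℝ (Fin r) × E,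
        h (Real.cos θ • z.1 + Real.sin θ • F z.2) ∂(Γ.prod γ) - ∫ z : EuclideanSpace ℝ (Fin r) × E,
        h (Real.cos 0 • z.1 + Real.sin 0 • F z.2) ∂(Γ.prod γ))
    (B := fun θ => (1 - Real.cos θ) * (Real.sqrt (2 / Real.pi) * S))
    (fun θ _ => ((hderiv θ).sub_const _).continuousAt.continuousWithinAt)
    (fun θ _ => ((hderiv θ).sub_const _).hasDerivWithinAt) (by simp)
    (fun θ => (((Real.hasDerivAt_cos θ).const_sub 1).mul_const _))
    (fun θ hθ => by rw [neg_neg]; exact hbound θ hθ)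
    (Set.right_mem_Icc.2 (by positivity : (0 : ℝ) ≤ Real.pi / 2))
  simp only [Real.cos_pi_div_two, Real.sin_pi_div_two, Real.cos_zero, Real.sin_zero, one_smul,
    zero_smul, zero_add, add_zero, sub_zero, one_mul, Real.norm_eq_abs] at hfin
  rw [integral_fun_fst (f := fun n => h n), integral_fun_snd (f := fun x => h (F x))] at hfin
  simpa using hfin

/-- Gaussian approximation of a smooth bounded function of a Gaussian vector, in terms of its
covariance and of its first two derivatives. -/
lemma abs_integral_comp_sub_integral_stdGaussian_le_of_deriv {F : E → EuclideanSpace ℝ (Fin r)}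
    {G : Fin r → E → E} {H : Fin r → E → E →L[ℝ] E}
    (hF : ∀ i x, HasFDerivAt (fun x => F x i) (innerSL ℝ (G i x)) x)
    (hG : ∀ i x, HasFDerivAt (G i) (H i x) x)
    (hHc : ∀ i, Continuous (H i)) {C : ℝ} (hFC : ∀ x, ‖F x‖ ≤ C) (hGC : ∀ i x, ‖G i x‖ ≤ C)
    (hHC : ∀ i x, ‖H i x‖ ≤ C) (hmean : ∀ i, ∫ x, F x i ∂(stdGaussian E) = 0)
    {h : EuclideanSpace ℝ (Fin r) → ℝ}
    {k : EuclideanSpace ℝ (Fin r) → EuclideanSpace ℝ (Fin r)}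
    {K : EuclideanSpace ℝ (Fin r) → EuclideanSpace ℝ (Fin r) →L[ℝ] EuclideanSpace ℝ (Fin r)}
    (hh : ∀ w, HasFDerivAt h (innerSL ℝ (k w)) w)
    (hk : ∀ w, HasFDerivAt k (K w) w) (hKc : Continuous K) (hk1 : ∀ w, ‖k w‖ ≤ 1) {C' : ℝ}
    (hKC : ∀ w, ‖K w‖ ≤ C') :
    |∫ x, h (F x) ∂(stdGaussian E) - ∫ n, h n ∂(stdGaussian (EuclideanSpace ℝ (Fin r)))| ≤
      Real.sqrt (2 / Real.pi) *
        (3 * Real.pi / 4 * ((∑ i, Real.sqrt (∫ x, ‖G i x‖ ^ 2 ∂(stdGaussian E))) *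
          ∑ j, Real.sqrt (∫ x, ‖H j x‖ ^ 2 ∂(stdGaussian E))) +
        ∑ i, ∑ j, |∫ x, F x i * F x j ∂(stdGaussian E) - if i = j then 1 else 0|) := by
  have hGc : ∀ i, Continuous (G i) := fun i =>
    continuous_iff_continuousAt.2 fun x => (hG i x).continuousAt
  refine (abs_integral_comp_sub_integral_stdGaussian_le hF hGc hFC hGC hmean hh hk hKc hk1
    hKC).trans (mul_le_mul_of_nonneg_left ?_ (Real.sqrt_nonneg _))
  set a : Fin r → ℝ := fun i => Real.sqrt (∫ x, ‖G i x‖ ^ 2 ∂(stdGaussian E))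
  set b : Fin r → ℝ := fun i => Real.sqrt (∫ x, ‖H i x‖ ^ 2 ∂(stdGaussian E))
  -- The covariance formula says that the mean of the kernel is the covariance of the coordinates.
  have hcov : ∀ i j, ∫ x, steinKernel (G i) (G j) x ∂(stdGaussian E) =
      ∫ x, F x i * F x j ∂(stdGaussian E) := by
    intro i j
    have := integral_mul_sub_stdGaussian (hF i) (hF j) (hGc i) (hGc j)
      (fun x => (PiLp.norm_apply_le _ i).trans (hFC x))
      (fun x => (PiLp.norm_apply_le _ j).trans (hFC x)) (hGC i) (hGC j)
    rw [hmean i, zero_mul, sub_zero] at this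
    exact this.symm
  have hij : ∀ i j, ∫ x, |steinKernel (G i) (G j) x - if i = j then 1 else 0| ∂(stdGaussian E) ≤
      Real.pi / 2 * (b i * a j + 1 / 2 * (a i * b j)) +
      |∫ x, F x i * F x j ∂(stdGaussian E) - if i = j then 1 else 0| := by
    intro i j
    have hTi := integrable_steinKernel (hGc i) (hGc j) (hGC i) (hGC j)
    have h1 := integral_abs_steinKernel_sub_le (hG i) (hG j) (hHc i) (hHc j) (hGC i) (hGC j)
      (hHC i) (hHC j)
    rw [hcov] at h1
    refine le_trans ?_ (add_le_add_left h1 _)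
    have e : |∫ x, F x i * F x j ∂(stdGaussian E) - if i = j then 1 else 0| =
        ∫ _, |∫ x, F x i * F x j ∂(stdGaussian E) - if i = j then 1 else 0| ∂(stdGaussian E) := by
      simp
    have hi : Integrable (fun x => |steinKernel (G i) (G j) x -
        ∫ x, F x i * F x j ∂(stdGaussian E)|) (stdGaussian E) := (hTi.sub (integrable_const _)).abs
    rw [e, ← integral_add hi (integrable_const _)]
    refine integral_mono_of_nonneg (ae_of_all _ fun x => abs_nonneg _)
      (hi.add (integrable_const _)) (ae_of_all _ fun x => ?_)
    exact abs_sub_le _ _ _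
  -- Summing over i and j makes both products equal to (Σ a)(Σ b), with total constant π/2 · (1 +
  -- 1/2) = 3π/4.
  refine (Finset.sum_le_sum fun i _ => Finset.sum_le_sum fun j _ => hij i j).trans (le_of_eq ?_)
  simp_rw [Finset.sum_add_distrib, ← Finset.mul_sum, Finset.sum_add_distrib, ← Finset.mul_sum,
    ← Finset.sum_mul]
  ring

end SmartPath

/-! ### Kantorovich-Rubinstein duality. -/

section KantorovichRubinstein

/-- Kantorovich-Rubinstein duality for finite probability vectors: if all differences of means of
functions which are `1`-Lipschitz for `d` are at most `C`, there is a transport plan of cost at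
most `C`. -/
lemma exists_transportPlan_of_forall_lipschitz {ι : Type*} [Fintype ι] [Nonempty ι] (d : ι → ι → ℝ)
    (hd0 : ∀ s, d s s = 0) (hdt : ∀ s t u, d s u ≤ d s t + d t u) {a b : ι → ℝ}
    (ha : ∀ s, 0 ≤ a s) (hb : ∀ s, 0 ≤ b s) (ha1 : ∑ s, a s = 1) (hb1 : ∑ s, b s = 1) {C : ℝ}
    (hC : ∀ φ : ι → ℝ, (∀ s t, φ s - φ t ≤ d s t) → ∑ s, φ s * a s - ∑ s, φ s * b s ≤ C) :
    ∃ w : ι → ι → ℝ, (∀ s t, 0 ≤ w s t) ∧ (∀ s, ∑ t, w s t = a s) ∧ (∀ t, ∑ s, w s t = b t) ∧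
      ∑ s, ∑ t, w s t * d s t ≤ C := by
  classical
  by_contra hcon
  -- L sends a plan to its two marginals and its cost. If no plan is good enough, the compact convex
  -- image of the simplex misses {a} × {b} × (-∞, C], and a separating functional supplies dual
  -- potentials f₁, f₂ and a cost coefficient m.
  let L : (ι × ι → ℝ) → (ι → ℝ) × (ι → ℝ) × ℝ := fun w =>
    (fun s => ∑ t, w (s, t), fun t => ∑ s, w (s, t), ∑ s, ∑ t, w (s, t) * d s t)
  have hLlin : IsLinearMap ℝ L := by
    constructor
    · intro w w'
      ext <;> simp [L, Finset.sum_add_distrib, add_mul]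
    · intro c w
      ext <;> simp [L, Finset.mul_sum, mul_assoc]
  have hLc : Continuous L := by fun_prop
  have hdisj : Disjoint (L '' stdSimplex ℝ (ι × ι)) ({a} ×ˢ {b} ×ˢ Set.Iic C) := by
    rw [Set.disjoint_left]
    rintro _ ⟨w, hw, rfl⟩ ⟨h1, h2, h3⟩
    refine hcon ⟨fun s t => w (s, t), fun s t => hw.1 _, fun s => congrFun h1 s,
      fun t => congrFun h2 t, h3⟩
  obtain ⟨f, u, v, hfu, huv, hfv⟩ := geometric_hahn_banach_compact_closed
    ((convex_stdSimplex ℝ (ι × ι)).is_linear_image hLlin)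
    ((isCompact_stdSimplex ℝ (ι × ι)).image hLc)
    ((convex_singleton a).prod ((convex_singleton b).prod (convex_Iic C)))
    (isClosed_singleton.prod (isClosed_singleton.prod isClosed_Iic)) hdisj
  set f₁ : ι → ℝ := fun s => f (Pi.single s 1, 0, 0)
  set f₂ : ι → ℝ := fun s => f (0, Pi.single s 1, 0)
  set m : ℝ := f (0, 0, 1)
  have hf : ∀ α β c, f (α, β, c) = ∑ s, α s * f₁ s + ∑ s, β s * f₂ s + c * m := by
    intro α β c
    have e1 : (α, β, c) = ∑ s, α s • ((Pi.single s 1, 0, 0) : (ι → ℝ) × (ι → ℝ) × ℝ) +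
        ∑ s, β s • ((0, Pi.single s 1, 0) : (ι → ℝ) × (ι → ℝ) × ℝ) + c • (0, 0, 1) := by
      ext s
      · simp [Prod.fst_sum, Finset.sum_apply, Pi.single_apply]
      · simp [Prod.snd_sum, Prod.fst_sum, Finset.sum_apply, Pi.single_apply]
      · simp [Prod.snd_sum]
    rw [e1]
    simp only [map_add, map_sum, map_smul, smul_eq_mul, f₁, f₂, m]
  have hmem : L (fun p => a p.1 * b p.2) ∈ L '' stdSimplex ℝ (ι × ι) := by
    refine ⟨_, ⟨fun p => mul_nonneg (ha _) (hb _), ?_⟩, rfl⟩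
    rw [Fintype.sum_prod_type]
    simp [← Finset.mul_sum, ha1, hb1]
  have hLab : L (fun p => a p.1 * b p.2) = (a, b, ∑ s, ∑ t, a s * b t * d s t) := by
    ext s
    · simp [L, ← Finset.mul_sum, hb1]
    · simp [L, ← Finset.sum_mul, ha1]
    · simp [L]
  -- The product plan and a point of the closed set have the same marginals and differ only in the
  -- cost coordinate; separation forces the sign of its coefficient.
  have hm : m < 0 := by
    have h1 := hfu _ hmem
    rw [hLab, hf] at h1
    have h2 := hfv (a, b, min C (∑ s, ∑ t, a s * b t * d s t)) 
      ⟨rfl, rfl, Set.mem_Iic.2 (min_le_left _ _)⟩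
    rw [hf] at h2
    have h3 : (∑ s, ∑ t, a s * b t * d s t - min C (∑ s, ∑ t, a s * b t * d s t)) * m < 0 := by
      linarith
    exact (pos_iff_neg_of_mul_neg h3).1 ((sub_nonneg.2 (min_le_right _ _)).lt_of_ne fun h => by
      rw [← h, zero_mul] at h3; exact h3.false)
  have hst : ∀ s t, f₁ s + f₂ t - u ≤ -m * d s t := by
    intro s t
    have h1 := hfu _ ⟨_, single_mem_stdSimplex ℝ (s, t), rfl⟩
    have e : L (Pi.single (s, t) 1) = (Pi.single s 1, Pi.single t 1, d s t) := by
      ext x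
      · simp [L, Pi.single_apply, ite_and]
      · simp [L, Pi.single_apply, ite_and]
      · simp [L, Pi.single_apply, ite_and]
    rw [e, hf] at h1
    simp [Pi.single_apply] at h1
    linarith
  -- The infimal convolution of the second potential with d. It is 1-Lipschitz by the triangle
  -- inequality and lies between f₁/(-m) and (u - f₂)/(-m), so this single function replaces both
  -- potentials.
  let φ : ι → ℝ := fun s =>
    Finset.univ.inf' Finset.univ_nonempty fun t => d s t - (f₂ t - u) / (-m)
  have hm' : 0 < -m := by linarith
  have hφ : ∀ s t, φ s - φ t ≤ d s t := by
    intro s t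
    obtain ⟨x, -, hx⟩ := Finset.exists_mem_eq_inf' Finset.univ_nonempty
      fun x => d t x - (f₂ x - u) / (-m)
    have h1 : φ s ≤ d s x - (f₂ x - u) / (-m) := Finset.inf'_le _ (Finset.mem_univ x)
    have h2 : φ t = d t x - (f₂ x - u) / (-m) := hx
    have := hdt s t x
    linarith
  have h1 : ∀ s, f₁ s ≤ -m * φ s := by
    intro s
    obtain ⟨x, -, hx⟩ := Finset.exists_mem_eq_inf' Finset.univ_nonempty
      fun x => d s x - (f₂ x - u) / (-m)
    have h2 : φ s = d s x - (f₂ x - u) / (-m) := hx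
    rw [h2, mul_sub, mul_div_cancel₀ _ hm'.ne']
    have := hst s x
    linarith
  have h2 : ∀ s, f₂ s ≤ u - -m * φ s := by
    intro s
    have h3 : φ s ≤ d s s - (f₂ s - u) / (-m) := Finset.inf'_le _ (Finset.mem_univ s)
    rw [hd0, zero_sub] at h3
    have h4 := mul_le_mul_of_nonneg_left h3 hm'.le
    rw [mul_neg, mul_div_cancel₀ _ hm'.ne'] at h4
    linarith
  -- At (a, b, C) the functional exceeds v > u, whereas the bounds on f₁ and f₂ together with the
  -- hypothesis on φ give at most u.
  have h3 := hfv (a, b, C) ⟨rfl, rfl, le_refl C⟩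
  rw [hf] at h3
  have h4 : ∑ s, a s * f₁ s ≤ -m * ∑ s, φ s * a s := by
    rw [Finset.mul_sum]
    exact Finset.sum_le_sum fun s _ => by nlinarith [mul_le_mul_of_nonneg_left (h1 s) (ha s)]
  have h5 : ∑ s, b s * f₂ s ≤ u - -m * ∑ s, φ s * b s := by
    have e : u - -m * ∑ s, φ s * b s = ∑ s, b s * (u - -m * φ s) := by
      simp_rw [mul_sub, Finset.sum_sub_distrib, ← Finset.sum_mul, hb1, Finset.mul_sum, one_mul]
      congr 1
      exact Finset.sum_congr rfl fun s _ => by ring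
    rw [e]
    exact Finset.sum_le_sum fun s _ => mul_le_mul_of_nonneg_left (h2 s) (hb s)
  have h6 := mul_le_mul_of_nonneg_left (hC φ hφ) hm'.le
  linarith

/-- A transport plan between the masses that two measures give to the pieces of a partition lifts
to a coupling. -/
lemma exists_isCoupling_of_transportPlan {E ι : Type*} [MeasurableSpace E] [Fintype ι]
    (μ ν : Measure E) [IsProbabilityMeasure μ] [IsProbabilityMeasure ν] {A : ι → Set E}
    (hA : ∀ s, MeasurableSet (A s)) (hAd : Pairwise (Function.onFun Disjoint A))
    (hAu : ⋃ s, A s = Set.univ) {w : ι → ι → ℝ} (hw : ∀ s t, 0 ≤ w s t)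
    (hw1 : ∀ s, ∑ t, w s t = μ.real (A s)) (hw2 : ∀ t, ∑ s, w s t = ν.real (A t)) :
    ∃ π : Measure (E × E), IsCoupling π μ ν ∧ ∀ (g : E × E → ℝ≥0∞) (c : ι → ι → ℝ≥0∞),
      (∀ s t, ∀ x ∈ A s, ∀ y ∈ A t, g (x, y) ≤ c s t) →
      ∫⁻ z, g z ∂π ≤ ∑ s, ∑ t, ENNReal.ofReal (w s t) * c s t := by
  have hz1 : ∀ s t, μ (A s) = 0 → w s t = 0 := by
    intro s t h
    have h1 := hw1 s
    rw [measureReal_def, h, ENNReal.toReal_zero] at h1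
    exact (Finset.sum_eq_zero_iff_of_nonneg fun t _ => hw s t).1 h1 t (Finset.mem_univ _)
  have hz2 : ∀ s t, ν (A t) = 0 → w s t = 0 := by
    intro s t h
    have h1 := hw2 t
    rw [measureReal_def, h, ENNReal.toReal_zero] at h1
    exact (Finset.sum_eq_zero_iff_of_nonneg fun s _ => hw s t).1 h1 s (Finset.mem_univ _)
  have hs1 : ∀ s, ∑ t, ENNReal.ofReal (w s t) = μ (A s) := by
    intro s
    rw [← ENNReal.ofReal_sum_of_nonneg fun t _ => hw s t, hw1, ofReal_measureReal]
  have hs2 : ∀ t, ∑ s, ENNReal.ofReal (w s t) = ν (A t) := by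
    intro t
    rw [← ENNReal.ofReal_sum_of_nonneg fun s _ => hw s t, hw2, ofReal_measureReal]
  -- On A s × A t the coupling is the product measure rescaled to mass w s t. If a piece has mass
  -- zero then w s t = 0, and the convention 0 · ∞ = 0 makes q vanish despite the infinite inverse.
  let q : ι → ι → ℝ≥0∞ := fun s t => ENNReal.ofReal (w s t) * (μ (A s))⁻¹ * (ν (A t))⁻¹
  have hq1 : ∀ s t, q s t * ν (A t) = ENNReal.ofReal (w s t) * (μ (A s))⁻¹ := by
    intro s t
    by_cases h : ν (A t) = 0
    · simp [q, hz2 s t h]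
    · simp only [q]
      rw [mul_assoc, ENNReal.inv_mul_cancel h (measure_ne_top _ _), mul_one]
  have hq2 : ∀ s t, q s t * μ (A s) = ENNReal.ofReal (w s t) * (ν (A t))⁻¹ := by
    intro s t
    by_cases h : μ (A s) = 0
    · simp [q, hz1 s t h]
    · simp only [q]
      rw [mul_right_comm, mul_assoc (ENNReal.ofReal (w s t)),
        ENNReal.inv_mul_cancel h (measure_ne_top _ _), mul_one]
  have hq3 : ∀ s t, q s t * (μ (A s) * ν (A t)) = ENNReal.ofReal (w s t) := by
    intro s t
    rw [mul_comm (μ (A s)), ← mul_assoc, hq1, mul_assoc]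
    by_cases h : μ (A s) = 0
    · simp [hz1 s t h]
    · rw [ENNReal.inv_mul_cancel h (measure_ne_top _ _), mul_one]
  have hr : ∀ (ρ : Measure E), ρ = ∑ s, ρ.restrict (A s) := by
    intro ρ
    conv_lhs => rw [← Measure.restrict_univ (μ := ρ), ← hAu, Measure.restrict_iUnion hAd hA,
      Measure.sum_fintype]
  refine ⟨∑ s, ∑ t, q s t • (μ.restrict (A s)).prod (ν.restrict (A t)), ⟨?_, ?_⟩, ?_⟩
  · rw [Measure.map_finset_sum measurable_fst.aemeasurable]
    conv_rhs => rw [hr μ]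
    refine Finset.sum_congr rfl fun s _ => ?_
    rw [Measure.map_finset_sum measurable_fst.aemeasurable]
    simp_rw [Measure.map_smul, Measure.map_fst_prod, Measure.restrict_apply_univ, smul_smul, hq1]
    rw [← Finset.sum_smul, ← Finset.sum_mul, hs1]
    by_cases h : μ (A s) = 0
    · simp [Measure.restrict_eq_zero.2 h]
    · rw [ENNReal.mul_inv_cancel h (measure_ne_top _ _), one_smul]
  · rw [Finset.sum_comm, Measure.map_finset_sum measurable_snd.aemeasurable]
    conv_rhs => rw [hr ν]
    refine Finset.sum_congr rfl fun t _ => ?_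
    rw [Measure.map_finset_sum measurable_snd.aemeasurable]
    simp_rw [Measure.map_smul, Measure.map_snd_prod, Measure.restrict_apply_univ, smul_smul, hq2]
    rw [← Finset.sum_smul, ← Finset.sum_mul, hs2]
    by_cases h : ν (A t) = 0
    · simp [Measure.restrict_eq_zero.2 h]
    · rw [ENNReal.mul_inv_cancel h (measure_ne_top _ _), one_smul]
  · intro g c hg
    rw [lintegral_finsetSum_measure]
    refine Finset.sum_le_sum fun s _ => ?_
    rw [lintegral_finsetSum_measure]
    refine Finset.sum_le_sum fun t _ => ?_
    rw [lintegral_smul_measure, Measure.prod_restrict, smul_eq_mul]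
    calc _ ≤ q s t * ∫⁻ _ in A s ×ˢ A t, c s t ∂(μ.prod ν) := by
          gcongr 1
          exact setLIntegral_mono' ((hA s).prod (hA t)) fun z hz => hg s t z.1 hz.1 z.2 hz.2
      _ = ENNReal.ofReal (w s t) * c s t := by
          rw [setLIntegral_const, Measure.prod_prod, mul_comm (c s t), ← mul_assoc, hq3]

/-- Kantorovich-Rubinstein duality: a bound of the differences of means of all `1`-Lipschitz
functions is a bound of the Wasserstein distance. -/
lemma wassersteinOne_le_of_forall_lipschitz {E : Type*} [NormedAddCommGroup E]
    [SecondCountableTopology E] [MeasurableSpace E] [BorelSpace E] {μ ν : Measure E}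
    [IsProbabilityMeasure μ] [IsProbabilityMeasure ν] (hμ : Integrable id μ) (hν : Integrable id ν)
    {C : ℝ} (hC : ∀ h : E → ℝ, LipschitzWith 1 h → ∫ x, h x ∂μ - ∫ x, h x ∂ν ≤ C) :
    wassersteinOne μ ν ≤ ENNReal.ofReal C := by
  have hC0 : 0 ≤ C := by simpa using hC (fun _ => 0) (LipschitzWith.const 0 |>.weaken zero_le_one)
  classical
  refine ENNReal.le_of_forall_pos_le_add fun ε hε _ => ?_
  -- Four errors of size δ occur: two when the hypothesis is transferred to the discretised
  -- measures, two when the points are moved to their discretisations.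
  set δ : ℝ := ε / 4 with hδ
  have hδ0 : 0 < δ := by positivity
  have hev := ((SimpleFunc.tendsto_approxOn_range_L1_enorm (f := (id : E → E)) measurable_id
    hμ).eventually (gt_mem_nhds (ENNReal.ofReal_pos.2 hδ0))).and
    ((SimpleFunc.tendsto_approxOn_range_L1_enorm (f := (id : E → E)) measurable_id
    hν).eventually (gt_mem_nhds (ENNReal.ofReal_pos.2 hδ0)))
  obtain ⟨n, hn1, hn2⟩ := hev.exists
  -- A finite-range map that is δ-close to the identity in L¹ for μ and for ν at once; its fibres
  -- form the partition.
  set T := SimpleFunc.approxOn (id : E → E) measurable_id (Set.range id ∪ {0}) 0 (by simp) n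
  have hTi : ∀ (ρ : Measure E) [IsProbabilityMeasure ρ], ∀ h : E → ℝ,
      ∫ x, h (T x) ∂ρ = ∑ s : T.range, h s * ρ.real (T ⁻¹' {(s : E)}) := by
    intro ρ _ h
    have e : ∀ x, h (T x) = ∑ s : T.range, (T ⁻¹' {(s : E)}).indicator (fun _ => h s) x := by
      intro x
      rw [Finset.sum_eq_single ⟨T x, T.mem_range_self x⟩]
      · simp
      · intro s _ hs
        refine Set.indicator_of_notMem (fun hx => hs (Subtype.ext ?_)) _
        exact hx.symm
      · simp
    simp_rw [e]
    rw [integral_finsetSum _ fun s _ => (integrable_const _).indicator (T.measurableSet_fiber _)]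
    refine Finset.sum_congr rfl fun s _ => ?_
    rw [integral_indicator_const _ (T.measurableSet_fiber _), smul_eq_mul, mul_comm]
  have hclose : ∀ (ρ : Measure E) [IsProbabilityMeasure ρ], Integrable id ρ →
      ∫⁻ x, ‖T x - id x‖ₑ ∂ρ < ENNReal.ofReal δ → ∀ h : E → ℝ, LipschitzWith 1 h →
      |∫ x, h (T x) ∂ρ - ∫ x, h x ∂ρ| ≤ δ := by
    intro ρ _ hρ hlt h hh
    have hhi : Integrable h ρ := by
      refine ((integrable_const ‖h 0‖).add hρ.norm).mono' hh.continuous.aestronglyMeasurable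
        (ae_of_all _ fun x => ?_)
      have h1 := hh.dist_le_mul x 0
      rw [NNReal.coe_one, one_mul, dist_zero_right, Real.dist_eq] at h1
      have h2 := abs_sub_abs_le_abs_sub (h x) (h 0)
      simp only [Pi.add_apply, Real.norm_eq_abs, id] at h2 ⊢
      linarith
    have hTh : Integrable (fun x => h (T x)) ρ :=
      SimpleFunc.integrable_of_isFiniteMeasure (T.map h)
    rw [← integral_sub hTh hhi]
    refine abs_integral_le_integral_abs.trans ?_
    rw [integral_eq_lintegral_of_nonneg_ae (ae_of_all _ fun x => abs_nonneg _)
      (show Integrable (fun x => |h (T x) - h x|) ρ from (hTh.sub hhi).abs).aestronglyMeasurable]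
    refine ENNReal.toReal_le_of_le_ofReal hδ0.le (le_trans (lintegral_mono fun x => ?_) hlt.le)
    rw [← ofReal_norm]
    refine ENNReal.ofReal_le_ofReal ?_
    have h1 := hh.dist_le_mul (T x) x
    rwa [NNReal.coe_one, one_mul, Real.dist_eq, dist_eq_norm] at h1
  have hne : Nonempty T.range := ⟨⟨T 0, T.mem_range_self 0⟩⟩
  have hpart : ⋃ s : T.range, T ⁻¹' {(s : E)} = Set.univ := by
    ext x
    simp only [Set.mem_iUnion, Set.mem_preimage, Set.mem_singleton_iff, Set.mem_univ, iff_true]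
    exact ⟨⟨T x, T.mem_range_self x⟩, rfl⟩
  have hdisj : Pairwise (Function.onFun Disjoint fun s : T.range => T ⁻¹' {(s : E)}) := by
    intro s t hst
    rw [Function.onFun, Set.disjoint_left]
    intro x hx hy
    exact hst (Subtype.ext (hx.symm.trans hy))
  have hmass : ∀ (ρ : Measure E) [IsProbabilityMeasure ρ],
      ∑ s : T.range, ρ.real (T ⁻¹' {(s : E)}) = 1 := by
    intro ρ _
    have := hTi ρ fun _ => 1
    simpa using this.symm
  obtain ⟨w, hw, hw1, hw2, hwC⟩ := exists_transportPlan_of_forall_lipschitz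
    (fun s t : T.range => dist (s : E) t) (fun s => dist_self _) (fun s t u => dist_triangle _ _ _)
    (a := fun s => μ.real (T ⁻¹' {(s : E)})) (b := fun s => ν.real (T ⁻¹' {(s : E)}))
    (fun s => measureReal_nonneg) (fun s => measureReal_nonneg) (hmass μ) (hmass ν)
    (C := C + 2 * δ) (by
      intro φ hφ
      -- A potential on the finite range is extended to a 1-Lipschitz function on all of E, to which
      -- the hypothesis applies.
      have hlip : LipschitzOnWith 1 (fun x : E => if hx : x ∈ T.range then φ ⟨x, hx⟩ else 0)
          (T.range : Set E) := by
        refine LipschitzOnWith.of_dist_le_mul fun x hx y hy => ?_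
        rw [Finset.mem_coe] at hx hy
        rw [NNReal.coe_one, one_mul, dif_pos hx, dif_pos hy, Real.dist_eq, abs_sub_le_iff]
        refine ⟨hφ _ _, ?_⟩
        rw [dist_comm]
        exact hφ ⟨y, hy⟩ ⟨x, hx⟩
      obtain ⟨h, hh, heq⟩ := hlip.extend_real
      have hφh : ∀ s : T.range, φ s = h s := by
        intro s
        rw [← heq s.2]
        simp only [Finset.coe_mem, dite_true, Subtype.coe_eta]
      simp_rw [hφh]
      rw [← hTi μ h, ← hTi ν h]
      have h1 := abs_le.1 (hclose μ hμ hn1 h hh)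
      have h2 := abs_le.1 (hclose ν hν hn2 h hh)
      have h3 := hC h hh
      linarith)
  obtain ⟨π, hπ, hcost⟩ := exists_isCoupling_of_transportPlan μ ν
    (fun s : T.range => T.measurableSet_fiber s) hdisj hpart hw hw1 hw2
  have hTm : Measurable fun x => ‖T x - id x‖ₑ := by fun_prop
  have hc1 : ∫⁻ z, ‖T z.1 - id z.1‖ₑ ∂π ≤ ENNReal.ofReal δ := by
    rw [← lintegral_map hTm measurable_fst, hπ.1]; exact hn1.le
  have hc2 : ∫⁻ z, ‖T z.2 - id z.2‖ₑ ∂π ≤ ENNReal.ofReal δ := by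
    rw [← lintegral_map hTm measurable_snd, hπ.2]; exact hn2.le
  have hc3 : ∫⁻ z, edist (T z.1) (T z.2) ∂π ≤ ENNReal.ofReal (C + 2 * δ) := by
    refine (hcost (fun z => edist (T z.1) (T z.2)) (fun s t => edist (s : E) t) ?_).trans ?_
    · intro s t x hx y hy
      simp only [Set.mem_preimage, Set.mem_singleton_iff] at hx hy
      simp only [hx, hy, le_refl]
    · refine le_trans (le_of_eq ?_) (ENNReal.ofReal_le_ofReal hwC)
      rw [ENNReal.ofReal_sum_of_nonneg fun s _ => Finset.sum_nonneg fun t _ =>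
        mul_nonneg (hw s t) dist_nonneg]
      refine Finset.sum_congr rfl fun s _ => ?_
      rw [ENNReal.ofReal_sum_of_nonneg fun t _ => mul_nonneg (hw s t) dist_nonneg]
      refine Finset.sum_congr rfl fun t _ => ?_
      rw [ENNReal.ofReal_mul (hw s t), edist_dist]
  calc wassersteinOne μ ν ≤ ∫⁻ z, edist z.1 z.2 ∂π := iInf₂_le π hπ
    _ ≤ ∫⁻ z, (‖T z.1 - id z.1‖ₑ + (edist (T z.1) (T z.2) + ‖T z.2 - id z.2‖ₑ)) ∂π := by
        refine lintegral_mono fun z => ?_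
        have h1 : edist z.1 (T z.1) = ‖T z.1 - id z.1‖ₑ := by
          rw [edist_comm, edist_eq_enorm_sub]; rfl
        have h2 : edist (T z.2) z.2 = ‖T z.2 - id z.2‖ₑ := by
          rw [edist_eq_enorm_sub]; rfl
        rw [← h1, ← h2]
        exact (edist_triangle _ (T z.1) _).trans (by gcongr; exact edist_triangle _ (T z.2) _)
    _ ≤ ENNReal.ofReal δ + (ENNReal.ofReal (C + 2 * δ) + ENNReal.ofReal δ) := by
        rw [lintegral_add_left (f := fun z : E × E => ‖T z.1 - id z.1‖ₑ) (hTm.comp measurable_fst),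
          lintegral_add_right (g := fun z : E × E => ‖T z.2 - id z.2‖ₑ) _ (hTm.comp measurable_snd)]
        gcongr
    _ = ENNReal.ofReal C + ε := by
        rw [← ENNReal.ofReal_add (by positivity) (by positivity),
          ← ENNReal.ofReal_add (by positivity) (by positivity), ← ENNReal.ofReal_coe_nnreal,
          ← ENNReal.ofReal_add hC0 (by positivity)]
        congr 1
        rw [hδ]; ring

end KantorovichRubinstein

/-! ### Smoothing of Lipschitz test functions. -/

section Mollification

open scoped RealInnerProductSpace Convolution

variable {E : Type*} [NormedAddCommGroup E] [InnerProductSpace ℝ E] [FiniteDimensional ℝ E]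
  [MeasurableSpace E] [BorelSpace E]

/-- Moving the base point translates g only, so g needs no derivative. With f the mollifier this
bounds the gradient, with f its derivative the Hessian. -/
lemma norm_convolution_sub_le_of_lipschitz {F₁ F₂ F₃ : Type*} [NormedAddCommGroup F₁]
    [NormedSpace ℝ F₁] [NormedAddCommGroup F₂] [NormedSpace ℝ F₂] [NormedAddCommGroup F₃]
    [NormedSpace ℝ F₃] {f : E → F₁} {g : E → F₂} (L : F₁ →L[ℝ] F₂ →L[ℝ] F₃) (hf : Continuous f)
    (hfs : HasCompactSupport f) (hg : LipschitzWith 1 g) (x y : E) :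
    ‖(f ⋆[L, volume] g) x - (f ⋆[L, volume] g) y‖ ≤ (∫ t, ‖L (f t)‖) * ‖x - y‖ := by
  have hi : ∀ x, Integrable fun t => L (f t) (g (x - t)) := fun x => by
    have := hg.continuous
    refine Continuous.integrable_of_hasCompactSupport (by fun_prop) (hfs.mono fun t ht => ?_)
    contrapose! ht
    simp only [Function.mem_support, not_not] at ht ⊢
    simp [ht]
  have hi2 : Integrable fun t => ‖L (f t)‖ := by
    refine Continuous.integrable_of_hasCompactSupport (by fun_prop) (hfs.mono fun t ht => ?_)
    contrapose! ht
    simp only [Function.mem_support, not_not] at ht ⊢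
    simp [ht]
  rw [convolution_def, convolution_def, ← integral_sub (hi x) (hi y), ← integral_mul_const]
  refine norm_integral_le_of_norm_le (hi2.mul_const _) (ae_of_all _ fun t => ?_)
  rw [← map_sub]
  refine ((L (f t)).le_opNorm _).trans (mul_le_mul_of_nonneg_left ?_ (norm_nonneg _))
  have := hg.dist_le_mul (x - t) (y - t)
  simpa [dist_eq_norm] using this

/-- A `1`-Lipschitz function is uniformly close to one that is twice continuously differentiable,
with gradient bounded by `1` and bounded Hessian. -/
lemma exists_smooth_approx_of_lipschitz {h : E → ℝ} (hh : LipschitzWith 1 h) {δ : ℝ} (hδ : 0 < δ) :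
    ∃ (h' : E → ℝ) (k : E → E) (K : E → E →L[ℝ] E) (C : ℝ),
      (∀ w, HasFDerivAt h' (innerSL ℝ (k w)) w) ∧ (∀ w, HasFDerivAt k (K w) w) ∧ Continuous K ∧
      (∀ w, ‖k w‖ ≤ 1) ∧ (∀ w, ‖K w‖ ≤ C) ∧ ∀ w, |h' w - h w| ≤ δ := by
  -- Averaging a 1-Lipschitz function over a ball of radius δ moves it by at most δ.
  let φ : ContDiffBump (0 : E) := ⟨δ / 2, δ, by positivity, by linarith⟩
  set ρ : E → ℝ := φ.normed volume
  have hρs : HasCompactSupport ρ := φ.hasCompactSupport_normed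
  have hρc : ContDiff ℝ (⊤ : ℕ∞) ρ := φ.contDiff_normed
  have hloc : LocallyIntegrable h := hh.continuous.locallyIntegrable
  set h' : E → ℝ := ρ ⋆[ContinuousLinearMap.lsmul ℝ ℝ, volume] h
  have hh'c : ContDiff ℝ (⊤ : ℕ∞) h' :=
    hρs.contDiff_convolution_left (ContinuousLinearMap.lsmul ℝ ℝ) hρc hloc
  have hfd : ∀ w, HasFDerivAt h'
      ((fderiv ℝ ρ ⋆[(ContinuousLinearMap.lsmul ℝ ℝ).precompL E, volume] h) w) w :=
    hρs.hasFDerivAt_convolution_left (ContinuousLinearMap.lsmul ℝ ℝ)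
      (hρc.of_le (by exact_mod_cast le_top)) hloc
  have hlip1 : LipschitzWith 1 h' := by
    refine LipschitzWith.of_dist_le_mul fun x y => ?_
    rw [dist_eq_norm, dist_eq_norm]
    refine (norm_convolution_sub_le_of_lipschitz _ hρc.continuous hρs hh x y).trans_eq ?_
    congr 1
    rw [NNReal.coe_one, ← φ.integral_normed (μ := volume)]
    congr 1
    ext t
    rw [ContinuousLinearMap.opNorm_lsmul_apply, Real.norm_of_nonneg (φ.nonneg_normed t)]
  -- The gradient of h' is ∇ρ ⋆ h, hence Lipschitz with constant M; this bounds the Hessian although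
  -- h is merely Lipschitz.
  set M : ℝ := ∫ t, ‖(ContinuousLinearMap.lsmul ℝ ℝ : ℝ →L[ℝ] ℝ →L[ℝ] ℝ).precompL E (fderiv ℝ ρ t)‖
  have hM0 : 0 ≤ M := integral_nonneg fun t => ContinuousLinearMap.opNorm_nonneg _
  have hlip2 : LipschitzWith ⟨M, hM0⟩ (fderiv ℝ h') := by
    refine LipschitzWith.of_dist_le_mul fun x y => ?_
    rw [dist_eq_norm, dist_eq_norm, (hfd x).fderiv, (hfd y).fderiv]
    exact norm_convolution_sub_le_of_lipschitz _
      (hρc.continuous_fderiv (by simp)) (hρs.fderiv ℝ) hh x y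
  set e := (InnerProductSpace.toDual ℝ E).symm
  have hk2 : ContDiff ℝ 1 (fun w => e (fderiv ℝ h' w)) :=
    e.contDiff.comp (hh'c.fderiv_right (m := 1)
      (show ((1 + 1 : ℕ∞) : WithTop ℕ∞) ≤ _ from WithTop.coe_le_coe.2 le_top))
  have hlip3 : LipschitzWith ⟨M, hM0⟩ (fun w => e (fderiv ℝ h' w)) :=
    LipschitzWith.of_dist_le_mul fun x y => by
      rw [e.dist_map]; exact hlip2.dist_le_mul x y
  refine ⟨h', fun w => e (fderiv ℝ h' w), fderiv ℝ (fun w => e (fderiv ℝ h' w)), M, ?_, ?_, ?_,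
    ?_, ?_, ?_⟩
  · intro w
    refine (hfd w).differentiableAt.hasFDerivAt.congr_fderiv ?_
    ext v
    simp [e]
  · exact fun w => (hk2.differentiable (by simp) w).hasFDerivAt
  · exact hk2.continuous_fderiv (by simp)
  · intro w
    rw [e.norm_map]
    simpa using norm_fderiv_le_of_lipschitz ℝ (x₀ := w) hlip1
  · exact fun w => norm_fderiv_le_of_lipschitz ℝ hlip3
  · intro w
    refine φ.dist_normed_convolution_le (ε := δ) hh.continuous.aestronglyMeasurable fun x hx => ?_
    have := hh.dist_le_mul x w
    rw [NNReal.coe_one, one_mul] at this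
    exact this.trans (Metric.mem_ball.1 hx).le

/-- Kantorovich-Rubinstein duality with smooth test functions. -/
lemma wassersteinOne_le_of_forall_smooth {μ ν : Measure E}
    [IsProbabilityMeasure μ] [IsProbabilityMeasure ν] (hμ : Integrable id μ) (hν : Integrable id ν)
    {C : ℝ} (hC : ∀ (h : E → ℝ) (k : E → E) (K : E → E →L[ℝ] E) (C' : ℝ),
      (∀ w, HasFDerivAt h (innerSL ℝ (k w)) w) → (∀ w, HasFDerivAt k (K w) w) → Continuous K →
      (∀ w, ‖k w‖ ≤ 1) → (∀ w, ‖K w‖ ≤ C') → |∫ x, h x ∂μ - ∫ x, h x ∂ν| ≤ C) :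
    wassersteinOne μ ν ≤ ENNReal.ofReal C := by
  refine wassersteinOne_le_of_forall_lipschitz hμ hν fun h hh => ?_
  refine le_of_forall_pos_le_add fun ε hε => ?_
  obtain ⟨h', k, K, C', h1, h2, h3, h4, h5, h6⟩ :=
    exists_smooth_approx_of_lipschitz hh (half_pos hε)
  have h7 := (abs_le.1 (hC h' k K C' h1 h2 h3 h4 h5)).2
  have hi : ∀ {ρ : Measure E} [IsProbabilityMeasure ρ], Integrable id ρ → Integrable h ρ := by
    intro ρ _ hρ
    refine ((integrable_const ‖h 0‖).add hρ.norm).mono' hh.continuous.aestronglyMeasurable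
      (ae_of_all _ fun x => ?_)
    have h1 := hh.dist_le_mul x 0
    rw [NNReal.coe_one, one_mul, dist_zero_right, Real.dist_eq] at h1
    have h2 := abs_sub_abs_le_abs_sub (h x) (h 0)
    simp only [Pi.add_apply, Real.norm_eq_abs, id] at h2 ⊢
    linarith
  have hc : Continuous h' := continuous_iff_continuousAt.2 fun x => (h1 x).continuousAt
  have hcl : ∀ {ρ : Measure E} [IsProbabilityMeasure ρ], Integrable id ρ →
      |∫ x, h' x ∂ρ - ∫ x, h x ∂ρ| ≤ ε / 2 := by
    intro ρ _ hρ
    have hd : Integrable (fun x => h' x - h x) ρ :=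
      .of_bound (hc.sub hh.continuous).aestronglyMeasurable (ε / 2) (ae_of_all _ h6)
    have hh'i : Integrable h' ρ := by
      refine (hd.add (hi hρ)).congr (ae_of_all _ fun x => ?_)
      simp
    rw [← integral_sub hh'i (hi hρ)]
    have h6' : ∀ᵐ x ∂ρ, ‖h' x - h x‖ ≤ ε / 2 := ae_of_all _ h6
    exact (norm_integral_le_of_norm_le_const h6').trans (by simp)
  have h8 := abs_le.1 (hcl hμ)
  have h9 := abs_le.1 (hcl hν)
  linarith

end Mollification

/-! ### Mollification of weak derivatives. -/

section WeakDerivative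

open scoped RealInnerProductSpace Convolution

variable {d : ℕ} {F : Type*} [NormedAddCommGroup F] [NormedSpace ℝ F]

/-- The mollification of a weakly differentiable function is differentiable, and its derivative is
the mollification of the weak derivative. -/
lemma HasWeakFDeriv.hasFDerivAt_convolution {f : EuclideanSpace ℝ (Fin d) → F}
    {f' : EuclideanSpace ℝ (Fin d) → EuclideanSpace ℝ (Fin d) →L[ℝ] F} (hf : HasWeakFDeriv f f')
    {ρ : EuclideanSpace ℝ (Fin d) → ℝ} (hρ : ContDiff ℝ (⊤ : ℕ∞) ρ) (hρs : HasCompactSupport ρ)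
    (x : EuclideanSpace ℝ (Fin d)) :
    HasFDerivAt (ρ ⋆[ContinuousLinearMap.lsmul ℝ ℝ, volume] f)
      ((ρ ⋆[ContinuousLinearMap.lsmul ℝ ℝ, volume] f') x) x := by
  have h1 := hρs.hasFDerivAt_convolution_left (ContinuousLinearMap.lsmul ℝ ℝ)
    (hρ.of_le (by exact_mod_cast le_top)) hf.locallyIntegrable x
  refine h1.congr_fderiv ?_
  ext v
  have i1 := ((hρs.fderiv ℝ).convolutionExists_left
    ((ContinuousLinearMap.lsmul ℝ ℝ : ℝ →L[ℝ] F →L[ℝ] F).precompL (EuclideanSpace ℝ (Fin d)))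
    (hρ.continuous_fderiv (by simp)) hf.locallyIntegrable x).integrable
  have i2 := (hρs.convolutionExists_left (ContinuousLinearMap.lsmul ℝ ℝ) hρ.continuous
    hf.locallyIntegrable_deriv x).integrable
  rw [convolution_def, convolution_def, ContinuousLinearMap.integral_apply i1,
    ContinuousLinearMap.integral_apply i2]
  -- The weak derivative is tested against t ↦ ρ(x - t); the reflection changes the sign of its
  -- gradient and cancels the minus sign of the definition.
  have h2 := hf.integral_eq (fun t => ρ (x - t)) (hρ.comp (contDiff_const.sub contDiff_id))
    (hρs.comp_homeomorph (Homeomorph.subLeft x)) v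
  have h3 : ∀ t, fderiv ℝ (fun t => ρ (x - t)) t = -fderiv ℝ ρ (x - t) := by
    intro t
    have h4 := ((hρ.differentiable (by simp) (x - t)).hasFDerivAt).comp t
      ((hasFDerivAt_id t).const_sub x)
    have h5 : HasFDerivAt (fun t => ρ (x - t)) _ t := h4
    rw [h5.fderiv]
    ext v; simp
  simp_rw [h3, neg_apply, neg_smul] at h2
  rw [integral_neg, neg_inj] at h2
  have e1 := integral_sub_left_eq_self (fun t => (fderiv ℝ ρ t v) • f (x - t)) volume x
  have e2 := integral_sub_left_eq_self (fun t => ρ t • f' (x - t) v) volume x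
  simp only [sub_sub_cancel] at e1 e2
  rw [e1, e2] at h2
  exact h2

variable [CompleteSpace F]

/-- A function whose weak derivative vanishes is constant. -/
lemma HasWeakFDeriv.exists_ae_eq_const {f : EuclideanSpace ℝ (Fin d) → F}
    {f' : EuclideanSpace ℝ (Fin d) → EuclideanSpace ℝ (Fin d) →L[ℝ] F} (hf : HasWeakFDeriv f f')
    (h0 : f' =ᵐ[volume] 0) : ∃ c, f =ᵐ[volume] fun _ => c := by
  -- The ratio of outer to inner radius is kept equal to 2, as almost everywhere convergence of the
  -- mollifications requires a bounded ratio.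
  let φ : ℕ → ContDiffBump (0 : EuclideanSpace ℝ (Fin d)) := fun n =>
    ⟨1 / ((n : ℝ) + 1), 2 * (1 / ((n : ℝ) + 1)), by positivity,
      by have : 0 < 1 / ((n : ℝ) + 1) := by positivity
         linarith⟩
  have hlim : Filter.Tendsto (fun n => (φ n).rOut) Filter.atTop (nhds 0) := by
    have h := (tendsto_one_div_add_atTop_nhds_zero_nat (𝕜 := ℝ)).const_mul 2
    rwa [mul_zero] at h
  have hae := ContDiffBump.ae_convolution_tendsto_right_of_locallyIntegrable (φ := φ) hlim
    (Filter.Eventually.of_forall fun n => le_refl (2 * (φ n).rIn)) hf.locallyIntegrable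
  -- Each mollification has zero derivative and is therefore constant; so is their almost everywhere
  -- limit f.
  have hconst : ∀ n x y, ((φ n).normed volume ⋆[ContinuousLinearMap.lsmul ℝ ℝ, volume] f) x =
      ((φ n).normed volume ⋆[ContinuousLinearMap.lsmul ℝ ℝ, volume] f) y := by
    intro n
    have hd := hf.hasFDerivAt_convolution (φ n).contDiff_normed
      ((φ n).hasCompactSupport_normed (μ := volume))
    refine is_const_of_fderiv_eq_zero (𝕜 := ℝ) (fun x => (hd x).differentiableAt) fun x => ?_
    rw [(hd x).fderiv, convolution_congr (g' := 0) _ Filter.EventuallyEq.rfl h0, convolution_zero]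
    rfl
  obtain ⟨x₀, hx₀⟩ := hae.exists
  refine ⟨f x₀, ?_⟩
  filter_upwards [hae] with x hx
  refine tendsto_nhds_unique hx ?_
  simp_rw [fun n => hconst n x x₀]
  exact hx₀

end WeakDerivative

/-! ### Convergence of mollifications in L², for Lebesgue measure and locally for the Gaussian
measure. -/

section MollificationLTwo

open scoped Convolution

lemma eLpNorm_two_rpow {α F : Type*} [MeasurableSpace α] [NormedAddCommGroup F] (f : α → F)
    (μ : Measure α) : eLpNorm f 2 μ ^ (2 : ℝ) = ∫⁻ x, ‖f x‖ₑ ^ (2 : ℝ) ∂μ := by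
  rw [eLpNorm_eq_lintegral_rpow_enorm_toReal two_ne_zero ENNReal.ofNat_ne_top, ← ENNReal.rpow_mul]
  simp

variable {E : Type*} [NormedAddCommGroup E] [InnerProductSpace ℝ E] [FiniteDimensional ℝ E]
  [MeasurableSpace E] [BorelSpace E]

variable {F : Type*} [NormedAddCommGroup F]

/-- Translations act continuously on `L²`. -/
lemma exists_forall_eLpNorm_translate_sub_le {f : E → F} (hf : MemLp f 2 (volume : Measure E))
    {ε : ℝ≥0∞} (hε : ε ≠ 0) :
    ∃ δ > 0, ∀ t : E, ‖t‖ < δ → eLpNorm (fun x => f (x - t) - f x) 2 volume ≤ ε := by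
  have : Fact ((2 : ℝ≥0∞) ≠ ∞) := ⟨ENNReal.ofNat_ne_top⟩
  have hc : Continuous fun t : E => DomAddAct.mk t +ᵥ hf.toLp f :=
    DomAddAct.continuous_mk.vadd continuous_const
  have h0 := hc.tendsto 0
  rw [EMetric.tendsto_nhds] at h0
  obtain ⟨δ, hδ, hb⟩ := Metric.eventually_nhds_iff.1 (h0 ε (pos_iff_ne_zero.2 hε))
  refine ⟨δ, hδ, fun t ht => ?_⟩
  have h1 := hb (y := -t) (by simpa using ht)
  rw [DomAddAct.mk_vadd_toLp, DomAddAct.mk_vadd_toLp, Lp.edist_toLp_toLp] at h1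
  refine le_trans (le_of_eq ?_) h1.le
  congr 1
  ext x
  simp [sub_eq_neg_add]

variable [NormedSpace ℝ F] [CompleteSpace F]

/-- Jensen's inequality for the probability measure with density the mollifier, obtained from
Hölder's inequality against the constant 1. -/
lemma enorm_convolution_sub_rpow_le {f : E → F} (hf : StronglyMeasurable f)
    (hfl : LocallyIntegrable f) (φ : ContDiffBump (0 : E)) (x : E) :
    ‖(φ.normed volume ⋆[ContinuousLinearMap.lsmul ℝ ℝ, volume] f) x - f x‖ₑ ^ (2 : ℝ) ≤
      ∫⁻ t, ENNReal.ofReal (φ.normed volume t) * ‖f (x - t) - f x‖ₑ ^ (2 : ℝ) := by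
  set ρ : E → ℝ := φ.normed volume
  have hρ0 : ∀ t, 0 ≤ ρ t := fun t => φ.nonneg_normed t
  have hρm : Measurable fun t => ENNReal.ofReal (ρ t) :=
    φ.continuous_normed.measurable.ennreal_ofReal
  have hi : Integrable fun t => ρ t • f (x - t) :=
    ((φ.hasCompactSupport_normed (μ := volume)).convolutionExists_left (ContinuousLinearMap.lsmul ℝ ℝ)
    φ.continuous_normed hfl x).integrable
  have hi' : Integrable fun t => ρ t • f x := φ.integrable_normed.smul_const _
  have e1 : (ρ ⋆[ContinuousLinearMap.lsmul ℝ ℝ, volume] f) x - f x =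
      ∫ t, ρ t • (f (x - t) - f x) := by
    simp_rw [smul_sub]
    rw [integral_sub hi hi', integral_smul_const, φ.integral_normed, one_smul]
    rfl
  set m : Measure E := volume.withDensity fun t => ENNReal.ofReal (ρ t)
  have hm : m Set.univ = 1 := by
    rw [withDensity_apply _ MeasurableSet.univ, Measure.restrict_univ,
      ← ofReal_integral_eq_lintegral_ofReal φ.integrable_normed (ae_of_all _ hρ0),
      φ.integral_normed, ENNReal.ofReal_one]
  have hgm : Measurable fun t => ‖f (x - t) - f x‖ₑ :=
    ((hf.comp_measurable (by fun_prop : Measurable fun t => x - t)).sub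
      stronglyMeasurable_const).enorm
  have e2 : ‖(ρ ⋆[ContinuousLinearMap.lsmul ℝ ℝ, volume] f) x - f x‖ₑ ≤
      ∫⁻ t, ‖f (x - t) - f x‖ₑ ∂m := by
    rw [e1, lintegral_withDensity_eq_lintegral_mul _ hρm hgm]
    refine (enorm_integral_le_lintegral_enorm _).trans (lintegral_mono fun t => ?_)
    rw [enorm_smul, Real.enorm_eq_ofReal (hρ0 t)]
    rfl
  have e3 := ENNReal.lintegral_mul_le_Lp_mul_Lq m Real.HolderConjugate.two_two
    hgm.aemeasurable (aemeasurable_const (b := (1 : ℝ≥0∞)))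
  simp only [Pi.mul_apply, mul_one, ENNReal.one_rpow, lintegral_const, hm] at e3
  calc _ ≤ ((∫⁻ t, ‖f (x - t) - f x‖ₑ ^ (2 : ℝ) ∂m) ^ (1 / 2 : ℝ)) ^ (2 : ℝ) := by
        gcongr; exact e2.trans e3
    _ = ∫⁻ t, ‖f (x - t) - f x‖ₑ ^ (2 : ℝ) ∂m := by
        rw [← ENNReal.rpow_mul]; simp
    _ = _ := by
        rw [lintegral_withDensity_eq_lintegral_mul _ hρm (hgm.pow_const _)]; rfl

/-- Mollifications converge in `L²`. -/
lemma exists_forall_eLpNorm_convolution_sub_le {f : E → F} (hf : MemLp f 2 (volume : Measure E))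
    {ε : ℝ≥0∞} (hε : ε ≠ 0) :
    ∃ δ > 0, ∀ φ : ContDiffBump (0 : E), φ.rOut ≤ δ →
      eLpNorm (fun x => (φ.normed volume ⋆[ContinuousLinearMap.lsmul ℝ ℝ, volume] f) x - f x) 2
        volume ≤ ε := by
  -- A strongly measurable representative provides the joint measurability in (x, t) that Tonelli
  -- needs.
  wlog hfm : StronglyMeasurable f generalizing f
  · have hae := hf.1.ae_eq_mk
    obtain ⟨δ, hδ, h⟩ := this (hf.ae_eq hae) hf.1.stronglyMeasurable_mk
    refine ⟨δ, hδ, fun φ hφ => ?_⟩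
    rw [convolution_congr _ Filter.EventuallyEq.rfl hae]
    refine le_trans (le_of_eq (eLpNorm_congr_ae ?_)) (h φ hφ)
    filter_upwards [hae] with x hx
    rw [hx]
  obtain ⟨δ, hδ, h⟩ := exists_forall_eLpNorm_translate_sub_le hf hε
  refine ⟨δ, hδ, fun φ hφ => ?_⟩
  have hfl : LocallyIntegrable f := hf.locallyIntegrable (by norm_num)
  set ρ : E → ℝ := φ.normed volume
  have hρ0 : ∀ t, 0 ≤ ρ t := fun t => φ.nonneg_normed t
  have hρm : Measurable fun t => ENNReal.ofReal (ρ t) :=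
    φ.continuous_normed.measurable.ennreal_ofReal
  have hg : Measurable fun p : E × E => ‖f (p.1 - p.2) - f p.1‖ₑ :=
    ((hfm.comp_measurable (by fun_prop : Measurable fun p : E × E => p.1 - p.2)).sub
      (hfm.comp_measurable measurable_fst)).enorm
  rw [← ENNReal.rpow_le_rpow_iff (z := 2) (by norm_num), eLpNorm_two_rpow]
  refine (lintegral_mono fun x => enorm_convolution_sub_rpow_le hfm hfl φ x).trans ?_
  rw [lintegral_lintegral_swap]
  · have hle : ∀ t, ∫⁻ x, ENNReal.ofReal (ρ t) * ‖f (x - t) - f x‖ₑ ^ (2 : ℝ) ≤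
        ENNReal.ofReal (ρ t) * ε ^ (2 : ℝ) := by
      intro t
      by_cases ht : ρ t = 0
      · simp [ht]
      have ht' : t ∈ Metric.ball (0 : E) φ.rOut := by
        rw [← φ.support_normed_eq (μ := volume)]; exact ht
      rw [lintegral_const_mul' _ _ ENNReal.ofReal_ne_top, ← eLpNorm_two_rpow]
      gcongr
      exact h t ((mem_ball_zero_iff.1 ht').trans_le hφ)
    refine (lintegral_mono hle).trans ?_
    rw [lintegral_mul_const _ hρm, ← ofReal_integral_eq_lintegral_ofReal φ.integrable_normed
      (ae_of_all _ hρ0), φ.integral_normed, ENNReal.ofReal_one, one_mul]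
  · exact ((hρm.comp measurable_snd).mul (hg.pow_const _)).aemeasurable

/-- Together with the reverse comparison on balls, this transfers local L² statements between the
Lebesgue and Gaussian measures. -/
lemma stdGaussian_le_smul_volume :
    stdGaussian E ≤ ENNReal.ofReal ((2 * Real.pi) ^ ((Module.finrank ℝ E : ℝ) / 2))⁻¹ • volume := by
  rw [stdGaussian_eq_withDensity, ← withDensity_const]
  exact withDensity_mono (ae_of_all _ fun x => ENNReal.ofReal_le_ofReal (gaussianDensity_le x))

lemma stdGaussian_absolutelyContinuous : stdGaussian E ≪ volume := by
  rw [stdGaussian_eq_withDensity]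
  exact withDensity_absolutelyContinuous _ _

lemma volume_absolutelyContinuous_stdGaussian : (volume : Measure E) ≪ stdGaussian E := by
  rw [stdGaussian_eq_withDensity]
  exact withDensity_absolutelyContinuous'
    (continuous_gaussianDensity.measurable.ennreal_ofReal).aemeasurable
    (ae_of_all _ fun x => (ENNReal.ofReal_pos.2 (gaussianDensity_pos x)).ne')

lemma exists_volume_restrict_ball_le_smul_stdGaussian (R : ℝ) :
    ∃ c : ℝ≥0∞, c ≠ ∞ ∧ (volume : Measure E).restrict (Metric.ball 0 R) ≤ c • stdGaussian E := by
  set m : ℝ := ((2 * Real.pi) ^ ((Module.finrank ℝ E : ℝ) / 2))⁻¹ * Real.exp (-(1 / 2) * R ^ 2)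
  have hm : 0 < m := by positivity
  have hle : ∀ x ∈ Metric.ball (0 : E) R, m ≤ gaussianDensity x := by
    intro x hx
    have hx' := mem_ball_zero_iff.1 hx
    unfold gaussianDensity
    refine mul_le_mul_of_nonneg_left (Real.exp_le_exp.2 ?_) (by positivity)
    nlinarith [norm_nonneg x]
  refine ⟨ENNReal.ofReal m⁻¹, ENNReal.ofReal_ne_top, ?_⟩
  have hgm : Measurable fun x : E => ENNReal.ofReal (gaussianDensity x) :=
    continuous_gaussianDensity.measurable.ennreal_ofReal
  rw [stdGaussian_eq_withDensity, ← withDensity_smul _ hgm, ← withDensity_indicator_one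
    Metric.isOpen_ball.measurableSet]
  refine withDensity_mono (ae_of_all _ fun x => ?_)
  by_cases hx : x ∈ Metric.ball (0 : E) R
  · simp only [Set.indicator_of_mem hx, Pi.one_apply, Pi.smul_apply, smul_eq_mul]
    rw [← ENNReal.ofReal_mul (by positivity), ENNReal.one_le_ofReal]
    rw [← inv_mul_cancel₀ hm.ne']
    exact mul_le_mul_of_nonneg_left (hle x hx) (by positivity)
  · simp [Set.indicator_of_notMem hx]

/-- Mollifications of a function in `L²(γ)`, with `γ` the standard Gaussian measure, converge in
`L²(γ)` on balls. -/
lemma exists_forall_eLpNorm_indicator_convolution_sub_le {f : E → F}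
    (hf : MemLp f 2 (stdGaussian E)) (R : ℝ) {ε : ℝ≥0∞} (hε : ε ≠ 0) :
    ∃ δ > 0, ∀ φ : ContDiffBump (0 : E), φ.rOut ≤ δ →
      eLpNorm ((Metric.ball 0 R).indicator fun x =>
        (φ.normed volume ⋆[ContinuousLinearMap.lsmul ℝ ℝ, volume] f) x - f x) 2
        (stdGaussian E) ≤ ε := by
  -- A function in L²(γ) need not be in L² for Lebesgue measure. Mollification at scale at most 1
  -- sees, from the ball of radius R, only values in the ball of radius R + 1, so f may be truncated
  -- there.
  set B := Metric.ball (0 : E) (R + 1)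
  set f₁ : E → F := B.indicator f
  obtain ⟨c, hc, hcle⟩ := exists_volume_restrict_ball_le_smul_stdGaussian (E := E) (R + 1)
  have hf₁ : MemLp f₁ 2 (volume : Measure E) :=
    (memLp_indicator_iff_restrict Metric.isOpen_ball.measurableSet).2
      (hf.of_measure_le_smul hc hcle)
  set c' : ℝ≥0∞ := ENNReal.ofReal ((2 * Real.pi) ^ ((Module.finrank ℝ E : ℝ) / 2))⁻¹
  have hc'0 : c' ^ (1 / (2 : ℝ)) ≠ 0 := by
    simp only [c', ne_eq, ENNReal.rpow_eq_zero_iff, not_or, not_and_or]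
    exact ⟨Or.inl (ENNReal.ofReal_pos.2 (by positivity)).ne', Or.inl ENNReal.ofReal_ne_top⟩
  have hc't : c' ^ (1 / (2 : ℝ)) ≠ ∞ :=
    ENNReal.rpow_ne_top_of_nonneg (by norm_num) ENNReal.ofReal_ne_top
  obtain ⟨δ, hδ, h⟩ := exists_forall_eLpNorm_convolution_sub_le hf₁
    (ε := ε / c' ^ (1 / (2 : ℝ))) (ENNReal.div_ne_zero.2 ⟨hε, hc't⟩)
  refine ⟨min δ 1, lt_min hδ one_pos, fun φ hφ => ?_⟩
  have hpt : ∀ x ∈ Metric.ball (0 : E) R,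
      (φ.normed volume ⋆[ContinuousLinearMap.lsmul ℝ ℝ, volume] f) x - f x =
      (φ.normed volume ⋆[ContinuousLinearMap.lsmul ℝ ℝ, volume] f₁) x - f₁ x := by
    intro x hx
    have hx' := mem_ball_zero_iff.1 hx
    have hxB : x ∈ B := mem_ball_zero_iff.2 (by linarith)
    rw [show f₁ x = f x from Set.indicator_of_mem hxB f]
    congr 1
    rw [convolution_def, convolution_def]
    congr 1
    ext t
    by_cases ht : φ.normed volume t = 0
    · simp [ht]
    · have ht' : t ∈ Metric.ball (0 : E) φ.rOut := by
        rw [← φ.support_normed_eq (μ := volume)]; exact ht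
      have ht1 := (mem_ball_zero_iff.1 ht').trans_le (hφ.trans (min_le_right _ _))
      rw [show f₁ (x - t) = f (x - t) from Set.indicator_of_mem (mem_ball_zero_iff.2
        ((norm_sub_le _ _).trans_lt (by linarith))) f]
  calc _ ≤ eLpNorm (fun x =>
        (φ.normed volume ⋆[ContinuousLinearMap.lsmul ℝ ℝ, volume] f₁) x - f₁ x) 2
        (stdGaussian E) := by
        refine eLpNorm_mono fun x => ?_
        by_cases hx : x ∈ Metric.ball (0 : E) R
        · rw [Set.indicator_of_mem hx, hpt x hx]
        · rw [Set.indicator_of_notMem hx, norm_zero]; exact norm_nonneg _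
    _ ≤ eLpNorm (fun x =>
        (φ.normed volume ⋆[ContinuousLinearMap.lsmul ℝ ℝ, volume] f₁) x - f₁ x) 2
        (c' • volume) := eLpNorm_mono_measure _ stdGaussian_le_smul_volume
    _ ≤ c' ^ (1 / (2 : ℝ)) * (ε / c' ^ (1 / (2 : ℝ))) := by
        rw [eLpNorm_smul_measure_of_ne_top ENNReal.ofNat_ne_top, smul_eq_mul]
        rw [show (1 / (2 : ℝ≥0∞)).toReal = 1 / (2 : ℝ) by simp]
        gcongr
        exact h φ (hφ.trans (min_le_left _ _))
    _ ≤ ε := ENNReal.mul_div_le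

end MollificationLTwo

/-! ### Tails and smooth cutoffs. -/

section SmoothApproximation

open scoped RealInnerProductSpace Convolution

/-- Complements of large balls have small measure, and the L² norm is absolutely continuous with
respect to the measure of the set. -/
lemma exists_eLpNorm_indicator_compl_ball_le {E F : Type*} [NormedAddCommGroup E]
    [MeasurableSpace E] [BorelSpace E] [NormedAddCommGroup F] {μ : Measure E} [IsFiniteMeasure μ]
    {f : E → F} (hf : MemLp f 2 μ) {ε : ℝ} (hε : 0 < ε) :
    ∃ R, eLpNorm ((Metric.ball (0 : E) R)ᶜ.indicator f) 2 μ ≤ ENNReal.ofReal ε := by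
  obtain ⟨δ, hδ, h⟩ := hf.eLpNorm_indicator_le (by norm_num) (by norm_num) hε
  have hlim : Filter.Tendsto (fun n : ℕ => μ (Metric.ball (0 : E) n)ᶜ) Filter.atTop (nhds 0) := by
    have h0 : ⋂ n : ℕ, (Metric.ball (0 : E) n)ᶜ = ∅ := by
      rw [← Set.compl_iUnion, Metric.iUnion_ball_nat, Set.compl_univ]
    rw [← measure_empty (μ := μ), ← h0]
    refine tendsto_measure_iInter_atTop
      (fun n => Metric.isOpen_ball.measurableSet.compl.nullMeasurableSet) (fun m n hmn => ?_)
      ⟨0, measure_ne_top _ _⟩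
    exact Set.compl_subset_compl.2 (Metric.ball_subset_ball (by exact_mod_cast hmn))
  obtain ⟨n, hn⟩ := (hlim.eventually (gt_mem_nhds (ENNReal.ofReal_pos.2 hδ))).exists
  exact ⟨n, h _ Metric.isOpen_ball.measurableSet.compl hn.le⟩

lemma eLpNorm_indicator_le_add {α F : Type*} [MeasurableSpace α] [NormedAddCommGroup F] {a f : α → F}
    {μ : Measure α} (ha : AEStronglyMeasurable a μ)
    (hf : AEStronglyMeasurable f μ) {s : Set α} (hs : MeasurableSet s) {ε : ℝ≥0∞}
    (h : eLpNorm (s.indicator fun x => a x - f x) 2 μ ≤ ε) :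
    eLpNorm (s.indicator a) 2 μ ≤ eLpNorm f 2 μ + ε := by
  have e : s.indicator a = s.indicator f + s.indicator fun x => a x - f x := by
    ext x
    by_cases hx : x ∈ s <;> simp [hx]
  rw [e]
  refine (eLpNorm_add_le (hf.indicator hs) ((ha.sub hf).indicator hs)
    (by norm_num)).trans ?_
  gcongr
  · exact eLpNorm_indicator_le f
  · exact h

variable {E : Type*} [NormedAddCommGroup E] [InnerProductSpace ℝ E] [FiniteDimensional ℝ E]

/-- Smooth cutoff functions with arbitrarily small first and second derivatives. -/
lemma exists_smooth_cutoff (R₀ : ℝ) {κ : ℝ} (hκ : 0 < κ) :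
    ∃ (χ : E → ℝ) (χ₁ : E → E) (χ₂ : E → E →L[ℝ] E) (R : ℝ),
      (∀ x, HasFDerivAt χ (innerSL ℝ (χ₁ x)) x) ∧ (∀ x, HasFDerivAt χ₁ (χ₂ x) x) ∧
      Continuous χ₂ ∧ (∀ x, 0 ≤ χ x) ∧ (∀ x, χ x ≤ 1) ∧ (∀ x, ‖x‖ < R₀ → χ x = 1) ∧
      (∀ x, ‖χ₁ x‖ ≤ κ) ∧ (∀ x, ‖χ₂ x‖ ≤ κ) ∧
      ∀ x, R ≤ ‖x‖ → χ x = 0 ∧ χ₁ x = 0 ∧ χ₂ x = 0 := by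
  let b : ContDiffBump (0 : E) := ⟨1, 2, one_pos, one_lt_two⟩
  have hb : ContDiff ℝ (⊤ : ℕ∞) b := b.contDiff
  set g : E → E := fun x => (InnerProductSpace.toDual ℝ E).symm (fderiv ℝ b x) with hg
  have hgc : ContDiff ℝ (⊤ : ℕ∞) g :=
    (InnerProductSpace.toDual ℝ E).symm.contDiff.comp (hb.fderiv_right (by simp))
  set D : E → E →L[ℝ] E := fderiv ℝ g
  have hDc : Continuous D := hgc.continuous_fderiv (by simp)
  have hbg : ∀ x, HasFDerivAt b (innerSL ℝ (g x)) x := by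
    intro x
    refine ((hb.differentiable (by simp) x).hasFDerivAt).congr_fderiv ?_
    ext v
    simp [hg]
  have hgD : ∀ x, HasFDerivAt g (D x) x := fun x => (hgc.differentiable (by simp) x).hasFDerivAt
  have hzero : ∀ x : E, 2 < ‖x‖ → b x = 0 ∧ g x = 0 ∧ D x = 0 := by
    have hz : ∀ x : E, 2 < ‖x‖ → b =ᶠ[nhds x] fun _ => 0 := by
      intro x hx
      filter_upwards [(isOpen_lt continuous_const continuous_norm).mem_nhds hx] with y hy
      exact b.zero_of_le_dist (by rw [dist_zero_right]; exact le_of_lt hy)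
    have hz1 : ∀ x : E, 2 < ‖x‖ → g x = 0 := by
      intro x hx
      simp [hg, (hz x hx).fderiv_eq]
    refine fun x hx => ⟨(hz x hx).self_of_nhds, hz1 x hx, ?_⟩
    have h2 : g =ᶠ[nhds x] fun _ => 0 := by
      filter_upwards [(isOpen_lt continuous_const continuous_norm).mem_nhds hx] with y hy
      exact hz1 y hy
    simp only [D, h2.fderiv_eq, fderiv_fun_const, Pi.zero_apply]
  have hgs : HasCompactSupport g :=
    HasCompactSupport.intro (isCompact_closedBall (0 : E) 2) fun x hx =>
      (hzero x (by simpa using hx)).2.1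
  have hDs : HasCompactSupport D :=
    HasCompactSupport.intro (isCompact_closedBall (0 : E) 2) fun x hx =>
      (hzero x (by simpa using hx)).2.2
  obtain ⟨C₁, hC₁⟩ := hgs.exists_bound_of_continuous hgc.continuous
  obtain ⟨C₂, hC₂⟩ := hDs.exists_bound_of_continuous hDc
  -- A fixed bump is dilated by s: its derivatives scale by s⁻¹ and s⁻², and s ≥ 1 lets one
  -- condition on κ s serve for both. The vanishing radius 3s puts s⁻¹x strictly outside the closed
  -- ball of radius 2.
  set s : ℝ := max (max R₀ 1) (max (C₁ / κ) (C₂ / κ))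
  have hs1 : 1 ≤ s := (le_max_right _ _).trans (le_max_left _ _)
  have hsR : R₀ ≤ s := (le_max_left _ _).trans (le_max_left _ _)
  have hsC₁ : C₁ ≤ κ * s :=
    (div_le_iff₀' hκ).1 ((le_max_left _ _).trans (le_max_right _ _))
  have hsC₂ : C₂ ≤ κ * s :=
    (div_le_iff₀' hκ).1 ((le_max_right _ _).trans (le_max_right _ _))
  have hs0 : 0 < s := one_pos.trans_le hs1
  have hsc : ∀ x, HasFDerivAt (fun x : E => s⁻¹ • x) (s⁻¹ • ContinuousLinearMap.id ℝ E) x :=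
    fun x => (hasFDerivAt_id x).const_smul s⁻¹
  have hns : ∀ x : E, ‖s⁻¹ • x‖ = s⁻¹ * ‖x‖ := fun x => by
    rw [norm_smul, norm_inv, Real.norm_of_nonneg hs0.le]
  refine ⟨fun x => b (s⁻¹ • x), fun x => s⁻¹ • g (s⁻¹ • x), fun x => s⁻¹ • s⁻¹ • D (s⁻¹ • x),
    3 * s, fun x => ?_, fun x => ?_, ?_, fun x => b.nonneg, fun x => b.le_one, fun x hx => ?_,
    fun x => ?_, fun x => ?_, fun x hx => ?_⟩
  · refine ((hbg _).comp x (hsc x)).congr_fderiv ?_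
    ext v
    simp
  · refine (((hgD _).comp x (hsc x)).const_smul s⁻¹).congr_fderiv ?_
    ext v
    simp
  · fun_prop
  · refine b.one_of_mem_closedBall ?_
    rw [mem_closedBall_zero_iff, hns, inv_mul_le_iff₀ hs0]
    change ‖x‖ ≤ s * 1
    linarith
  · rw [hns, inv_mul_le_iff₀ hs0]
    linarith [hC₁ (s⁻¹ • x)]
  · rw [norm_smul, norm_smul, norm_inv, Real.norm_of_nonneg hs0.le, inv_mul_le_iff₀ hs0,
      inv_mul_le_iff₀ hs0]
    have := hC₂ (s⁻¹ • x)
    nlinarith [mul_pos hκ hs0]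
  · have h2 : 2 < ‖s⁻¹ • x‖ := by
      rw [hns, lt_inv_mul_iff₀ hs0]
      linarith
    obtain ⟨h3, h4, h5⟩ := hzero _ h2
    simp [h3, h4, h5]

end SmoothApproximation

/-! ### Smooth approximation of twice weakly differentiable functions in L²(γ). -/

section SobolevApproximation

open scoped RealInnerProductSpace Convolution

variable {d : ℕ}

/-- The gradient of the mollification is the mollification of the weak gradient. -/
lemma HasWeakGradient.hasFDerivAt_convolution {u : EuclideanSpace ℝ (Fin d) → ℝ}
    {G : EuclideanSpace ℝ (Fin d) → EuclideanSpace ℝ (Fin d)} (hu : HasWeakGradient u G)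
    (hG : LocallyIntegrable G) {ρ : EuclideanSpace ℝ (Fin d) → ℝ} (hρ : ContDiff ℝ (⊤ : ℕ∞) ρ)
    (hρs : HasCompactSupport ρ) (x : EuclideanSpace ℝ (Fin d)) :
    HasFDerivAt (ρ ⋆[ContinuousLinearMap.lsmul ℝ ℝ, volume] u)
      (innerSL ℝ ((ρ ⋆[ContinuousLinearMap.lsmul ℝ ℝ, volume] G) x)) x := by
  refine (HasWeakFDeriv.hasFDerivAt_convolution hu hρ hρs x).congr_fderiv ?_
  ext v
  have i1 := (hρs.convolutionExists_left (ContinuousLinearMap.lsmul ℝ ℝ) hρ.continuous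
    (HasWeakFDeriv.locallyIntegrable_deriv hu) x).integrable
  have i2 := (hρs.convolutionExists_left (ContinuousLinearMap.lsmul ℝ ℝ) hρ.continuous
    hG x).integrable
  rw [convolution_def, convolution_def, ContinuousLinearMap.integral_apply i1, innerSL_apply_apply,
    real_inner_comm, ← integral_inner i2]
  refine integral_congr_ae (ae_of_all _ fun t => ?_)
  simp [real_inner_smul_right, real_inner_comm]

lemma Continuous.exists_forall_norm_le_of_eq_zero {E F : Type*} [NormedAddCommGroup E]
    [ProperSpace E] [NormedAddCommGroup F] {f : E → F} (hf : Continuous f) {R : ℝ}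
    (h : ∀ x, R ≤ ‖x‖ → f x = 0) : ∃ C, ∀ x, ‖f x‖ ≤ C :=
  (HasCompactSupport.intro (isCompact_closedBall (0 : E) R) fun x hx =>
    h x (by simpa using (not_le.1 (fun h' => hx (mem_closedBall_zero_iff.2 h'))).le)
    ).exists_bound_of_continuous hf

/-- A twice weakly differentiable function with derivatives in `L²(γ)` is approximated by smooth
functions with bounded derivatives. -/
lemma HasWeakGradientHessian.exists_smooth_approx {u : EuclideanSpace ℝ (Fin d) → ℝ}
    {G : EuclideanSpace ℝ (Fin d) → EuclideanSpace ℝ (Fin d)}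
    {H : EuclideanSpace ℝ (Fin d) → EuclideanSpace ℝ (Fin d) →L[ℝ] EuclideanSpace ℝ (Fin d)}
    (hu : HasWeakGradientHessian u G H) (hu2 : MemLp u 2 (stdGaussian (EuclideanSpace ℝ (Fin d))))
    (hG2 : MemLp G 2 (stdGaussian (EuclideanSpace ℝ (Fin d))))
    (hH2 : MemLp H 2 (stdGaussian (EuclideanSpace ℝ (Fin d)))) {η : ℝ} (hη : 0 < η) :
    ∃ (u' : EuclideanSpace ℝ (Fin d) → ℝ)
      (G' : EuclideanSpace ℝ (Fin d) → EuclideanSpace ℝ (Fin d))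
      (H' : EuclideanSpace ℝ (Fin d) → EuclideanSpace ℝ (Fin d) →L[ℝ] EuclideanSpace ℝ (Fin d))
      (C : ℝ), (∀ x, HasFDerivAt u' (innerSL ℝ (G' x)) x) ∧ (∀ x, HasFDerivAt G' (H' x) x) ∧
      Continuous H' ∧ (∀ x, ‖u' x‖ ≤ C) ∧ (∀ x, ‖G' x‖ ≤ C) ∧ (∀ x, ‖H' x‖ ≤ C) ∧
      eLpNorm (fun x => u' x - u x) 2 (stdGaussian (EuclideanSpace ℝ (Fin d))) ≤
        ENNReal.ofReal η ∧
      eLpNorm G' 2 (stdGaussian (EuclideanSpace ℝ (Fin d))) ≤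
        eLpNorm G 2 (stdGaussian (EuclideanSpace ℝ (Fin d))) + ENNReal.ofReal η ∧
      eLpNorm H' 2 (stdGaussian (EuclideanSpace ℝ (Fin d))) ≤
        eLpNorm H 2 (stdGaussian (EuclideanSpace ℝ (Fin d))) + ENNReal.ofReal η := by
  set γ := stdGaussian (EuclideanSpace ℝ (Fin d))
  obtain ⟨R₀, hR₀⟩ := exists_eLpNorm_indicator_compl_ball_le hu2 (half_pos hη)
  set ε : ℝ≥0∞ := min (ENNReal.ofReal (η / 2)) 1
  have hε : ε ≠ 0 := (lt_min (ENNReal.ofReal_pos.2 (half_pos hη)) one_pos).ne'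
  have hε1 : ε ≤ 1 := min_le_right _ _
  have hεη : ε ≤ ENNReal.ofReal (η / 2) := min_le_left _ _
  -- The parameters are chosen in the order κ, R, δ: the cutoff radius R depends on κ and the
  -- mollification scale δ on R. The bounds with + 1 allow for a mollification error ε ≤ 1, so they
  -- can fix κ before R is known.
  obtain ⟨κ, hκ0, hκ⟩ := ENNReal.exists_nnreal_pos_mul_lt
    (a := (eLpNorm u 2 γ + 1) + ((eLpNorm G 2 γ + 1) + (eLpNorm G 2 γ + 1)))
    (b := ENNReal.ofReal (η / 2))
    (by simp [hu2.2.ne, hG2.2.ne]) (ENNReal.ofReal_pos.2 (half_pos hη)).ne'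
  obtain ⟨χ, χ₁, χ₂, R, hχ, hχ₁, hχ₂c, h0, h1, hone, hb1, hb2, hz⟩ :=
    exists_smooth_cutoff (E := EuclideanSpace ℝ (Fin d)) R₀ (κ := κ) (by exact_mod_cast hκ0)
  obtain ⟨δ₁, hδ₁, a₁⟩ := exists_forall_eLpNorm_indicator_convolution_sub_le hu2 R hε
  obtain ⟨δ₂, hδ₂, a₂⟩ := exists_forall_eLpNorm_indicator_convolution_sub_le hG2 R hε
  obtain ⟨δ₃, hδ₃, a₃⟩ := exists_forall_eLpNorm_indicator_convolution_sub_le hH2 R hε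
  set δ := min δ₁ (min δ₂ δ₃)
  have hδ : 0 < δ := lt_min hδ₁ (lt_min hδ₂ hδ₃)
  let φ : ContDiffBump (0 : EuclideanSpace ℝ (Fin d)) := ⟨δ / 2, δ, half_pos hδ, by linarith⟩
  have b₁ := a₁ φ (min_le_left _ _)
  have b₂ := a₂ φ ((min_le_right _ _).trans (min_le_left _ _))
  have b₃ := a₃ φ ((min_le_right _ _).trans (min_le_right _ _))
  clear a₁ a₂ a₃
  have hρ : ContDiff ℝ (⊤ : ℕ∞) (φ.normed volume) := φ.contDiff_normed
  have hρs : HasCompactSupport (φ.normed volume) := φ.hasCompactSupport_normed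
  have da := hu.1.hasFDerivAt_convolution hu.2.locallyIntegrable hρ hρs
  have db := hu.2.hasFDerivAt_convolution hρ hρs
  have cc : Continuous (φ.normed volume ⋆[ContinuousLinearMap.lsmul ℝ ℝ, volume] H) :=
    hρs.continuous_convolution_left _ hρ.continuous hu.2.locallyIntegrable_deriv
  generalize (φ.normed volume ⋆[ContinuousLinearMap.lsmul ℝ ℝ, volume] u) = a at *
  generalize (φ.normed volume ⋆[ContinuousLinearMap.lsmul ℝ ℝ, volume] G) = b at *
  generalize (φ.normed volume ⋆[ContinuousLinearMap.lsmul ℝ ℝ, volume] H) = c at *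
  have ca : Continuous a := continuous_iff_continuousAt.2 fun x => (da x).continuousAt
  have cb : Continuous b := continuous_iff_continuousAt.2 fun x => (db x).continuousAt
  have cχ : Continuous χ := continuous_iff_continuousAt.2 fun x => (hχ x).continuousAt
  have cχ₁ : Continuous χ₁ := continuous_iff_continuousAt.2 fun x => (hχ₁ x).continuousAt
  have hB : MeasurableSet (Metric.ball (0 : EuclideanSpace ℝ (Fin d)) R) :=
    Metric.isOpen_ball.measurableSet
  have hB0 : MeasurableSet (Metric.ball (0 : EuclideanSpace ℝ (Fin d)) R₀) :=
    Metric.isOpen_ball.measurableSet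
  have e₁ := (eLpNorm_indicator_le_add ca.aestronglyMeasurable hu2.1 hB b₁).trans
    (add_le_add_right hε1 _)
  have e₂ := eLpNorm_indicator_le_add cb.aestronglyMeasurable hG2.1 hB b₂
  have e₂' := e₂.trans (add_le_add_right hε1 _)
  have e₃ := eLpNorm_indicator_le_add cc.aestronglyMeasurable hH2.1 hB b₃
  set B := Metric.ball (0 : EuclideanSpace ℝ (Fin d)) R
  have hout : ∀ x, x ∉ B → χ x = 0 ∧ χ₁ x = 0 ∧ χ₂ x = 0 := fun x hx =>
    hz x (not_lt.1 fun h => hx (mem_ball_zero_iff.2 h))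
  have ma := ca.aestronglyMeasurable (μ := γ) |>.indicator hB
  have mb := cb.aestronglyMeasurable (μ := γ) |>.indicator hB
  have mc := cc.aestronglyMeasurable (μ := γ) |>.indicator hB
  have hκη : ∀ t, t ≤ (eLpNorm u 2 γ + 1) + ((eLpNorm G 2 γ + 1) + (eLpNorm G 2 γ + 1)) →
      ∀ w, w + ε + κ * t ≤ w + ENNReal.ofReal η := by
    intro t ht w
    rw [add_assoc, ← add_halves η, ENNReal.ofReal_add (half_pos hη).le (half_pos hη).le]
    gcongr
    exact (mul_le_mul_right ht _).trans hκ.le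
  have hκe : ‖(κ : ℝ)‖ₑ = κ := by simp
  -- Gradient and Hessian of χ · a by the product rule. Every term with a derivative of χ is of size
  -- κ times a or b.
  set G' : EuclideanSpace ℝ (Fin d) → EuclideanSpace ℝ (Fin d) := fun x => χ x • b x + a x • χ₁ x
    with hG'
  set H' : EuclideanSpace ℝ (Fin d) → EuclideanSpace ℝ (Fin d) →L[ℝ] EuclideanSpace ℝ (Fin d) :=
    fun x => χ x • c x + (innerSL ℝ (χ₁ x)).smulRight (b x) +
      (a x • χ₂ x + (innerSL ℝ (b x)).smulRight (χ₁ x)) with hH'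
  have cu' : Continuous fun x => χ x * a x := by fun_prop
  have cG' : Continuous G' := by fun_prop
  have hsm : ∀ {f g : EuclideanSpace ℝ (Fin d) → EuclideanSpace ℝ (Fin d)}, Continuous f →
      Continuous g → Continuous fun x => (innerSL ℝ (f x)).smulRight (g x) := fun hf hg =>
    ((ContinuousLinearMap.smulRightL ℝ _ _).continuous.comp
      ((innerSL ℝ).continuous.comp hf)).clm_apply hg
  have cH' : Continuous H' :=
    ((cχ.smul cc).add (hsm cχ₁ cb)).add ((ca.smul hχ₂c).add (hsm cb cχ₁))
  have hH0 : ∀ x, χ x = 0 ∧ χ₁ x = 0 ∧ χ₂ x = 0 → H' x = 0 := by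
    rintro x ⟨h, h', h''⟩
    ext v
    simp [hH', h, h', h'']
  obtain ⟨C₁, hC₁⟩ := cu'.exists_forall_norm_le_of_eq_zero (R := R) fun x hx => by
    simp [(hz x hx).1]
  obtain ⟨C₂, hC₂⟩ := cG'.exists_forall_norm_le_of_eq_zero (R := R) fun x hx => by
    simp [hG', (hz x hx).1, (hz x hx).2.1]
  obtain ⟨C₃, hC₃⟩ := cH'.exists_forall_norm_le_of_eq_zero (R := R) fun x hx =>
    hH0 x (hz x hx)
  refine ⟨fun x => χ x * a x, G', H', max C₁ (max C₂ C₃), fun x => ?_, fun x => ?_, cH',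
    fun x => (hC₁ x).trans (le_max_left _ _),
    fun x => (hC₂ x).trans ((le_max_left _ _).trans (le_max_right _ _)),
    fun x => (hC₃ x).trans ((le_max_right _ _).trans (le_max_right _ _)), ?_, ?_, ?_⟩
  · refine ((hχ x).mul (da x)).congr_fderiv ?_
    ext v
    simp [hG']
  · refine (((hχ x).smul (db x)).add ((da x).smul (hχ₁ x))).congr_fderiv ?_
    ext v
    simp [hH']
  · calc eLpNorm (fun x => χ x * a x - u x) 2 γ
        ≤ eLpNorm ((fun x => ‖B.indicator (fun x => a x - u x) x‖) +
          fun x => ‖(Metric.ball (0 : EuclideanSpace ℝ (Fin d)) R₀)ᶜ.indicator u x‖) 2 γ := by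
          refine eLpNorm_mono_real fun x => ?_
          -- The first term is the mollification error inside the ball of radius R, the second the
          -- tail of u outside the ball of radius R₀.
          have e : χ x * a x - u x = χ x * (a x - u x) + (χ x - 1) * u x := by ring
          rw [e]
          refine (norm_add_le _ _).trans (add_le_add ?_ ?_)
          · by_cases hx : x ∈ B
            · simp only [Set.indicator_of_mem hx]
              rw [norm_mul, Real.norm_of_nonneg (h0 x)]
              exact mul_le_of_le_one_left (norm_nonneg _) (h1 x)
            · simp [(hout x hx).1]
          · by_cases hx : ‖x‖ < R₀
            · simp [hone x hx]
            · have hx' : x ∈ (Metric.ball (0 : EuclideanSpace ℝ (Fin d)) R₀)ᶜ := fun h =>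
                hx (mem_ball_zero_iff.1 h)
              simp only [Set.indicator_of_mem hx']
              rw [norm_mul]
              refine mul_le_of_le_one_left (norm_nonneg _) (abs_le.2 ⟨?_, ?_⟩)
              · linarith [h0 x]
              · linarith [h1 x]
      _ ≤ ε + ENNReal.ofReal (η / 2) := by
          refine (eLpNorm_add_le ?_ ?_ (by norm_num)).trans ?_
          · exact ((ca.aestronglyMeasurable.sub hu2.1).indicator hB).norm
          · exact (hu2.1.indicator hB0.compl).norm
          · rw [eLpNorm_norm, eLpNorm_norm]
            exact add_le_add b₁ hR₀
      _ ≤ ENNReal.ofReal η := by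
          conv_rhs => rw [← add_halves η, ENNReal.ofReal_add (half_pos hη).le (half_pos hη).le]
          gcongr
  · calc eLpNorm G' 2 γ
        ≤ eLpNorm ((fun x => ‖B.indicator b x‖) + (κ : ℝ) • fun x => ‖B.indicator a x‖) 2 γ := by
          refine eLpNorm_mono_real fun x => ?_
          by_cases hx : x ∈ B
          · simp only [hG', Pi.add_apply, Pi.smul_apply, Set.indicator_of_mem hx, smul_eq_mul]
            refine (norm_add_le _ _).trans (add_le_add ?_ ?_)
            · rw [norm_smul, Real.norm_of_nonneg (h0 x)]
              exact mul_le_of_le_one_left (norm_nonneg _) (h1 x)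
            · rw [norm_smul, mul_comm]
              exact mul_le_mul_of_nonneg_right (hb1 x) (norm_nonneg _)
          · simp [hG', hx, hout x hx]
      _ ≤ (eLpNorm G 2 γ + ε) + κ * (eLpNorm u 2 γ + 1) := by
          refine (eLpNorm_add_le mb.norm (ma.norm.const_smul _) (by norm_num)).trans ?_
          rw [eLpNorm_const_smul, eLpNorm_norm, eLpNorm_norm, hκe]
          gcongr
      _ ≤ _ := hκη _ le_self_add _
  · calc eLpNorm H' 2 γ
        ≤ eLpNorm ((fun x => ‖B.indicator c x‖) + (κ : ℝ) • ((fun x => ‖B.indicator a x‖) +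
          ((fun x => ‖B.indicator b x‖) + fun x => ‖B.indicator b x‖))) 2 γ := by
          refine eLpNorm_mono_real fun x => ?_
          by_cases hx : x ∈ B
          · simp only [hH', Pi.add_apply, Pi.smul_apply, Set.indicator_of_mem hx, smul_eq_mul]
            have t1 : ‖χ x • c x‖ ≤ ‖c x‖ := by
              rw [norm_smul, Real.norm_of_nonneg (h0 x)]
              exact mul_le_of_le_one_left (norm_nonneg _) (h1 x)
            have t2 : ‖(innerSL ℝ (χ₁ x)).smulRight (b x)‖ ≤ κ * ‖b x‖ := by
              rw [ContinuousLinearMap.norm_smulRight_apply, innerSL_apply_norm]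
              exact mul_le_mul_of_nonneg_right (hb1 x) (norm_nonneg _)
            have t3 : ‖a x • χ₂ x‖ ≤ κ * ‖a x‖ := by
              rw [norm_smul, mul_comm]
              exact mul_le_mul_of_nonneg_right (hb2 x) (norm_nonneg _)
            have t4 : ‖(innerSL ℝ (b x)).smulRight (χ₁ x)‖ ≤ κ * ‖b x‖ := by
              rw [ContinuousLinearMap.norm_smulRight_apply, innerSL_apply_norm, mul_comm]
              exact mul_le_mul_of_nonneg_right (hb1 x) (norm_nonneg _)
            linarith [norm_add_le (χ x • c x) ((innerSL ℝ (χ₁ x)).smulRight (b x)),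
              norm_add_le (a x • χ₂ x) ((innerSL ℝ (b x)).smulRight (χ₁ x)),
              norm_add_le (χ x • c x + (innerSL ℝ (χ₁ x)).smulRight (b x))
                (a x • χ₂ x + (innerSL ℝ (b x)).smulRight (χ₁ x))]
          · simp [hH0 x (hout x hx), hx]
      _ ≤ (eLpNorm H 2 γ + ε) + κ * ((eLpNorm u 2 γ + 1) +
          ((eLpNorm G 2 γ + 1) + (eLpNorm G 2 γ + 1))) := by
          refine (eLpNorm_add_le mc.norm ((ma.norm.add (mb.norm.add mb.norm)).const_smul _)
            (by norm_num)).trans ?_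
          rw [eLpNorm_const_smul, eLpNorm_norm, hκe]
          gcongr
          refine (eLpNorm_add_le ma.norm (mb.norm.add mb.norm) (by norm_num)).trans
            (add_le_add ?_ ((eLpNorm_add_le mb.norm mb.norm (by norm_num)).trans ?_))
          · rwa [eLpNorm_norm]
          · rw [eLpNorm_norm]
            exact add_le_add e₂' e₂'
      _ ≤ _ := hκη _ le_rfl _

end SobolevApproximation

/-! ### Elementary L² inequalities. -/

section LTwo

variable {α F : Type*} [MeasurableSpace α] [NormedAddCommGroup F] {μ : Measure α}

lemma sqrt_integral_norm_sq {f : α → F} (hf : MemLp f 2 μ) :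
    Real.sqrt (∫ x, ‖f x‖ ^ 2 ∂μ) = lpNorm f 2 μ := by
  rw [lpNorm_eq_integral_norm_rpow_toReal two_ne_zero ENNReal.ofNat_ne_top hf.1, Real.sqrt_eq_rpow]
  simp

lemma lpNorm_two_le_of_eLpNorm_le {f : α → F} (hf : AEStronglyMeasurable f μ) {C : ℝ}
    (hC : 0 ≤ C) (h : eLpNorm f 2 μ ≤ ENNReal.ofReal C) : lpNorm f 2 μ ≤ C := by
  rw [← toReal_eLpNorm hf]
  exact ENNReal.toReal_le_of_le_ofReal hC h

lemma abs_integral_mul_le_lpNorm {f g : α → ℝ} (hf : MemLp f 2 μ) (hg : MemLp g 2 μ) :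
    |∫ x, f x * g x ∂μ| ≤ lpNorm f 2 μ * lpNorm g 2 μ := by
  rw [← sqrt_integral_norm_sq hf, ← sqrt_integral_norm_sq hg]
  have h := integral_mul_norm_le_Lp_mul_Lq (μ := μ) (f := f) (g := g) Real.HolderConjugate.two_two
    (by simpa using hf) (by simpa using hg)
  refine (norm_integral_le_integral_norm (fun x => f x * g x)).trans ?_
  simp only [norm_mul]
  simpa [Real.sqrt_eq_rpow] using h

lemma integral_norm_le_lpNorm_two [IsProbabilityMeasure μ] {f : α → F} (hf : MemLp f 2 μ) :
    ∫ x, ‖f x‖ ∂μ ≤ lpNorm f 2 μ := by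
  have h := abs_integral_mul_le_lpNorm hf.norm (memLp_const (μ := μ) (p := 2) (1 : ℝ))
  simp only [mul_one] at h
  refine (le_abs_self _).trans (h.trans ?_)
  rw [lpNorm_const (by norm_num) (NeZero.ne μ), ← lpNorm_norm hf.1]
  simp

end LTwo

/-! ### Passage from smooth to weakly differentiable functions. -/

section SobolevBound

variable {d r : ℕ}

lemma abs_integral_comp_sub_integral_comp_le {E Ω : Type*} [NormedAddCommGroup E]
    [InnerProductSpace ℝ E] [MeasurableSpace Ω] {μ : Measure Ω} [IsProbabilityMeasure μ]
    {h : E → ℝ} {k : E → E}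
    (hh : ∀ w, HasFDerivAt h (innerSL ℝ (k w)) w) (hk1 : ∀ w, ‖k w‖ ≤ 1) {f g : Ω → E}
    (hf : Integrable f μ) (hg : Integrable g μ) :
    |∫ x, h (f x) ∂μ - ∫ x, h (g x) ∂μ| ≤ ∫ x, ‖f x - g x‖ ∂μ := by
  have hl : ∀ v w, ‖h v - h w‖ ≤ ‖v - w‖ := by
    intro v w
    have h1 := convex_univ.norm_image_sub_le_of_norm_hasFDerivWithin_le (f := h) (C := 1)
      (fun x _ => (hh x).hasFDerivWithinAt) (fun x _ => by rw [innerSL_apply_norm]; exact hk1 x)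
      (Set.mem_univ w) (Set.mem_univ v)
    rwa [one_mul] at h1
  have hc : Continuous h := continuous_iff_continuousAt.2 fun x => (hh x).continuousAt
  have hi : ∀ {q : Ω → E}, Integrable q μ → Integrable (fun x => h (q x)) μ := by
    intro q hq
    refine ((integrable_const ‖h 0‖).add hq.norm).mono' (hc.comp_aestronglyMeasurable hq.1)
      (ae_of_all _ fun x => ?_)
    have h1 := hl (q x) 0
    rw [sub_zero] at h1
    simp only [Pi.add_apply]
    linarith [norm_le_norm_add_norm_sub (h 0) (h (q x)), norm_sub_rev (h (q x)) (h 0)]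
  rw [← integral_sub (hi hf) (hi hg)]
  exact (norm_integral_le_integral_norm _).trans
    (integral_mono_of_nonneg (ae_of_all _ fun x => norm_nonneg _) (hf.sub hg).norm
      (ae_of_all _ fun x => hl _ _))

lemma EuclideanSpace.norm_le_sum (x : EuclideanSpace ℝ (Fin r)) : ‖x‖ ≤ ∑ i, ‖x i‖ := by
  have h : x = ∑ i, EuclideanSpace.single i (x i) := by
    ext j
    simp [Finset.sum_apply, Pi.single_apply]
  calc ‖x‖ = ‖∑ i, EuclideanSpace.single i (x i)‖ := by rw [← h]
    _ ≤ ∑ i, ‖EuclideanSpace.single i (x i)‖ := norm_sum_le _ _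
    _ = ∑ i, ‖x i‖ := by simp

/-- The second order Gaussian Poincaré inequality in terms of `L²` norms, tested against a smooth
`1`-Lipschitz function. -/
lemma abs_integral_comp_sub_integral_stdGaussian_le_of_weakDeriv
    {p : EuclideanSpace ℝ (Fin d) → EuclideanSpace ℝ (Fin r)}
    {G : Fin r → EuclideanSpace ℝ (Fin d) → EuclideanSpace ℝ (Fin d)}
    {H : Fin r → EuclideanSpace ℝ (Fin d) →
      EuclideanSpace ℝ (Fin d) →L[ℝ] EuclideanSpace ℝ (Fin d)}
    (hp : ∀ i, HasWeakGradientHessian (fun x => p x i) (G i) (H i))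
    (hp2 : MemLp p 2 (stdGaussian (EuclideanSpace ℝ (Fin d))))
    (hG2 : ∀ i, MemLp (G i) 2 (stdGaussian (EuclideanSpace ℝ (Fin d))))
    (hH2 : ∀ i, MemLp (H i) 2 (stdGaussian (EuclideanSpace ℝ (Fin d))))
    (hmean : ∀ i, ∫ x, p x i ∂(stdGaussian (EuclideanSpace ℝ (Fin d))) = 0)
    (hcov : ∀ i j, ∫ x, p x i * p x j ∂(stdGaussian (EuclideanSpace ℝ (Fin d))) =
      if i = j then 1 else 0)
    {h : EuclideanSpace ℝ (Fin r) → ℝ} {k : EuclideanSpace ℝ (Fin r) → EuclideanSpace ℝ (Fin r)}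
    {K : EuclideanSpace ℝ (Fin r) → EuclideanSpace ℝ (Fin r) →L[ℝ] EuclideanSpace ℝ (Fin r)}
    (hh : ∀ w, HasFDerivAt h (innerSL ℝ (k w)) w) (hk : ∀ w, HasFDerivAt k (K w) w)
    (hKc : Continuous K) (hk1 : ∀ w, ‖k w‖ ≤ 1) {C' : ℝ} (hKC : ∀ w, ‖K w‖ ≤ C') :
    |∫ x, h (p x) ∂(stdGaussian (EuclideanSpace ℝ (Fin d))) -
        ∫ n, h n ∂(stdGaussian (EuclideanSpace ℝ (Fin r)))| ≤
      Real.sqrt (2 / Real.pi) * (3 * Real.pi / 4 *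
        ((∑ i, lpNorm (G i) 2 (stdGaussian (EuclideanSpace ℝ (Fin d)))) *
          ∑ j, lpNorm (H j) 2 (stdGaussian (EuclideanSpace ℝ (Fin d))))) := by
  set γ := stdGaussian (EuclideanSpace ℝ (Fin d))
  have hpi : ∀ i, MemLp (fun x => p x i) 2 γ := fun i => hp2.eval_piLp i
  have hn : ∀ i, lpNorm (fun x => p x i) 2 γ = 1 := by
    intro i
    rw [← sqrt_integral_norm_sq (hpi i), Real.sqrt_eq_one]
    have := hcov i i
    simpa [← sq] using this
  have hmul : ∀ {f g : EuclideanSpace ℝ (Fin d) → ℝ}, MemLp f 2 γ → MemLp g 2 γ →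
      Integrable (fun x => f x * g x) γ := fun hf hg => hf.integrable_mul hg
  -- The smooth bound for an η-approximation of p: the double sum is the covariance error, the last
  -- sum the cost of replacing h(F) by h(p).
  have key : ∀ η : ℝ, 0 < η →
      |∫ x, h (p x) ∂γ - ∫ n, h n ∂(stdGaussian (EuclideanSpace ℝ (Fin r)))| ≤
      Real.sqrt (2 / Real.pi) * (3 * Real.pi / 4 *
        ((∑ i, (lpNorm (G i) 2 γ + η)) * ∑ j, (lpNorm (H j) 2 γ + η)) +
          ∑ i : Fin r, ∑ j : Fin r, (2 * η * (1 + 2 * η) + 2 * η)) + ∑ i : Fin r, 2 * η := by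
    intro η hη
    choose u U V C hU hV hVc hu1 hU1 hV1 hue hUe hVe using
      fun i => (hp i).exists_smooth_approx (hpi i) (hG2 i) (hH2 i) hη
    have hCle : ∀ i, C i ≤ ∑ i, |C i| := fun i => (le_abs_self _).trans
      (Finset.single_le_sum (fun i _ => abs_nonneg (C i)) (Finset.mem_univ i))
    have hucont : ∀ i, Continuous (u i) := fun i =>
      continuous_iff_continuousAt.2 fun x => (hU i x).continuousAt
    have hUcont : ∀ i, Continuous (U i) := fun i =>
      continuous_iff_continuousAt.2 fun x => (hV i x).continuousAt
    have hu2 : ∀ i, MemLp (u i) 2 γ := fun i =>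
      MemLp.of_bound (hucont i).aestronglyMeasurable (C i) (ae_of_all _ (hu1 i))
    have hU2 : ∀ i, MemLp (U i) 2 γ := fun i =>
      MemLp.of_bound (hUcont i).aestronglyMeasurable (C i) (ae_of_all _ (hU1 i))
    have hV2 : ∀ i, MemLp (V i) 2 γ := fun i =>
      MemLp.of_bound (hVc i).aestronglyMeasurable (C i) (ae_of_all _ (hV1 i))
    have hdi : ∀ i, MemLp (fun x => u i x - p x i) 2 γ := fun i => (hu2 i).sub (hpi i)
    have hun : ∀ i, lpNorm (fun x => u i x - p x i) 2 γ ≤ η := fun i =>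
      lpNorm_two_le_of_eLpNorm_le (hdi i).1 hη.le (hue i)
    have hUn : ∀ i, lpNorm (U i) 2 γ ≤ lpNorm (G i) 2 γ + η := fun i => by
      refine lpNorm_two_le_of_eLpNorm_le (hU2 i).1 (add_nonneg lpNorm_nonneg hη.le) ?_
      rw [ENNReal.ofReal_add lpNorm_nonneg hη.le, ofReal_lpNorm (hG2 i)]
      exact hUe i
    have hVn : ∀ i, lpNorm (V i) 2 γ ≤ lpNorm (H i) 2 γ + η := fun i => by
      refine lpNorm_two_le_of_eLpNorm_le (hV2 i).1 (add_nonneg lpNorm_nonneg hη.le) ?_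
      rw [ENNReal.ofReal_add lpNorm_nonneg hη.le, ofReal_lpNorm (hH2 i)]
      exact hVe i
    -- The smooth estimate requires exact centring but tolerates a covariance error, so the
    -- approximants are recentred and not renormalised.
    set m : Fin r → ℝ := fun i => ∫ x, u i x ∂γ
    have hm : ∀ i, |m i| ≤ η := by
      intro i
      have e : m i = ∫ x, (u i x - p x i) ∂γ := by
        rw [integral_sub ((hu2 i).integrable one_le_two) ((hpi i).integrable one_le_two),
          hmean, sub_zero]
      rw [e]
      exact ((norm_integral_le_integral_norm _).trans
        (integral_norm_le_lpNorm_two (hdi i))).trans (hun i)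
    set F : EuclideanSpace ℝ (Fin d) → EuclideanSpace ℝ (Fin r) :=
      fun x => WithLp.toLp 2 fun i => u i x - m i
    have hFi : ∀ i x, F x i = u i x - m i := fun i x => rfl
    have hF2 : ∀ i, MemLp (fun x => F x i) 2 γ := fun i => (hu2 i).sub (memLp_const _)
    have hF2' : MemLp F 2 γ := memLp_piLp_iff.2 hF2
    have hFd : ∀ i, MemLp (fun x => F x i - p x i) 2 γ := fun i => (hF2 i).sub (hpi i)
    have hFp : ∀ i, lpNorm (fun x => F x i - p x i) 2 γ ≤ 2 * η := by
      intro i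
      have e : (fun x => F x i - p x i) = (fun x => u i x - p x i) + fun _ => - m i := by
        ext x; simp only [hFi, Pi.add_apply]; ring
      rw [e]
      refine (lpNorm_add_le (hdi i) one_le_two).trans ?_
      rw [lpNorm_const two_ne_zero (NeZero.ne γ)]
      have := hun i
      have := hm i
      simp only [norm_neg, Real.norm_eq_abs, probReal_univ, Real.one_rpow, mul_one]
      linarith
    have hFn : ∀ i, lpNorm (fun x => F x i) 2 γ ≤ 1 + 2 * η := by
      intro i
      have e : (fun x => F x i) = (fun x => p x i) + fun x => F x i - p x i := by
        ext x; simp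
      rw [e]
      refine (lpNorm_add_le (hpi i) one_le_two).trans ?_
      rw [hn]
      linarith [hFp i]
    have hcovF : ∀ i j, |∫ x, F x i * F x j ∂γ - if i = j then 1 else 0| ≤
        2 * η * (1 + 2 * η) + 2 * η := by
      intro i j
      rw [← hcov i j, ← integral_sub (hmul (hF2 i) (hF2 j)) (hmul (hpi i) (hpi j))]
      have e : ∀ x, F x i * F x j - p x i * p x j =
          (F x i - p x i) * F x j + p x i * (F x j - p x j) := fun x => by ring
      simp_rw [e]
      rw [integral_add (hmul (hFd i) (hF2 j)) (hmul (hpi i) (hFd j))]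
      refine (abs_add_le _ _).trans (add_le_add ?_ ?_)
      · refine (abs_integral_mul_le_lpNorm (hFd i) (hF2 j)).trans ?_
        exact mul_le_mul (hFp i) (hFn j) lpNorm_nonneg (by positivity)
      · refine (abs_integral_mul_le_lpNorm (hpi i) (hFd j)).trans ?_
        rw [hn, one_mul]
        exact hFp j
    have hFC : ∀ x, ‖F x‖ ≤ ∑ i, (|C i| + |m i|) := by
      intro x
      refine (EuclideanSpace.norm_le_sum _).trans (Finset.sum_le_sum fun i _ => ?_)
      rw [hFi]
      exact (norm_sub_le _ _).trans (add_le_add ((hu1 i x).trans (le_abs_self _)) le_rfl)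
    set M := max (∑ i, (|C i| + |m i|)) (∑ i, |C i|)
    have hmain := abs_integral_comp_sub_integral_stdGaussian_le_of_deriv (F := F) (G := U) (H := V)
      (C := M) (fun i x => (hU i x).sub_const (m i)) hV hVc
      (fun x => (hFC x).trans (le_max_left _ _))
      (fun i x => ((hU1 i x).trans (hCle i)).trans (le_max_right _ _))
      (fun i x => ((hV1 i x).trans (hCle i)).trans (le_max_right _ _))
      (fun i => by
        simp_rw [hFi]
        rw [integral_sub ((hu2 i).integrable one_le_two) (integrable_const _)]
        simp [m, γ]) hh hk hKc hk1 hKC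
    have hdiff : |∫ x, h (F x) ∂γ - ∫ x, h (p x) ∂γ| ≤ ∑ i : Fin r, 2 * η := by
      refine (abs_integral_comp_sub_integral_comp_le hh hk1 (hF2'.integrable one_le_two)
        (hp2.integrable one_le_two)).trans ?_
      have hi : ∀ i, Integrable (fun x => ‖F x i - p x i‖) γ := fun i =>
        ((hFd i).integrable one_le_two).norm
      calc ∫ x, ‖F x - p x‖ ∂γ ≤ ∫ x, ∑ i, ‖F x i - p x i‖ ∂γ :=
            integral_mono_of_nonneg (ae_of_all _ fun x => norm_nonneg _)
              (integrable_finsetSum _ fun i _ => hi i)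
              (ae_of_all _ fun x => EuclideanSpace.norm_le_sum _)
        _ = ∑ i, ∫ x, ‖F x i - p x i‖ ∂γ := integral_finsetSum _ fun i _ => hi i
        _ ≤ _ := Finset.sum_le_sum fun i _ =>
            (integral_norm_le_lpNorm_two (hFd i)).trans (hFp i)
    have htri := abs_sub_le (∫ x, h (p x) ∂γ) (∫ x, h (F x) ∂γ)
      (∫ n, h n ∂(stdGaussian (EuclideanSpace ℝ (Fin r))))
    rw [abs_sub_comm] at hdiff
    refine htri.trans ((add_comm _ _).trans_le (add_le_add (hmain.trans ?_) hdiff))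
    have e₁ : ∀ i, Real.sqrt (∫ x, ‖U i x‖ ^ 2 ∂(stdGaussian (EuclideanSpace ℝ (Fin d)))) =
        lpNorm (U i) 2 γ := fun i => sqrt_integral_norm_sq (hU2 i)
    have e₂ : ∀ i, Real.sqrt (∫ x, ‖V i x‖ ^ 2 ∂(stdGaussian (EuclideanSpace ℝ (Fin d)))) =
        lpNorm (V i) 2 γ := fun i => sqrt_integral_norm_sq (hV2 i)
    simp_rw [e₁, e₂]
    have hG0 : ∀ i, 0 ≤ lpNorm (G i) 2 γ + η := fun i => add_nonneg lpNorm_nonneg hη.le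
    gcongr with i _ i _ i _ j _
    · exact Finset.sum_nonneg fun i _ => lpNorm_nonneg
    · exact Finset.sum_nonneg fun i _ => hG0 i
    · exact hUn i
    · exact hVn i
    · exact hcovF i j
  -- The bound is a polynomial in η; letting η decrease to 0 removes all error terms.
  have hcont : Continuous fun η : ℝ => Real.sqrt (2 / Real.pi) * (3 * Real.pi / 4 *
        ((∑ i, (lpNorm (G i) 2 γ + η)) * ∑ j, (lpNorm (H j) 2 γ + η)) +
          ∑ i : Fin r, ∑ j : Fin r, (2 * η * (1 + 2 * η) + 2 * η)) + ∑ i : Fin r, 2 * η := by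
    fun_prop
  have hlim := (hcont.tendsto 0).mono_left (nhdsWithin_le_nhds (s := Set.Ioi 0))
  have hres := ge_of_tendsto hlim (Filter.eventually_of_mem self_mem_nhdsWithin fun η hη => key η hη)
  simpa using hres

end SobolevBound

/-! ### The Wasserstein bound for derivatives in L⁴(γ). -/

section SecondOrderPoincare

variable {d r : ℕ}

/-- The argument yields about 1.88, below the required 4/√π, which is about 2.26. -/
lemma sqrt_two_div_pi_mul_le :
    Real.sqrt (2 / Real.pi) * (3 * Real.pi / 4) ≤ 4 / Real.sqrt Real.pi := by
  have hπ := Real.pi_pos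
  rw [Real.sqrt_div (by norm_num), le_div_iff₀ (Real.sqrt_pos.2 hπ), div_mul_eq_mul_div,
    div_mul_cancel₀ _ (Real.sqrt_pos.2 hπ).ne']
  have h2 : Real.sqrt 2 ≤ 1.5 := Real.sqrt_le_iff.2 ⟨by norm_num, by norm_num⟩
  nlinarith [Real.pi_lt_d2, Real.sqrt_nonneg 2]

/-- The second order Gaussian Poincaré inequality in Wasserstein distance, for derivatives in
`L⁴(γ)`. -/
lemma wassersteinOne_map_stdGaussian_le
    {p : EuclideanSpace ℝ (Fin d) → EuclideanSpace ℝ (Fin r)}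
    {G : Fin r → EuclideanSpace ℝ (Fin d) → EuclideanSpace ℝ (Fin d)}
    {H : Fin r → EuclideanSpace ℝ (Fin d) →
      EuclideanSpace ℝ (Fin d) →L[ℝ] EuclideanSpace ℝ (Fin d)}
    (hp : ∀ i, HasWeakGradientHessian (fun x => p x i) (G i) (H i))
    (hp2 : MemLp p 2 (stdGaussian (EuclideanSpace ℝ (Fin d))))
    (hG4 : ∀ i, MemLp (G i) 4 (stdGaussian (EuclideanSpace ℝ (Fin d))))
    (hH4 : ∀ i, MemLp (H i) 4 (stdGaussian (EuclideanSpace ℝ (Fin d))))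
    (hmean : ∀ i, ∫ x, p x i ∂(stdGaussian (EuclideanSpace ℝ (Fin d))) = 0)
    (hcov : ∀ i j, ∫ x, p x i * p x j ∂(stdGaussian (EuclideanSpace ℝ (Fin d))) =
      if i = j then 1 else 0) :
    wassersteinOne ((stdGaussian (EuclideanSpace ℝ (Fin d))).map p)
        (stdGaussian (EuclideanSpace ℝ (Fin r))) ≤
      ENNReal.ofReal (4 / Real.sqrt Real.pi) *
        (∑ i, eLpNorm (G i) 4 (stdGaussian (EuclideanSpace ℝ (Fin d)))) *
        (∑ j, eLpNorm (H j) 4 (stdGaussian (EuclideanSpace ℝ (Fin d)))) := by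
  set γ := stdGaussian (EuclideanSpace ℝ (Fin d))
  have h24 : (2 : ℝ≥0∞) ≤ 4 := by norm_num
  have hG2 : ∀ i, MemLp (G i) 2 γ := fun i => (hG4 i).mono_exponent h24
  have hH2 : ∀ i, MemLp (H i) 2 γ := fun i => (hH4 i).mono_exponent h24
  have hpm : AEMeasurable p γ := hp2.1.aemeasurable
  have : IsProbabilityMeasure (γ.map p) := Measure.isProbabilityMeasure_map hpm
  -- The bound holds with L² norms; the exponent 4 enters by monotonicity of norms under a
  -- probability measure.
  have hsum : ∀ {F : Type} [NormedAddCommGroup F] {f : Fin r → EuclideanSpace ℝ (Fin d) → F},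
      (∀ i, MemLp (f i) 4 γ) →
      ENNReal.ofReal (∑ i, lpNorm (f i) 2 γ) ≤ ∑ i, eLpNorm (f i) 4 γ := by
    intro F _ f hf
    rw [ENNReal.ofReal_sum_of_nonneg fun i _ => lpNorm_nonneg]
    refine Finset.sum_le_sum fun i _ => ?_
    rw [ofReal_lpNorm ((hf i).mono_exponent h24)]
    exact eLpNorm_le_eLpNorm_of_exponent_le h24 (hf i).1
  refine (wassersteinOne_le_of_forall_smooth
    ((integrable_map_measure aestronglyMeasurable_id hpm).2 (hp2.integrable one_le_two))
    ((integrable_norm_iff aestronglyMeasurable_id).1 integrable_norm_stdGaussian)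
    (C := Real.sqrt (2 / Real.pi) * (3 * Real.pi / 4 *
      ((∑ i, lpNorm (G i) 2 γ) * ∑ j, lpNorm (H j) 2 γ))) ?_).trans ?_
  · intro h k K C' hh hk hKc hk1 hKC
    have hc : Continuous h := continuous_iff_continuousAt.2 fun x => (hh x).continuousAt
    rw [integral_map hpm hc.aestronglyMeasurable]
    exact abs_integral_comp_sub_integral_stdGaussian_le_of_weakDeriv hp hp2 hG2 hH2 hmean hcov
      hh hk hKc hk1 hKC
  · rw [← mul_assoc, ← mul_assoc, ENNReal.ofReal_mul (by
      have : 0 ≤ ∑ i, lpNorm (G i) 2 γ := Finset.sum_nonneg fun i _ => lpNorm_nonneg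
      positivity), ENNReal.ofReal_mul (by positivity)]
    exact mul_le_mul' (mul_le_mul' (ENNReal.ofReal_le_ofReal sqrt_two_div_pi_mul_le) (hsum hG4))
      (hsum hH4)

lemma ae_eq_zero_of_sum_eLpNorm_eq_zero {ι α F : Type*} [Fintype ι] [MeasurableSpace α]
    [NormedAddCommGroup F] {μ : Measure α} {f : ι → α → F}
    (hf : ∀ i, AEStronglyMeasurable (f i) μ) (h : ∑ i, eLpNorm (f i) 4 μ = 0) (i : ι) :
    f i =ᵐ[μ] 0 :=
  (eLpNorm_eq_zero_iff (hf i) (by norm_num)).1 (Finset.sum_eq_zero_iff.1 h i (Finset.mem_univ i))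

lemma lintegral_enorm_pow_four_rpow {α F : Type*} [MeasurableSpace α] [NormedAddCommGroup F]
    (f : α → F) (μ : Measure α) :
    (∫⁻ x, ‖f x‖ₑ ^ 4 ∂μ) ^ (1 / 4 : ℝ) = eLpNorm f 4 μ := by
  rw [eLpNorm_eq_lintegral_rpow_enorm_toReal (by norm_num) (by norm_num)]
  have h : (4 : ℝ≥0∞).toReal = ((4 : ℕ) : ℝ) := by simp
  simp only [h, ENNReal.rpow_natCast]
  norm_num

end SecondOrderPoincare

/-! ### Transfer to the law of X, and the cases of infinite norms. -/

theorem lemma1 {Ω : Type*} [MeasurableSpace Ω] (P : Measure Ω) [IsProbabilityMeasure P]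
    (d r : ℕ) (X : Ω → EuclideanSpace ℝ (Fin d))
    (hX : HasLaw X (stdGaussian (EuclideanSpace ℝ (Fin d))) P)
    (p : EuclideanSpace ℝ (Fin d) → EuclideanSpace ℝ (Fin r))
    (gradp : Fin r → EuclideanSpace ℝ (Fin d) → EuclideanSpace ℝ (Fin d))
    (hessp : Fin r → EuclideanSpace ℝ (Fin d) →
      EuclideanSpace ℝ (Fin d) →L[ℝ] EuclideanSpace ℝ (Fin d))
    (hderiv : ∀ i, HasWeakGradientHessian (fun x => p x i) (gradp i) (hessp i))
    (hL2 : MemLp (fun ω => p (X ω)) 2 P)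
    (hmean : ∫ ω, p (X ω) ∂P = 0)
    (hcov : ∀ i j, cov[fun ω => p (X ω) i, fun ω => p (X ω) j; P] = if i = j then 1 else 0) :
    wassersteinOne (P.map (fun ω => p (X ω))) (stdGaussian (EuclideanSpace ℝ (Fin r))) ≤
      ENNReal.ofReal (4 / Real.sqrt Real.pi) *
        (∑ i, (∫⁻ ω, ‖gradp i (X ω)‖ₑ ^ 4 ∂P) ^ (1 / 4 : ℝ)) *
        (∑ j, (∫⁻ ω, ‖hessp j (X ω)‖ₑ ^ 4 ∂P) ^ (1 / 4 : ℝ)) := by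
  set γ := stdGaussian (EuclideanSpace ℝ (Fin d)) with hγ
  have hγv : γ ≪ volume := stdGaussian_absolutelyContinuous
  have hvγ : volume ≪ γ := volume_absolutelyContinuous_stdGaussian
  have mG : ∀ i, AEStronglyMeasurable (gradp i) γ := fun i =>
    (hderiv i).2.locallyIntegrable.aestronglyMeasurable.mono_ac hγv
  have mH : ∀ i, AEStronglyMeasurable (hessp i) γ := fun i =>
    (hderiv i).2.locallyIntegrable_deriv.aestronglyMeasurable.mono_ac hγv
  have mpi : ∀ i, AEMeasurable (fun x => p x i) γ := fun i =>
    ((hderiv i).1.locallyIntegrable.aestronglyMeasurable.mono_ac hγv).aemeasurable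
  have mp : AEMeasurable p γ :=
    (WithLp.measurable_toLp 2 _).comp_aemeasurable (aemeasurable_pi_iff.2 mpi)
  have hp2 : MemLp p 2 γ := by
    rw [← hX.map_eq]
    refine (memLp_map_measure_iff ?_ hX.aemeasurable).2 hL2
    rw [hX.map_eq]
    exact mp.aestronglyMeasurable
  have hlaw : P.map (fun ω => p (X ω)) = γ.map p := by
    rw [← hX.map_eq] at mp ⊢
    rw [AEMeasurable.map_map_of_aemeasurable mp hX.aemeasurable]
    rfl
  have hmean' : ∀ i, ∫ x, p x i ∂γ = 0 := by
    intro i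
    have h1 : ∫ x, p x ∂γ = 0 := by rw [← hX.integral_comp hp2.1]; exact hmean
    have h2 := (EuclideanSpace.proj (𝕜 := ℝ) i).integral_comp_comm (hp2.integrable one_le_two)
    rw [h1, map_zero] at h2
    exact h2
  have hcov' : ∀ i j, ∫ x, p x i * p x j ∂γ = if i = j then 1 else 0 := by
    intro i j
    rw [← hcov i j, hX.covariance_fun_comp (f := fun x => p x i) (g := fun x => p x j) (mpi i)
      (mpi j)]
    simp [covariance, hmean']
  have eG : ∀ i, (∫⁻ ω, ‖gradp i (X ω)‖ₑ ^ 4 ∂P) ^ (1 / 4 : ℝ) = eLpNorm (gradp i) 4 γ := by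
    intro i
    rw [hX.lintegral_comp (f := fun x => ‖gradp i x‖ₑ ^ 4) ((mG i).enorm.pow_const _),
      lintegral_enorm_pow_four_rpow]
  have eH : ∀ i, (∫⁻ ω, ‖hessp i (X ω)‖ₑ ^ 4 ∂P) ^ (1 / 4 : ℝ) = eLpNorm (hessp i) 4 γ := by
    intro i
    rw [hX.lintegral_comp (f := fun x => ‖hessp i x‖ₑ ^ 4) ((mH i).enorm.pow_const _),
      lintegral_enorm_pow_four_rpow]
  simp_rw [hlaw, eG, eH]
  have hc : ENNReal.ofReal (4 / Real.sqrt Real.pi) ≠ 0 :=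
    (ENNReal.ofReal_pos.2 (by positivity)).ne'
  -- As ∞ · 0 = 0, an infinite factor makes the bound trivial only if the other factor is nonzero.
  -- Were all Hessians zero, the gradients would be constant and their norms finite.
  by_cases hGt : ∑ i, eLpNorm (gradp i) 4 γ = ∞
  · have hH0 : ∑ i, eLpNorm (hessp i) 4 γ ≠ 0 := by
      intro h0
      refine absurd hGt (ENNReal.sum_ne_top.2 fun i _ => ?_)
      obtain ⟨c, hc⟩ := (hderiv i).2.exists_ae_eq_const
        (hvγ.ae_eq (ae_eq_zero_of_sum_eLpNorm_eq_zero mH h0 i))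
      rw [eLpNorm_congr_ae (hγv.ae_eq hc)]
      exact (memLp_const c).eLpNorm_ne_top
    rw [hGt, ENNReal.mul_top hc, ENNReal.top_mul hH0]
    exact le_top
  by_cases hHt : ∑ i, eLpNorm (hessp i) 4 γ = ∞
  · have hG0 : ∑ i, eLpNorm (gradp i) 4 γ ≠ 0 := by
      intro h0
      -- Were all gradients zero, each p_i would be constant, hence 0 by centring, against its unit
      -- variance.
      refine absurd hHt (ENNReal.sum_ne_top.2 fun i _ => absurd (hcov' i i) ?_)
      obtain ⟨c, hc⟩ := HasWeakFDeriv.exists_ae_eq_const (hderiv i).1 (by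
        filter_upwards [hvγ.ae_eq (ae_eq_zero_of_sum_eLpNorm_eq_zero mG h0 i)] with x hx
        simp [hx])
      have hc' := hγv.ae_eq hc
      have h1 := hmean' i
      rw [integral_congr_ae hc'] at h1
      have h2 : c = 0 := by simpa [hγ] using h1
      rw [integral_congr_ae (g := fun _ => (0 : ℝ)) (by
        filter_upwards [hc'] with x hx
        rw [hx, h2, mul_zero])]
      simp
    rw [hHt, ENNReal.mul_top (mul_ne_zero hc hG0)]
    exact le_top
  exact wassersteinOne_map_stdGaussian_le hderiv hp2
    (fun i => ⟨mG i, (ENNReal.sum_ne_top.1 hGt i (Finset.mem_univ i)).lt_top⟩)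
    (fun i => ⟨mH i, (ENNReal.sum_ne_top.1 hHt i (Finset.mem_univ i)).lt_top⟩) hmean' hcov'
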